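/- For an integer $n\ge 1$ and integers $a_1,a_2,a_3,b$, let $\mathrm{eq}(a_1,a_2,a_3,b)$ denote the equation $a_1x_1+a_2x_2+a_3x_3=b$. A solution in $\mathbb{Z}_n$ is a triple $(s_1,s_2,s_3)\in\mathbb{Z}_n^3$ with $a_1s_1+a_2s_2+a_3s_3\equiv b \pmod n$. An exact $r$-coloring of $\mathbb{Z}_n$ is a surjective function $c:\mathbb{Z}_n\to\{1,\dots,r\}$. A solution $(s_1,s_2,s_3)$ is rainbow for $c$ if $c(s_1),c(s_2),c(s_3)$ are pairwise distinct. The rainbow number $\mathrm{rb}(\mathbb{Z}_n,\mathrm{eq}(a_1,a_2,a_3,b))$ is the smallest positive integer $r$ such that every exact $r$-coloring of $\mathbb{Z}_n$ has a rainbow solution to $\mathrm{eq}(a_1,a_2,a_3,b)$. (There is no exact $(n+1)$-coloring, so this number is at most $n+1$, and it equals $n+1$ if an exact $n$-coloring of $\mathbb{Z}_n$ has no rainbow solution.) Theorem. Let $n=p_1^{\alpha_1}p_2^{\alpha_2}\cdots p_\ell^{\alpha_\ell}$ with $p_k$ prime for $1\le k\le \ell$, and let $a_1,a_2,a_3,b$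 be integers such that $a_1a_2a_3$ is a unit modulo $n$. Suppose that one of the following holds: 1. $b\not\equiv 0\pmod n$ and $a_1+a_2+a_3$ is a unit modulo $n$; 2. $b\equiv 0\pmod n$ and $3\nmid n$; 3. $b\equiv 0\pmod n$, $3\mid n$, and $a_1+a_2+a_3$ is a unit modulo $3$. Then $$\mathrm{rb}(\mathbb{Z}_n,\mathrm{eq}(a_1,a_2,a_3,b)) = 2+\sum_{k=1}^{\ell}\alpha_k\bigl(\mathrm{rb}(\mathbb{Z}_{p_k},\mathrm{eq}(a_1,a_2,a_3,b))-2\bigr).$$ -/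

import Mathlib

/-- `(s₁, s₂, s₃)` is a solution in `ℤ/n` of `a₁x₁ + a₂x₂ + a₃x₃ = b`; the integer coefficients are
read modulo `n`. -/
def IsSolution (n : ℕ) (a₁ a₂ a₃ b : ℤ) (s₁ s₂ s₃ : ZMod n) : Prop :=
  (a₁ : ZMod n) * s₁ + (a₂ : ZMod n) * s₂ + (a₃ : ZMod n) * s₃ = (b : ZMod n)

/-- The colouring `c` of `ℤ/n` has a rainbow solution: one whose three entries receive pairwise
distinct colours. -/
def HasRainbowSolution (n : ℕ) (a₁ a₂ a₃ b : ℤ) {r : ℕ} (c : ZMod n → Fin r) : Prop :=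
  ∃ s₁ s₂ s₃ : ZMod n, IsSolution n a₁ a₂ a₃ b s₁ s₂ s₃ ∧
    c s₁ ≠ c s₂ ∧ c s₁ ≠ c s₃ ∧ c s₂ ≠ c s₃

/-- The rainbow number of `ℤ/n` for `a₁x₁ + a₂x₂ + a₃x₃ = b`: the smallest positive integer `r` such
that every exact (i.e. surjective) `r`-colouring of `ℤ/n` has a rainbow solution. For `n ≥ 1` there
is no exact `(n + 1)`-colouring, so `r = n + 1` always has this property vacuously. Hence the
minimum exists and is at most `n + 1`, with value `n + 1` when the exact `n`-colouring has no
rainbow solution. -/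
noncomputable def rainbowNumber (n : ℕ) (a₁ a₂ a₃ b : ℤ) : ℕ :=
  sInf {r : ℕ | 0 < r ∧ ∀ c : ZMod n → Fin r, Function.Surjective c →
    HasRainbowSolution n a₁ a₂ a₃ b c}

/-- The set defining `rainbowNumber` is nonempty, as it contains `n + 1`. -/
theorem rainbowNumber_set_nonempty (n : ℕ) (hn : 0 < n) (a₁ a₂ a₃ b : ℤ) :
    n + 1 ∈ {r : ℕ | 0 < r ∧ ∀ c : ZMod n → Fin r, Function.Surjective c →
      HasRainbowSolution n a₁ a₂ a₃ b c} := by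
  refine ⟨Nat.succ_pos n, fun c hc => ?_⟩
  have : NeZero n := ⟨hn.ne'⟩
  have h := Fintype.card_le_of_surjective c hc
  rw [Fintype.card_fin, ZMod.card] at h
  omega

/-! Each of the three cases makes `(a₁ + a₂ + a₃) t = b` solvable modulo `n` and modulo every
divisor of `n`, so translating by `t` reduces to `b = 0`. Merging colours creates no rainbow
solution. Hence the rainbow number is one more than the largest number of colours in a rainbow-free
colouring. This maximum is 1 for the trivial group, and multiplying the modulus by a prime `p`
raises it by an amount depending only on `p` and the coefficients: 1 if the multipliers `-(a i / a
j)` act transitively on the nonzero residues (`Good`), and 2 otherwise (`MaxColours.mul`). The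
modulus `p` itself identifies this amount with `rb(ℤ/p) - 2`, and the formula follows by additivity.

Lower bound: colour the multiples of `p` in `ℤ/pm` by an optimal colouring of `ℤ/m`, and everything
else by membership of the residue mod `p` in a set closed under the multipliers
(`rainbowFree_extend`).

Upper bound: cut `ℤ/pm` into cosets of the subgroup of order `p`, called lines and indexed by `ℤ/m`.
Let `M` be the maximum for `ℤ/m`. If line `j` is not constant, every line has at most one colour
missing from `j`. Recording that colour gives a rainbow-free colouring of `ℤ/m`, so there are at
most `M - 1 + #(pal X j)` colours. A line never has four colours (`not_fourFree`), which gives `M +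
2`. For good coefficients a line with two colours gives `M + 1` at once. Otherwise, for `p ≥ 5`, all
nonconstant lines have the same three colours (`pal_subset`, through `not_singles`). There are at
least two such lines, since a single one would be a rainbow-free three-colouring of `ℤ/p`, which
`TriColoring.elim` excludes. Replacing their three colours by two new ones gives a rainbow-free
colouring of `ℤ/m`, hence `M + 1` again.

The facts about `ℤ/p` rest on Cauchy–Davenport and Vosper, phrased through `bdry A d = #(A + {0, d})
- #A`; for a nontrivial set, `bdry A d ≤ 1` with `d ≠ 0` means a progression of difference `d`. In a
rainbow-free three-colouring a small boundary in direction `τ` passes to another class in direction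
`(a s / a t) τ`. Goodness then spreads it to all directions, against the identity `∑ d, bdry A d =
#A * (p - #A)`. -/

namespace RainbowZMod

open Finset
open scoped Pointwise

/-! ### Boundaries of subsets of `ℤ/p` under translation -/

section Boundary

variable {p : ℕ} [Fact p.Prime]

/-- The number of elements of `A` that leave `A` under translation by `d`. -/
def bdry (A : Finset (ZMod p)) (d : ZMod p) : ℕ := #{x ∈ A | x + d ∉ A}

/-- The dilate of a finite set. -/
def dil (c : ZMod p) (A : Finset (ZMod p)) : Finset (ZMod p) := A.image (c * ·)

/-- The translate of a finite set. -/
def shift (t : ZMod p) (A : Finset (ZMod p)) : Finset (ZMod p) := A.image (t + ·)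

theorem mem_shift {t : ZMod p} {A : Finset (ZMod p)} {x : ZMod p} :
    x ∈ shift t A ↔ x - t ∈ A := by
  simp only [shift, mem_image]
  constructor
  · rintro ⟨a, ha, rfl⟩; simpa using ha
  · intro h; exact ⟨x - t, h, by ring⟩

theorem mem_dil {c : ZMod p} (hc : c ≠ 0) {A : Finset (ZMod p)} {x : ZMod p} :
    x ∈ dil c A ↔ c⁻¹ * x ∈ A := by
  simp only [dil, mem_image]
  constructor
  · rintro ⟨a, ha, rfl⟩; simpa [hc] using ha
  · intro h; exact ⟨c⁻¹ * x, h, by field_simp⟩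

theorem mul_mem_dil {c : ZMod p} {A : Finset (ZMod p)} {x : ZMod p} (hx : x ∈ A) :
    c * x ∈ dil c A := mem_image_of_mem _ hx

theorem card_shift (t : ZMod p) (A : Finset (ZMod p)) : #(shift t A) = #A :=
  card_image_of_injective _ (add_right_injective t)

theorem card_dil {c : ZMod p} (hc : c ≠ 0) (A : Finset (ZMod p)) : #(dil c A) = #A :=
  card_image_of_injective _ (mul_right_injective₀ hc)

theorem card_le_prime (A : Finset (ZMod p)) : #A ≤ p := by
  simpa [ZMod.card] using card_le_univ A

theorem card_compl_zmod (A : Finset (ZMod p)) : #Aᶜ = p - #A := by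
  rw [card_compl, ZMod.card]

theorem bdry_le_card (A : Finset (ZMod p)) (d : ZMod p) : bdry A d ≤ #A := card_filter_le _ _

theorem bdry_le_one_iff {A : Finset (ZMod p)} {d : ZMod p} :
    bdry A d ≤ 1 ↔ ∀ x ∈ A, ∀ y ∈ A, x + d ∉ A → y + d ∉ A → x = y := by
  unfold bdry
  rw [card_le_one]
  simp only [mem_filter]
  constructor
  · intro h x hx y hy h1 h2; exact h x ⟨hx, h1⟩ y ⟨hy, h2⟩
  · rintro h x ⟨hx, h1⟩ y ⟨hy, h2⟩; exact h x hx y hy h1 h2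

theorem add_pair (A : Finset (ZMod p)) (d : ZMod p) : A + {0, d} = A ∪ shift d A := by
  ext x
  simp only [mem_add, mem_insert, mem_singleton, mem_union, mem_shift]
  constructor
  · rintro ⟨a, ha, b, rfl | rfl, rfl⟩
    · left; simpa using ha
    · right; simpa using ha
  · rintro (h | h)
    · exact ⟨x, h, 0, by simp, by simp⟩
    · exact ⟨x - d, h, d, by simp, by simp⟩

theorem card_union_shift (A : Finset (ZMod p)) (d : ZMod p) :
    #(A ∪ shift d A) = #A + bdry A d := by
  rw [← union_sdiff_self_eq_union, card_union_of_disjoint disjoint_sdiff]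
  congr 1
  unfold bdry
  rw [← card_shift d {x ∈ A | x + d ∉ A}]
  congr 1
  ext x
  simp only [mem_sdiff, mem_shift, mem_filter, sub_add_cancel]

theorem card_add_pair (A : Finset (ZMod p)) (d : ZMod p) : #(A + {0, d}) = #A + bdry A d := by
  rw [add_pair, card_union_shift]

theorem card_inter_shift (A : Finset (ZMod p)) (d : ZMod p) :
    #(A ∩ shift d A) + bdry A d = #A := by
  have h := card_union_add_card_inter A (shift d A)
  rw [card_union_shift, card_shift] at h
  omega

theorem bdry_shift (t : ZMod p) (A : Finset (ZMod p)) (d : ZMod p) :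
    bdry (shift t A) d = bdry A d := by
  unfold bdry
  rw [← card_shift t {x ∈ A | x + d ∉ A}]
  congr 1
  ext x
  simp only [mem_filter, mem_shift]
  rw [show x + d - t = x - t + d by ring]

theorem bdry_neg (A : Finset (ZMod p)) (d : ZMod p) : bdry A (-d) = bdry A d := by
  have h1 := card_inter_shift A d
  have h2 := card_inter_shift A (-d)
  have h3 : #(A ∩ shift (-d) A) = #(A ∩ shift d A) := by
    rw [← card_shift d (A ∩ shift (-d) A)]
    congr 1
    ext x
    simp only [mem_inter, mem_shift]
    rw [show x - d - -d = x by ring]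
    exact and_comm
  omega

theorem bdry_compl (A : Finset (ZMod p)) (d : ZMod p) : bdry Aᶜ d = bdry A d := by
  rw [← bdry_neg A]
  unfold bdry
  rw [← card_shift d {x ∈ Aᶜ | _}]
  congr 1
  ext x
  simp only [mem_filter, mem_shift, mem_compl, not_not, sub_add_cancel, ← sub_eq_add_neg]
  exact and_comm

theorem bdry_dil {c : ZMod p} (hc : c ≠ 0) (A : Finset (ZMod p)) (d : ZMod p) :
    bdry (dil c A) (c * d) = bdry A d := by
  unfold bdry
  rw [← card_dil hc {x ∈ A | x + d ∉ A}]
  congr 1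
  ext x
  simp only [mem_filter, mem_dil hc]
  rw [show c⁻¹ * (x + c * d) = c⁻¹ * x + d by field_simp]

theorem bdry_dil' {c : ZMod p} (hc : c ≠ 0) (A : Finset (ZMod p)) (d : ZMod p) :
    bdry (dil c A) d = bdry A (c⁻¹ * d) := by
  rw [← bdry_dil hc A, mul_inv_cancel_left₀ hc]

theorem bdry_zero (A : Finset (ZMod p)) : bdry A 0 = 0 := by
  unfold bdry
  rw [card_eq_zero, filter_eq_empty_iff]
  intro x hx; simpa using hx

/-- A set closed under a nonzero translation is trivial. -/
theorem eq_univ_of_add_mem {A : Set (ZMod p)} {d : ZMod p} (hd : d ≠ 0)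
    (h : ∀ x ∈ A, x + d ∈ A) {x : ZMod p} (hx : x ∈ A) (y : ZMod p) : y ∈ A := by
  have key : ∀ k : ℕ, x + k * d ∈ A := by
    intro k
    induction k with
    | zero => simpa using hx
    | succ k ih => have := h _ ih; rwa [add_assoc, ← add_one_mul, ← Nat.cast_succ] at this
  have h2 := key (((y - x) * d⁻¹).val)
  rw [ZMod.natCast_zmod_val] at h2
  convert h2 using 1
  field_simp
  ring

theorem bdry_pos {A : Finset (ZMod p)} {d : ZMod p} (hd : d ≠ 0) (hA : A.Nonempty)
    (hp : #A < p) : 0 < bdry A d := by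
  by_contra h0
  have h1 : ∀ x ∈ A, x + d ∈ A := by
    intro x hx
    by_contra h2
    exact h0 (card_pos.2 ⟨x, mem_filter.2 ⟨hx, h2⟩⟩)
  obtain ⟨x, hx⟩ := hA
  have : A = univ := by
    ext y
    simpa using eq_univ_of_add_mem (A := (A : Set (ZMod p))) hd (by simpa using h1) (by simpa using hx) y
  rw [this, card_univ, ZMod.card] at hp
  omega

/-- Double counting: each element of `A` leaves `A` for exactly `p - #A` translations. Uniform
bounds on the boundary are played against this total. -/
theorem sum_bdry (A : Finset (ZMod p)) : ∑ d, bdry A d = #A * (p - #A) := by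
  unfold bdry
  simp_rw [card_filter]
  rw [sum_comm, ← smul_eq_mul, ← sum_const]
  refine sum_congr rfl fun x _ => ?_
  rw [← card_filter, ← card_compl_zmod A]
  rw [← card_shift (-x) Aᶜ]
  congr 1
  ext d
  simp [mem_shift, add_comm]

theorem sum_bdry_ne_zero (A : Finset (ZMod p)) :
    ∑ d ∈ univ.erase (0 : ZMod p), bdry A d = #A * (p - #A) := by
  rw [← sum_bdry, ← add_sum_erase _ _ (mem_univ (0 : ZMod p)), bdry_zero, zero_add]

/-- The structure of a set with a single exit in direction `d`. -/
theorem exists_progression {A : Finset (ZMod p)} {d : ZMod p} (hd : d ≠ 0) (hA : A.Nonempty)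
    (hp : #A < p) (h : bdry A d ≤ 1) :
    ∃ e, ∀ i < #A, e - (i : ZMod p) * d ∈ A := by
  obtain ⟨e, he⟩ := card_pos.1 (bdry_pos hd hA hp)
  rw [mem_filter] at he
  rw [bdry_le_one_iff] at h
  refine ⟨e, fun i => ?_⟩
  induction i using Nat.strong_induction_on with
  | _ i ih =>
    intro hi
    by_contra hn
    -- If walking back from the exit `e` first leaves `A` at step `i`, the elements of `A` not yet
    -- visited are stable under adding `d`; were there any, they would fill `ℤ/p`, yet `e - i * d ∉
    -- A`. So `A` has at most `i` elements.
    have hsub : ∀ x ∈ A, x ∉ (range i).image (fun j : ℕ => e - (j : ZMod p) * d) → False := by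
      intro x hx hx'
      have := eq_univ_of_add_mem
        (A := {x | x ∈ A ∧ x ∉ (range i).image (fun j : ℕ => e - (j : ZMod p) * d)}) hd ?_
        ⟨hx, hx'⟩ (e - (i : ZMod p) * d)
      · exact hn this.1
      · rintro z ⟨hz, hz'⟩
        have hi0 : 0 < i := by
          rcases Nat.eq_zero_or_pos i with h0 | h0
          · exact absurd he.1 (by simpa [h0] using hn)
          · exact h0
        have hze : z ≠ e := by
          rintro rfl
          exact hz' (mem_image.2 ⟨0, by simpa using hi0, by simp⟩)
        refine ⟨?_, fun hc => ?_⟩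
        · by_contra hzd
          exact hze (h z hz e he.1 hzd he.2)
        · obtain ⟨j, hj, hjz⟩ := mem_image.1 hc
          have hz2 : z = e - ((j + 1 : ℕ) : ZMod p) * d := by
            push_cast; linear_combination -hjz
          rw [mem_range] at hj
          rcases Nat.lt_or_ge (j + 1) i with h1 | h1
          · exact hz' (mem_image.2 ⟨j + 1, by simpa using h1, hz2.symm⟩)
          · obtain rfl : i = j + 1 := by omega
            exact hn (hz2 ▸ hz)
    have : #A ≤ i := by
      calc #A ≤ #((range i).image (fun j : ℕ => e - (j : ZMod p) * d)) :=
            card_le_card fun x hx => by by_contra h'; exact hsub x hx h'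
        _ ≤ i := card_image_le.trans (by simp)
    omega

theorem natCast_injOn_lt {i j : ℕ} (hi : i < p) (hj : j < p) (h : (i : ZMod p) = j) : i = j := by
  have := (ZMod.natCast_eq_natCast_iff' i j p).1 h
  rwa [Nat.mod_eq_of_lt hi, Nat.mod_eq_of_lt hj] at this

/-- Small boundary in direction `τ` forces `τ` to be a small multiple of the difference. -/
theorem exists_small_multiple {A : Finset (ZMod p)} {d τ : ZMod p} {k : ℕ} (hd : d ≠ 0)
    (h : bdry A d ≤ 1) (hk : bdry A τ ≤ k) (hk1 : k < #A) (hk2 : k + #A < p) :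
    ∃ m ≤ k, τ = (m : ZMod p) * d ∨ τ = -((m : ZMod p) * d) := by
  obtain ⟨e, he⟩ := exists_progression hd (card_pos.1 (by omega)) (by omega) h
  have hA : A = (range #A).image (fun j : ℕ => e - (j : ZMod p) * d) := by
    symm
    apply eq_of_subset_of_card_le
    · intro x hx
      obtain ⟨j, hj, rfl⟩ := mem_image.1 hx
      exact he j (mem_range.1 hj)
    · rw [card_image_of_injOn]
      · simp
      · intro i hi j hj hij
        simp only [coe_range, Set.mem_Iio] at hi hj
        have : (i : ZMod p) = j := by
          apply mul_right_cancel₀ hd; linear_combination -hij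
        exact natCast_injOn_lt (by omega) (by omega) this
  rw [← bdry_neg] at hk
  set m := (τ * d⁻¹).val with hm
  have hτ : τ = (m : ZMod p) * d := by
    rw [hm, ZMod.natCast_zmod_val]; field_simp
  have hmp : m < p := ZMod.val_lt _
  -- Translation by `-τ` moves index `j` of the progression to `j + m`. The indices from `#A - m` on
  -- leave it as long as `j + m` does not wrap round past `p`.
  have key : min (min #A m) (min (p - m) (p - #A)) ≤ bdry A (-τ) := by
    have h1 : #((Finset.Ico (#A - m) (min #A (p - m))).image
        (fun j : ℕ => e - (j : ZMod p) * d)) ≤ bdry A (-τ) := by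
      apply card_le_card
      intro x hx
      obtain ⟨j, hj, rfl⟩ := mem_image.1 hx
      rw [mem_Ico] at hj
      rw [mem_filter]
      refine ⟨he j (by omega), fun hc => ?_⟩
      rw [hA] at hc
      obtain ⟨i, hi, hij⟩ := mem_image.1 hc
      rw [mem_range] at hi
      have : (i : ZMod p) = ((j + m : ℕ) : ZMod p) := by
        apply mul_right_cancel₀ hd
        push_cast
        rw [hτ] at hij
        linear_combination -hij
      have := natCast_injOn_lt (by omega) (by omega) this
      omega
    rw [card_image_of_injOn, Nat.card_Ico] at h1
    · omega
    · intro i hi j hj hij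
      simp only [coe_Ico, Set.mem_Ico] at hi hj
      have : (i : ZMod p) = j := by
        apply mul_right_cancel₀ hd; linear_combination -hij
      exact natCast_injOn_lt (by omega) (by omega) this
  by_cases hmk : m ≤ k
  · exact ⟨m, hmk, Or.inl hτ⟩
  · refine ⟨p - m, by omega, Or.inr ?_⟩
    rw [Nat.cast_sub hmp.le, hτ]
    simp

end Boundary

/-! ### Vosper's theorem and sets avoiding a linear equation -/

section Vosper

variable {p : ℕ} [hp : Fact p.Prime]

theorem card_add_ge {A B : Finset (ZMod p)} (hA : A.Nonempty) (hB : B.Nonempty)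
    (h : #(A + B) < p) : #A + #B ≤ #(A + B) + 1 := by
  have := ZMod.cauchy_davenport hp.out hA hB
  omega

/-- If the sumset of a critical pair is a progression, so is the first set. -/
theorem bdry_le_one_of_add {A B : Finset (ZMod p)} {d : ZMod p} (hd : d ≠ 0)
    (hA : 2 ≤ #A) (hB : 2 ≤ #B) (h : #(A + B) + 1 = #A + #B) (hp2 : #(A + B) + 2 ≤ p)
    (hS : bdry (A + B) d ≤ 1) : bdry A d ≤ 1 := by
  -- Duality: `A + C` misses `-B`, so `(A, C)` is again a critical pair, and `C` inherits the
  -- progression property from `A + B`.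
  set C := dil (-1) (A + B)ᶜ with hC
  have hC1 : #C = p - #(A + B) := by
    rw [hC, card_dil (by simp), card_compl_zmod]
  have hC2 : bdry C d ≤ 1 := by
    rw [hC, bdry_dil' (by simp), bdry_compl]
    simpa [bdry_neg, inv_neg] using hS
  have hAC : A + C ⊆ dil (-1) Bᶜ := by
    intro x hx
    obtain ⟨a, ha, c, hc, rfl⟩ := mem_add.1 hx
    rw [hC, mem_dil (by simp)] at hc
    rw [mem_dil (by simp)]
    simp only [mem_compl, inv_neg, inv_one, neg_mul, one_mul] at hc ⊢
    intro hb
    apply hc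
    exact mem_add.2 ⟨a, ha, _, hb, by ring⟩
  have hAC' : #(A + C) ≤ p - #B := by
    refine (card_le_card hAC).trans ?_
    rw [card_dil (by simp), card_compl_zmod]
  -- `C'` is `C` without its exit, so `{0, d} + C' ⊆ C`. Only one element is lost, and
  -- Cauchy–Davenport for `A + {0, d}` and `C'` leaves room for a boundary of at most 1.
  set C' := C.filter fun x => x + d ∈ C with hC'
  have hcard : #C' + bdry C d = #C := by
    unfold bdry
    exact card_filter_add_card_filter_not _
  have hsub : A + {0, d} + C' ⊆ A + C := by
    rw [add_assoc]
    apply add_subset_add_left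
    intro x hx
    obtain ⟨y, hy, c, hc, rfl⟩ := mem_add.1 hx
    rw [hC', mem_filter] at hc
    simp only [mem_insert, mem_singleton] at hy
    rcases hy with rfl | rfl
    · simpa using hc.1
    · rw [add_comm]; exact hc.2
  have h1 := card_le_card hsub
  have h2 := card_add_ge (A := A + {0, d}) (B := C')
    ((card_pos.1 (by omega : 0 < #A)).add (by simp)) (card_pos.1 (by omega)) (by omega)
  rw [card_add_pair] at h2
  omega

theorem bdry_add_le_one {A B : Finset (ZMod p)} {d : ZMod p}
    (hA : bdry A d ≤ 1) (hB : bdry B d ≤ 1) : bdry (A + B) d ≤ 1 := by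
  rw [bdry_le_one_iff] at *
  have key : ∀ a ∈ A, ∀ b ∈ B, a + b + d ∉ A + B → a + d ∉ A ∧ b + d ∉ B := by
    intro a ha b hb h
    exact ⟨fun h' => h (mem_add.2 ⟨_, h', _, hb, by ring⟩),
      fun h' => h (mem_add.2 ⟨_, ha, _, h', by ring⟩)⟩
  intro x hx y hy hxd hyd
  obtain ⟨a, ha, b, hb, rfl⟩ := mem_add.1 hx
  obtain ⟨a', ha', b', hb', rfl⟩ := mem_add.1 hy
  obtain ⟨h1, h2⟩ := key a ha b hb hxd
  obtain ⟨h3, h4⟩ := key a' ha' b' hb' hyd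
  rw [hA a ha a' ha' h1 h3, hB b hb b' hb' h2 h4]

/-- **Vosper's theorem**. -/
theorem vosper {A B : Finset (ZMod p)} (hA : 2 ≤ #A) (hB : 2 ≤ #B)
    (h : #(A + B) + 1 = #A + #B) (hp2 : #(A + B) + 2 ≤ p) :
    ∃ d ≠ 0, bdry A d ≤ 1 ∧ bdry B d ≤ 1 := by
  induction hn : #B using Nat.strong_induction_on generalizing A B with
  | _ n ih =>
  subst hn
  -- translate so that `0 ∈ B`
  wlog h0 : (0 : ZMod p) ∈ B generalizing B with H
  · obtain ⟨b, hb⟩ := card_pos.1 (by omega : 0 < #B)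
    have hs : #(A + shift (-b) B) = #(A + B) := by
      rw [← card_shift (-b) (A + B)]
      congr 1
      ext x
      simp only [mem_add, mem_shift]
      constructor
      · rintro ⟨a, ha, c, hc, rfl⟩; exact ⟨a, ha, _, hc, by ring⟩
      · rintro ⟨a, ha, c, hc, hx⟩
        exact ⟨a, ha, c - b, by simpa using hc, by linear_combination hx⟩
    obtain ⟨d, hd, h1, h2⟩ := H (B := shift (-b) B) (by rwa [card_shift])
      (by rw [hs, card_shift]; exact h) (by rw [hs]; exact hp2)
      (by rw [card_shift]; exact fun m hm => ih m hm) (by simpa [mem_shift] using hb)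
    exact ⟨d, hd, h1, by rwa [bdry_shift] at h2⟩
  rcases hB.eq_or_lt with hB2 | hB3
  · obtain ⟨d, hd⟩ : (B.erase 0).Nonempty := card_pos.1 (by rw [card_erase_of_mem h0]; omega)
    have hd0 : d ≠ 0 := (mem_erase.1 hd).1
    have hBd : B = {0, d} := by
      symm
      apply eq_of_subset_of_card_le
      · intro x hx
        simp only [mem_insert, mem_singleton] at hx
        rcases hx with rfl | rfl
        · exact h0
        · exact (mem_erase.1 hd).2
      · rw [card_pair hd0.symm]; omega
    refine ⟨d, hd0, ?_, ?_⟩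
    · rw [hBd, card_add_pair, card_pair hd0.symm] at h; omega
    · rw [bdry_le_one_iff, hBd]
      intro x hx y hy h1 h2
      simp only [mem_insert, mem_singleton] at hx hy h1 h2
      rcases hx with rfl | rfl <;> rcases hy with rfl | rfl <;> simp_all
  · set X := A.filter fun e => ∃ b ∈ B, e + b ∉ A with hX
    have hAp : #A + #B ≤ p := by omega
    have hX2 : 2 ≤ #X := by
      by_cases hne : (A \ X).Nonempty
      · have hsub : A \ X + B ⊆ A := by
          intro x hx
          obtain ⟨a, ha, b, hb, rfl⟩ := mem_add.1 hx
          by_contra hc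
          rw [mem_sdiff] at ha
          exact ha.2 (mem_filter.2 ⟨ha.1, b, hb, hc⟩)
        have h1 := card_le_card hsub
        have h2 := card_add_ge hne ⟨0, h0⟩ (by omega)
        have h3 : #(A \ X) + #X = #A := card_sdiff_add_card_eq_card (filter_subset _ _)
        omega
      · rw [not_nonempty_iff_eq_empty, sdiff_eq_empty_iff_subset] at hne
        exact hA.trans (card_le_card hne)
    obtain ⟨e, heX, b₁, hb₁, hb₁0, heb₁⟩ :
        ∃ e ∈ X, ∃ b ∈ B, b ≠ 0 ∧ e + b ∈ A := by
      by_contra! hc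
      have hsub : X + B.erase 0 ⊆ (A + B) \ A := by
        intro x hx
        obtain ⟨a, ha, b, hb, rfl⟩ := mem_add.1 hx
        rw [mem_erase] at hb
        exact mem_sdiff.2 ⟨mem_add.2 ⟨a, (mem_filter.1 ha).1, b, hb.2, rfl⟩, hc a ha b hb.2 hb.1⟩
      have h1 := card_le_card hsub
      have hAS : A ⊆ A + B := fun a ha => mem_add.2 ⟨a, ha, 0, h0, by simp⟩
      have h4 := card_sdiff_add_card_eq_card hAS
      have h3 : #(B.erase 0) + 1 = #B := card_erase_add_one h0
      have h2 := card_add_ge (card_pos.1 (by omega : 0 < #X))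
        (card_pos.1 (by omega : 0 < #(B.erase 0))) (by omega)
      omega
    rw [hX, mem_filter] at heX
    obtain ⟨heA, b₂, hb₂, heb₂⟩ := heX
    set A' := A ∪ shift e B with hA'
    set B' := B ∩ shift (-e) A with hB'
    have hsum : #A' + #B' = #A + #B := by
      have := card_union_add_card_inter A (shift e B)
      rw [card_shift] at this
      rw [← this, ← hA']
      congr 1
      rw [← card_shift e B']
      congr 1
      ext x
      simp only [hB', mem_inter, mem_shift]
      rw [show x - e - -e = x by ring]
      exact and_comm
    have hB'2 : 2 ≤ #B' := by
      have : ({0, b₁} : Finset (ZMod p)) ⊆ B' := by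
        intro x hx
        simp only [mem_insert, mem_singleton] at hx
        rw [hB', mem_inter, mem_shift]
        rcases hx with rfl | rfl
        · exact ⟨h0, by simpa using heA⟩
        · exact ⟨hb₁, by rw [sub_neg_eq_add, add_comm]; exact heb₁⟩
      simpa [card_pair hb₁0.symm] using card_le_card this
    have hB'lt : #B' < #B := by
      apply card_lt_card
      refine ⟨inter_subset_left, fun hc => ?_⟩
      have := hc hb₂
      rw [hB', mem_inter, mem_shift, sub_neg_eq_add, add_comm] at this
      exact heb₂ this.2
    have hsub : A' + B' ⊆ A + B := by
      intro x hx
      obtain ⟨a, ha, b, hb, rfl⟩ := mem_add.1 hx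
      rw [hB', mem_inter, mem_shift] at hb
      rw [hA', mem_union, mem_shift] at ha
      rcases ha with ha | ha
      · exact mem_add.2 ⟨a, ha, b, hb.1, rfl⟩
      · exact mem_add.2 ⟨_, hb.2, _, ha, by ring⟩
    have hle := card_le_card hsub
    have hge := card_add_ge (A := A') (B := B') (card_pos.1 (by omega)) (card_pos.1 (by omega))
      (by omega)
    have heq : A' + B' = A + B := eq_of_subset_of_card_le hsub (by omega)
    obtain ⟨d, hd, h1, h2⟩ := ih #B' hB'lt (A := A') (B := B') (by omega) hB'2
      (by rw [heq]; omega) (by rw [heq]; omega) rfl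
    -- The transform does not change the sumset, so the progression found for `A' + B'` is one for
    -- `A + B` and is handed back to `A` and `B`.
    have hS : bdry (A + B) d ≤ 1 := heq ▸ bdry_add_le_one h1 h2
    refine ⟨d, hd, bdry_le_one_of_add hd hA hB h hp2 hS, ?_⟩
    rw [add_comm A B] at h hp2 hS
    exact bdry_le_one_of_add hd hB hA (by omega) hp2 hS

/-- Cauchy–Davenport for three sets with no solution of a linear equation. -/
theorem card_trio_le {α β γ b : ZMod p} (hγ : γ ≠ 0) {X Y Z : Finset (ZMod p)}
    (h : ∀ x ∈ X, ∀ y ∈ Y, ∀ z ∈ Z, α * x + β * y + γ * z ≠ b) :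
    #(dil α X + dil β Y) + #Z ≤ p := by
  have hd : Disjoint (dil α X + dil β Y) (shift b (dil (-γ) Z)) := by
    rw [disjoint_left]
    intro u hu hu'
    obtain ⟨_, hx, _, hy, rfl⟩ := mem_add.1 hu
    obtain ⟨x, hxX, rfl⟩ := mem_image.1 hx
    obtain ⟨y, hyY, rfl⟩ := mem_image.1 hy
    rw [mem_shift] at hu'
    obtain ⟨z, hz, hz'⟩ := mem_image.1 hu'
    exact h x hxX y hyY z hz (by linear_combination -hz')
  have := card_union_of_disjoint hd
  rw [card_shift, card_dil (by simpa using hγ)] at this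
  rw [← this]
  exact card_le_prime _

theorem card_trio_le' {α β γ b : ZMod p} (hα : α ≠ 0) (hβ : β ≠ 0) (hγ : γ ≠ 0)
    {X Y Z : Finset (ZMod p)} (hX : X.Nonempty) (hY : Y.Nonempty) (hZ : Z.Nonempty)
    (h : ∀ x ∈ X, ∀ y ∈ Y, ∀ z ∈ Z, α * x + β * y + γ * z ≠ b) :
    #X + #Y + #Z ≤ p + 1 := by
  have h1 := card_trio_le hγ h
  have h2 := card_pos.2 hZ
  have := card_add_ge (A := dil α X) (B := dil β Y) (hX.image _) (hY.image _) (by omega)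
  rw [card_dil hα, card_dil hβ] at this
  omega

/-- The extremal case of `card_trio_le'`. -/
theorem bdry_of_trio {α β γ b : ZMod p} (hα : α ≠ 0) (hβ : β ≠ 0) (hγ : γ ≠ 0)
    {X Y Z : Finset (ZMod p)} (hX : 2 ≤ #X) (hY : 2 ≤ #Y) (hZ : 2 ≤ #Z)
    (h : ∀ x ∈ X, ∀ y ∈ Y, ∀ z ∈ Z, α * x + β * y + γ * z ≠ b) (hc : p + 1 ≤ #X + #Y + #Z) :
    ∃ d ≠ 0, bdry X d ≤ 1 := by
  have hX' : X.Nonempty := card_pos.1 (by omega)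
  have hY' : Y.Nonempty := card_pos.1 (by omega)
  have h1 := card_trio_le hγ h
  have := card_add_ge (A := dil α X) (B := dil β Y) (hX'.image _) (hY'.image _) (by omega)
  rw [card_dil hα, card_dil hβ] at this
  obtain ⟨d, hd, h2, -⟩ := vosper (A := dil α X) (B := dil β Y) (by rwa [card_dil hα])
    (by rwa [card_dil hβ]) (by rw [card_dil hα, card_dil hβ]; omega) (by omega)
  exact ⟨α⁻¹ * d, by simp [hα, hd], by rwa [bdry_dil' hα] at h2⟩

end Vosper

/-! ### Combinatorics of four indices -/

section Fin4

theorem fin4_pair : ∀ i j : Fin 4, i ≠ j → ∃ k l, i ≠ k ∧ i ≠ l ∧ j ≠ k ∧ j ≠ l ∧ k ≠ l := by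
  decide

theorem fin4_triple : ∀ o : Fin 4, ∃ i j k : Fin 4, i ≠ o ∧ j ≠ o ∧ k ≠ o ∧ i ≠ j ∧ i ≠ k ∧
    j ≠ k := by
  decide

theorem fin4_last : ∀ o i j k v : Fin 4, i ≠ o → j ≠ o → k ≠ o → i ≠ j → i ≠ k → j ≠ k → v ≠ o →
    v ≠ i → v ≠ j → v = k := by
  decide

/-- An odd total means one or three odd terms; `o` is the one whose parity differs from the other
three. -/
theorem exists_odd_add (x : Fin 4 → ℕ) (h : Odd (x 0 + x 1 + x 2 + x 3)) :
    ∃ o, ∀ i, i ≠ o → Odd (x o + x i) := by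
  simp only [Nat.odd_iff] at h ⊢
  have h0 := Nat.mod_two_eq_zero_or_one (x 0)
  have h1 := Nat.mod_two_eq_zero_or_one (x 1)
  have h2 := Nat.mod_two_eq_zero_or_one (x 2)
  have h3 := Nat.mod_two_eq_zero_or_one (x 3)
  by_cases e0 : x 1 % 2 = x 2 % 2 ∧ x 2 % 2 = x 3 % 2
  · refine ⟨0, fun i hi => ?_⟩
    fin_cases i <;> simp at hi ⊢ <;> omega
  by_cases e1 : x 0 % 2 = x 2 % 2 ∧ x 2 % 2 = x 3 % 2
  · refine ⟨1, fun i hi => ?_⟩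
    fin_cases i <;> simp at hi ⊢ <;> omega
  by_cases e2 : x 0 % 2 = x 1 % 2 ∧ x 1 % 2 = x 3 % 2
  · refine ⟨2, fun i hi => ?_⟩
    fin_cases i <;> simp at hi ⊢ <;> omega
  · refine ⟨3, fun i hi => ?_⟩
    fin_cases i <;> simp at hi ⊢ <;> omega

end Fin4

/-! ### No line carries four colours -/

section FourColours

variable {p : ℕ} [hp : Fact p.Prime]

/-- A colour class. -/
def cls {κ : Type*} [DecidableEq κ] (X : ZMod p → κ) (i : κ) : Finset (ZMod p) := {x | X x = i}

theorem mem_cls {κ : Type*} [DecidableEq κ] {X : ZMod p → κ} {i : κ} {x : ZMod p} :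
    x ∈ cls X i ↔ X x = i := by simp [cls]

theorem card_sub_ge {A B : Finset (ZMod p)} (hA : A.Nonempty) (hB : B.Nonempty)
    (h : #(A - B) < p) : #A + #B ≤ #(A - B) + 1 := by
  rw [sub_eq_add_neg] at h ⊢
  simpa using card_add_ge hA hB.neg h

/-- `0` is an exit of the complement, hence its only one. As `-d ∈ D`, no other element of the
complement steps onto `0`, so the others would be stable under adding `d`; thus the complement is
`{0}`. -/
theorem card_ge_of_arc {D : Finset (ZMod p)} {d : ZMod p} (hd : d ≠ 0) (h : bdry D d ≤ 1)
    (h1 : d ∈ D) (h2 : -d ∈ D) (h0 : (0 : ZMod p) ∉ D) : p ≤ #D + 1 := by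
  rw [← bdry_compl, bdry_le_one_iff] at h
  have key : Dᶜ ⊆ {0} := by
    intro x hx
    by_contra hx0
    rw [mem_singleton] at hx0
    have := eq_univ_of_add_mem (A := {y | y ∈ Dᶜ ∧ y ≠ 0}) hd ?_ ⟨hx, hx0⟩ 0
    · exact this.2 rfl
    · rintro y ⟨hy, hy0⟩
      refine ⟨?_, fun hc => ?_⟩
      · by_contra hc
        exact hy0 (h y hy 0 (by simpa using h0) hc (by simpa using h1))
      · rw [eq_neg_of_add_eq_zero_left hc] at hy
        exact mem_compl.1 hy h2
  have := card_le_card key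
  rw [card_compl_zmod, card_singleton] at this
  have := card_le_prime D
  omega

theorem even_card_of_neg_mem {D : Finset (ZMod p)} (hp2 : p ≠ 2)
    (h : ∀ x ∈ D, -x ∈ D) (h0 : (0 : ZMod p) ∉ D) : Even #D := by
  have h2 : ((#D : ℕ) : ZMod 2) = 0 := by
    rw [card_eq_sum_ones, Nat.cast_sum]
    refine sum_involution (fun x _ => -x) (fun _ _ => by simpa using CharTwo.add_self_eq_zero (1 : ZMod 2)) ?_
      (fun x hx => h x hx) (fun x _ => neg_neg x)
    intro x hx _ hxx
    have hx0 : x = 0 :=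
      (ZMod.add_self_eq_zero_iff_eq_zero (hp.out.odd_of_ne_two hp2)).1 (by linear_combination -hxx)
    exact h0 (hx0 ▸ hx)
  rwa [ZMod.natCast_eq_zero_iff_even] at h2

/-- Linear systems of four colour classes with no rainbow coincidences. -/
def FourFree (a : Fin 3 → ZMod p) (X : ZMod p → Fin 4) : Prop :=
  ∀ s t, s ≠ t → ∀ x x' y y', X x ≠ X x' → X x ≠ X y → X x ≠ X y' → X x' ≠ X y → X x' ≠ X y' →
    X y ≠ X y' → a s * (x - x') ≠ a t * (y - y')

/-- Symmetrised difference set of two classes. -/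
def dset (X : ZMod p → Fin 4) (i j : Fin 4) : Finset (ZMod p) :=
  (cls X i - cls X j) ∪ (cls X j - cls X i)

theorem neg_mem_dset {X : ZMod p → Fin 4} {i j : Fin 4} {z : ZMod p} (h : z ∈ dset X i j) :
    -z ∈ dset X i j := by
  simp only [dset, mem_union, mem_sub] at h ⊢
  rcases h with ⟨x, hx, y, hy, rfl⟩ | ⟨x, hx, y, hy, rfl⟩
  · right; exact ⟨y, hy, x, hx, by ring⟩
  · left; exact ⟨y, hy, x, hx, by ring⟩

theorem zero_notMem_sub {X : ZMod p → Fin 4} {i j : Fin 4} (hij : i ≠ j) :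
    (0 : ZMod p) ∉ cls X i - cls X j := by
  simp only [mem_sub, mem_cls]
  rintro ⟨x, hx, y, hy, h⟩
  rw [sub_eq_zero] at h
  subst h; exact hij (hx.symm.trans hy)

theorem zero_notMem_dset {X : ZMod p → Fin 4} {i j : Fin 4} (hij : i ≠ j) :
    (0 : ZMod p) ∉ dset X i j := by
  rw [dset, mem_union, not_or]
  exact ⟨zero_notMem_sub hij, zero_notMem_sub hij.symm⟩

theorem disjoint_dset {a : Fin 3 → ZMod p} {X : ZMod p → Fin 4} (H : FourFree a X)
    {s t : Fin 3} (hst : s ≠ t) {i j k l : Fin 4} (hij : i ≠ j) (hik : i ≠ k) (hil : i ≠ l)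
    (hjk : j ≠ k) (hjl : j ≠ l) (hkl : k ≠ l) :
    Disjoint (dil (a s) (dset X i j)) (dil (a t) (dset X k l)) := by
  rw [disjoint_left]
  intro z hz hz'
  obtain ⟨u, hu, rfl⟩ := mem_image.1 hz
  obtain ⟨v, hv, huv⟩ := mem_image.1 hz'
  simp only [dset, mem_union, mem_sub, mem_cls] at hu hv
  rcases hu with ⟨x, rfl, x', rfl, rfl⟩ | ⟨x, rfl, x', rfl, rfl⟩ <;>
  rcases hv with ⟨y, rfl, y', rfl, rfl⟩ | ⟨y, rfl, y', rfl, rfl⟩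
  · exact H s t hst x x' y y' hij hik hil hjk hjl hkl huv.symm
  · exact H s t hst x x' y y' hij hil hik hjl hjk hkl.symm huv.symm
  · exact H s t hst x x' y y' hij.symm hjk hjl hik hil hkl huv.symm
  · exact H s t hst x x' y y' hij.symm hjl hjk hil hik hkl.symm huv.symm

theorem sum_card_cls (X : ZMod p → Fin 4) {i j k l : Fin 4} (hij : i ≠ j) (hik : i ≠ k)
    (hil : i ≠ l) (hjk : j ≠ k) (hjl : j ≠ l) (hkl : k ≠ l) :
    #(cls X i) + #(cls X j) + #(cls X k) + #(cls X l) = p := by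
  have h1 : ∑ i, #(cls X i) = p := by
    have := Finset.card_eq_sum_card_fiberwise (s := (univ : Finset (ZMod p))) (t := univ) (f := X)
      (fun _ _ => by simp)
    rw [card_univ, ZMod.card] at this
    exact this.symm
  have h2 : (univ : Finset (Fin 4)) = {i, j, k, l} := by
    revert i j k l; decide
  refine Eq.trans ?_ h1
  rw [h2, sum_insert, sum_insert, sum_insert, sum_singleton]
  · ring
  all_goals simp [*]

section

variable {a : Fin 3 → ZMod p} {X : ZMod p → Fin 4} (ha : ∀ s, a s ≠ 0)
  (hX : Function.Surjective X) (H : FourFree a X)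

include hX in
theorem cls_nonempty (i : Fin 4) : (cls X i).Nonempty := by
  obtain ⟨x, hx⟩ := hX i
  exact ⟨x, mem_cls.2 hx⟩

include hX in
theorem cls_pos (i : Fin 4) : 0 < #(cls X i) := card_pos.2 (cls_nonempty hX i)

include hX in
theorem dset_ge {i j : Fin 4} (hij : i ≠ j) : #(cls X i) + #(cls X j) ≤ #(cls X i - cls X j) + 1 := by
  apply card_sub_ge (cls_nonempty hX i) (cls_nonempty hX j)
  calc _ < #(univ : Finset (ZMod p)) := card_lt_card (ssubset_univ_iff.2 fun h =>
        zero_notMem_sub hij (h ▸ mem_univ 0))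
    _ = p := by rw [card_univ, ZMod.card]

include ha hX H in
/-- Structure of the difference sets when the sizes have different parities. -/
theorem odd_pair {i j k l : Fin 4} (hij : i ≠ j) (hik : i ≠ k) (hil : i ≠ l)
    (hjk : j ≠ k) (hjl : j ≠ l) (hkl : k ≠ l) (hodd : Odd (#(cls X i) + #(cls X j))) :
    #(cls X i - cls X j) + 1 = #(cls X i) + #(cls X j) ∧ dset X i j = cls X i - cls X j ∧
    ∀ s t, s ≠ t → ∀ z, a s * z ∈ dil (a t) (dset X k l) ↔ z ≠ 0 ∧ z ∉ dset X i j := by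
  have hsum := sum_card_cls X hij hik hil hjk hjl hkl
  have h4 := cls_pos hX
  have hp2 : p ≠ 2 := by have := h4 i; have := h4 j; have := h4 k; have := h4 l; omega
  have hpo : Odd p := hp.out.odd_of_ne_two hp2
  have hge := dset_ge hX hij
  have hge' := dset_ge hX hkl
  have hs1 : #(cls X i - cls X j) ≤ #(dset X i j) := card_le_card subset_union_left
  have hs2 : #(cls X k - cls X l) ≤ #(dset X k l) := card_le_card subset_union_left
  have e1 : Even #(dset X i j) :=
    even_card_of_neg_mem hp2 (fun _ => neg_mem_dset) (zero_notMem_dset hij)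
  have e2 : Even #(dset X k l) :=
    even_card_of_neg_mem hp2 (fun _ => neg_mem_dset) (zero_notMem_dset hkl)
  have hu : ∀ s t, s ≠ t → dil (a s) (dset X i j) ∪ dil (a t) (dset X k l) ⊆ univ.erase 0 := by
    intro s t _ z hz
    refine mem_erase.2 ⟨?_, mem_univ _⟩
    rintro rfl
    rw [mem_union, mem_dil (ha s), mem_dil (ha t), mul_zero, mul_zero] at hz
    rcases hz with hz | hz
    · exact zero_notMem_dset hij hz
    · exact zero_notMem_dset hkl hz
  have hc : ∀ s t, s ≠ t → #(dil (a s) (dset X i j) ∪ dil (a t) (dset X k l)) =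
      #(dset X i j) + #(dset X k l) := by
    intro s t hst
    rw [card_union_of_disjoint (disjoint_dset H hst hij hik hil hjk hjl hkl), card_dil (ha s),
      card_dil (ha t)]
  have hle : #(dset X i j) + #(dset X k l) ≤ p - 1 := by
    rw [← hc 0 1 (by decide)]
    refine (card_le_card (hu 0 1 (by decide))).trans ?_
    rw [card_erase_of_mem (mem_univ _), card_univ, ZMod.card]
  obtain ⟨q, hq⟩ := hodd
  obtain ⟨q', hq'⟩ := hpo
  obtain ⟨q₁, hq₁⟩ := e1
  obtain ⟨q₂, hq₂⟩ := e2
  -- Parity forces equality. As `p` is odd, `#(cls X k) + #(cls X l)` is even, so its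
  -- Cauchy–Davenport bound is odd and the even cardinality of `dset X k l` raises it by one. The
  -- two bounds then add up to `p - 1`, all the room there is.
  refine ⟨by omega, (eq_of_subset_of_card_le subset_union_left (by unfold dset at *; omega)).symm, ?_⟩
  intro s t hst z
  have hU : dil (a s) (dset X i j) ∪ dil (a t) (dset X k l) = univ.erase 0 := by
    apply eq_of_subset_of_card_le (hu s t hst)
    rw [hc s t hst, card_erase_of_mem (mem_univ _), card_univ, ZMod.card]
    omega
  have hz : a s * z ∈ dil (a s) (dset X i j) ∪ dil (a t) (dset X k l) ↔ a s * z ∈ univ.erase 0 := by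
    rw [hU]
  rw [mem_union, mem_dil (ha s), inv_mul_cancel_left₀ (ha s)] at hz
  have hd : a s * z ∈ dil (a s) (dset X i j) → a s * z ∉ dil (a t) (dset X k l) := fun h =>
    disjoint_left.1 (disjoint_dset H hst hij hik hil hjk hjl hkl) h
  rw [mem_dil (ha s), inv_mul_cancel_left₀ (ha s)] at hd
  simp only [mem_erase, mem_univ, and_true, ne_eq, mul_eq_zero, ha s, false_or] at hz ⊢
  by_cases h1 : z ∈ dset X i j
  · have := hd h1; simp [h1, this]
  · by_cases h2 : z = 0
    · simp only [h2, not_true, iff_false] at hz ⊢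
      tauto
    · simp only [h2, not_false_iff, iff_true, h1, false_or] at hz ⊢
      simp [hz]

include ha hX H in
theorem odd_pair' {i j : Fin 4} (hij : i ≠ j) (hodd : Odd (#(cls X i) + #(cls X j))) :
    #(cls X i - cls X j) + 1 = #(cls X i) + #(cls X j) ∧
    (∀ z ∈ cls X i - cls X j, -z ∈ cls X i - cls X j) ∧ #(cls X i) + #(cls X j) + 2 ≤ p := by
  obtain ⟨k, l, hik, hil, hjk, hjl, hkl⟩ := fin4_pair i j hij
  obtain ⟨h1, h2, -⟩ := odd_pair ha hX H hij hik hil hjk hjl hkl hodd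
  refine ⟨h1, fun z hz => ?_, ?_⟩
  · rw [← h2] at hz ⊢; exact neg_mem_dset hz
  · have := sum_card_cls X hij hik hil hjk hjl hkl
    have := cls_pos hX k
    have := cls_pos hX l
    omega

include ha hX H in
theorem odd_pair_vosper {i j : Fin 4} (hij : i ≠ j) (hodd : Odd (#(cls X i) + #(cls X j)))
    (hi : 2 ≤ #(cls X i)) (hj : 2 ≤ #(cls X j)) :
    ∃ d ≠ 0, bdry (cls X i) d ≤ 1 ∧ bdry (cls X j) d ≤ 1 := by
  obtain ⟨h1, -, h2⟩ := odd_pair' ha hX H hij hodd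
  have hn : -cls X j = dil (-1) (cls X j) := by
    ext x; rw [mem_dil (by simp)]; simp [mem_neg']
  have h3 : #(-cls X j) = #(cls X j) := card_neg _
  rw [sub_eq_add_neg] at h1
  obtain ⟨d, hd, h4, h5⟩ := vosper hi (h3.symm ▸ hj) (by rw [h1, h3]) (by omega)
  refine ⟨d, hd, h4, ?_⟩
  rw [hn, bdry_dil' (by simp)] at h5
  simpa [bdry_neg, inv_neg] using h5

include ha hX H in
-- By Vosper class `o` is a `d`-progression. Let `j` be the colour met just after its end: class `j`
-- is a progression of the same difference, so `cls X j - cls X o` is an arc containing `d`, by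
-- symmetry also `-d`, but not `0`. By `card_ge_of_arc` it is too large.
theorem not_large_large {o : Fin 4} (hodd : ∀ i, i ≠ o → Odd (#(cls X o) + #(cls X i)))
    (ho : 2 ≤ #(cls X o)) {i : Fin 4} (hio : i ≠ o) (hi : 2 ≤ #(cls X i)) : False := by
  obtain ⟨d, hd, h1, -⟩ := odd_pair_vosper ha hX H hio.symm (hodd i hio) ho hi
  obtain ⟨-, -, hoi⟩ := odd_pair' ha hX H hio.symm (hodd i hio)
  obtain ⟨e, he⟩ := card_pos.1 (bdry_pos hd (cls_nonempty hX o) (by omega))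
  obtain ⟨heo, hed⟩ := mem_filter.1 he
  rw [mem_cls] at heo hed
  set j := X (e + d) with hj
  have hjo : j ≠ o := hed
  obtain ⟨h2, h3, h4⟩ := odd_pair' ha hX H hjo (by rw [add_comm]; exact hodd j hjo)
  have hjd : bdry (cls X j) d ≤ 1 := by
    rcases Nat.lt_or_ge (#(cls X j)) 2 with h | h
    · have := bdry_le_card (cls X j) d; omega
    · obtain ⟨d', hd', h5, h6⟩ := odd_pair_vosper ha hX H hjo.symm (hodd j hjo) ho h
      obtain ⟨m, hm, hmd⟩ := exists_small_multiple hd h1 h5 (by omega) (by omega)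
      obtain rfl | rfl : m = 0 ∨ m = 1 := by omega
      · exact absurd (by simpa using hmd) hd'
      · rcases hmd with h | h
        · rwa [show d' = d by simpa using h] at h6
        · rwa [show d' = -d by simpa using h, bdry_neg] at h6
  have hD : bdry (cls X j - cls X o) d ≤ 1 := by
    have hn : -cls X o = dil (-1) (cls X o) := by
      ext x; rw [mem_dil (by simp)]; simp [mem_neg']
    rw [sub_eq_add_neg]
    apply bdry_add_le_one hjd
    rw [hn, bdry_dil' (by simp)]
    simpa [bdry_neg, inv_neg] using h1
  have hdD : d ∈ cls X j - cls X o :=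
    mem_sub.2 ⟨e + d, mem_cls.2 rfl, e, mem_cls.2 heo, by ring⟩
  have := card_ge_of_arc hd hD hdD (h3 d hdD) (zero_notMem_sub hjo)
  omega

include ha hX H in
-- Symmetry of the difference sets makes class `o` invariant under reflection in each singleton. So
-- `2x - y = z` for the three singletons in any order, whence `3(x - y) = 0`.
theorem not_large_small (hp3 : p ≠ 3) {o : Fin 4}
    (hodd : ∀ i, i ≠ o → Odd (#(cls X o) + #(cls X i)))
    (hi : ∀ i, i ≠ o → #(cls X i) = 1) : False := by
  have hp2 : p ≠ 2 := by
    obtain ⟨i, -, -, hio, -⟩ := fin4_triple o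
    have := odd_pair' ha hX H hio.symm (hodd i hio)
    have := cls_pos hX o
    have := cls_pos hX i
    omega
  have hsing : ∀ i, i ≠ o → ∃ u, ∀ x, X x = i ↔ x = u := by
    intro i hio
    obtain ⟨u, hu⟩ := card_eq_one.1 (hi i hio)
    exact ⟨u, fun x => by rw [← mem_cls, hu, mem_singleton]⟩
  -- reflecting one singleton in another gives the third
  have hrefl : ∀ i j k : Fin 4, i ≠ o → j ≠ o → k ≠ o → i ≠ j → i ≠ k → j ≠ k → ∀ x y z, X x = i →
      X y = j → X z = k → 2 * x - y = z := by
    intro i j k hio hjo hko hij hik hjk x y z hx hy hz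
    obtain ⟨-, h3, -⟩ := odd_pair' ha hX H hio.symm (hodd i hio)
    have h1 : X (2 * x - y) ≠ o := by
      intro hc
      have := h3 (x - y) (mem_sub.2 ⟨2 * x - y, mem_cls.2 hc, x, mem_cls.2 hx, by ring⟩)
      obtain ⟨v, hv, w, hw, hvw⟩ := mem_sub.1 this
      rw [mem_cls] at hv hw
      obtain ⟨u, hu⟩ := hsing i hio
      have e1 := (hu w).1 hw
      have e2 := (hu x).1 hx
      have : v = y := by rw [e1, ← e2] at hvw; linear_combination hvw
      rw [this, hy] at hv
      exact hjo hv
    have hxy : x ≠ y := by rintro rfl; exact hij (hx.symm.trans hy)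
    have h2 : X (2 * x - y) ≠ i := by
      intro hc
      obtain ⟨u, hu⟩ := hsing i hio
      have e1 := (hu _).1 hc
      have e2 := (hu x).1 hx
      exact hxy (by linear_combination e1 - e2)
    have h3 : X (2 * x - y) ≠ j := by
      intro hc
      obtain ⟨u, hu⟩ := hsing j hjo
      have e1 := (hu _).1 hc
      have e2 := (hu y).1 hy
      have e3 : x - y = 0 := (ZMod.add_self_eq_zero_iff_eq_zero (hp.out.odd_of_ne_two hp2)).1
        (by linear_combination e1 - e2)
      exact hxy (sub_eq_zero.1 e3)
    have h4 : X (2 * x - y) = k := fin4_last o i j k _ hio hjo hko hij hik hjk h1 h2 h3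
    obtain ⟨u, hu⟩ := hsing k hko
    rw [(hu _).1 h4, (hu _).1 hz]
  obtain ⟨i, j, k, hio, hjo, hko, hij, hik, hjk⟩ := fin4_triple o
  obtain ⟨x, hx⟩ := hX i
  obtain ⟨y, hy⟩ := hX j
  obtain ⟨z, hz⟩ := hX k
  have h1 := hrefl i j k hio hjo hko hij hik hjk x y z hx hy hz
  have h2 := hrefl j i k hjo hio hko hij.symm hjk hik y x z hy hx hz
  have h3 : (3 : ZMod p) * (x - y) = 0 := by linear_combination h1 - h2
  rcases mul_eq_zero.1 h3 with h | h
  · have : (p : ℕ) ∣ 3 := (ZMod.natCast_eq_zero_iff 3 p).1 (by exact_mod_cast h)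
    exact hp3 ((Nat.prime_dvd_prime_iff_eq hp.out Nat.prime_three).1 this)
  · rw [sub_eq_zero] at h
    subst h
    exact hij (hx.symm.trans hy)

include ha hX H in
-- Here the colouring is even, and each class other than `o` is the nonzero complement of the
-- difference set of the other two. Two classes with `0` adjoined then attain equality in
-- Cauchy–Davenport, and Vosper gives them a common difference `d`. By `card_ge_of_arc` and
-- evenness, `d` would belong to both classes.
theorem not_small {o : Fin 4} (hodd : ∀ i, i ≠ o → Odd (#(cls X o) + #(cls X i)))
    (h0 : ∀ x, X x = o ↔ x = 0) : False := by
  have ho : cls X o = {0} := by ext x; rw [mem_cls, h0, mem_singleton]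
  have hneg : ∀ x, X (-x) = X x := by
    intro x
    by_cases hx : X x = o
    · rw [(h0 x).1 hx, neg_zero]
    · obtain ⟨-, h3, -⟩ := odd_pair' ha hX H hx (by rw [add_comm]; exact hodd _ hx)
      have := h3 x (mem_sub.2 ⟨x, mem_cls.2 rfl, 0, by simp [ho], by ring⟩)
      rw [ho, sub_singleton] at this
      simpa [mem_cls] using this
  have hQ : ∀ i j k, i ≠ o → j ≠ o → k ≠ o → i ≠ j → i ≠ k → j ≠ k → ∀ s t, s ≠ t → ∀ u, u ≠ 0 →
      (X ((a s)⁻¹ * a t * u) = i ↔ u ∉ dset X j k) := by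
    intro i j k hio hjo hko hij hik hjk s t hst u hu
    obtain ⟨-, h2, h3⟩ := odd_pair ha hX H hio.symm hjo.symm hko.symm hij hik hjk (hodd i hio)
    have h4 := h3 s t hst ((a s)⁻¹ * a t * u)
    have hz : (a s)⁻¹ * a t * u ≠ 0 := by simp [ha, hu]
    rw [h2, ho] at h4
    rw [show a s * ((a s)⁻¹ * a t * u) = a t * u by field_simp [ha s],
      mem_dil (ha t), inv_mul_cancel_left₀ (ha t)] at h4
    have h5 : (a s)⁻¹ * a t * u ∈ ({0} : Finset (ZMod p)) - cls X i ↔ X ((a s)⁻¹ * a t * u) = i := by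
      simp only [mem_sub, mem_singleton, mem_cls]
      constructor
      · rintro ⟨_, rfl, w, hw, h⟩
        rw [← h, zero_sub, hneg, hw]
      · intro h
        exact ⟨0, rfl, -((a s)⁻¹ * a t * u), by rw [hneg, h], by ring⟩
    rw [h5] at h4
    tauto
  -- Three instances of `hQ` chained through the third coefficient cancel all ratios.
  have hD : ∀ i j k, i ≠ o → j ≠ o → k ≠ o → i ≠ j → i ≠ k → j ≠ k → ∀ u, u ≠ 0 →
      (X u = i ↔ u ∉ dset X j k) := by
    intro i j k hio hjo hko hij hik hjk u hu
    have hu' : (a 1)⁻¹ * a 0 * u ≠ 0 := by simp [ha, hu]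
    have e1 := hQ i j k hio hjo hko hij hik hjk 0 1 (by decide) _ hu'
    have e2 := hQ i j k hio hjo hko hij hik hjk 2 1 (by decide) _ hu'
    have e3 := hQ i j k hio hjo hko hij hik hjk 2 0 (by decide) u hu
    rw [show (a 0)⁻¹ * a 1 * ((a 1)⁻¹ * a 0 * u) = u by field_simp [ha 0, ha 1]] at e1
    rw [show (a 2)⁻¹ * a 1 * ((a 1)⁻¹ * a 0 * u) = (a 2)⁻¹ * a 0 * u by
      field_simp [ha 1, ha 2]] at e2
    rw [e1, ← e2, e3]
  obtain ⟨i, j, k, hio, hjo, hko, hij, hik, hjk⟩ := fin4_triple o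
  have hsum := sum_card_cls X hio.symm hjo.symm hko.symm hij hik hjk
  have ho1 : #(cls X o) = 1 := by rw [ho, card_singleton]
  have hev : ∀ i, i ≠ o → 2 ≤ #(cls X i) := by
    intro i hio
    obtain ⟨q, hq⟩ := hodd i hio
    have := cls_pos hX i
    omega
  have hz : ∀ i, i ≠ o → (0 : ZMod p) ∉ cls X i := by
    intro i hio; rw [mem_cls, (h0 0).2 rfl]; exact hio.symm
  have hsub : insert 0 (cls X j) + insert 0 (cls X k) ⊆ insert 0 (cls X j ∪ cls X k) := by
    intro x hx
    rw [mem_insert, or_iff_not_imp_left]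
    intro hx0
    obtain ⟨y, hy, z, hz, rfl⟩ := mem_add.1 hx
    rw [mem_insert] at hy hz
    rw [mem_union]
    rcases hy with rfl | hy <;> rcases hz with rfl | hz
    · simp at hx0
    · right; simpa using hz
    · left; simpa using hy
    · have h1 : y + z ∈ dset X j k := by
        rw [dset, mem_union]
        left
        rw [mem_cls] at hz
        exact mem_sub.2 ⟨y, hy, -z, by rw [mem_cls, hneg, hz], by ring⟩
      have h2 : X (y + z) ≠ i := fun h => (hD i j k hio hjo hko hij hik hjk _ hx0).1 h h1
      have h3 : X (y + z) ≠ o := fun h => hx0 ((h0 _).1 h)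
      rw [mem_cls, mem_cls, or_iff_not_imp_left]
      exact fun h4 => fin4_last o i j k _ hio hjo hko hij hik hjk h3 h2 h4
  have hj0 := card_insert_of_notMem (hz j hjo)
  have hk0 := card_insert_of_notMem (hz k hko)
  have hc := card_le_card hsub
  have hc1 : #(insert 0 (cls X j ∪ cls X k)) ≤ #(cls X j) + #(cls X k) + 1 :=
    (card_insert_le _ _).trans (by have := card_union_le (cls X j) (cls X k); omega)
  have hi2 := hev i hio
  have hj2 := hev j hjo
  have hk2 := hev k hko
  have hge := card_add_ge (A := insert 0 (cls X j)) (B := insert 0 (cls X k)) (by simp) (by simp)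
    (by omega)
  obtain ⟨d, hd, h1, h2⟩ := vosper (A := insert 0 (cls X j)) (B := insert 0 (cls X k))
    (by omega) (by omega) (by omega) (by omega)
  have key : ∀ i, i ≠ o → 2 ≤ #(cls X i) → bdry (insert 0 (cls X i)) d ≤ 1 → X d = i := by
    intro i _ hi2 hb
    by_contra hdi
    have h3 := card_ge_of_arc (D := (insert 0 (cls X i))ᶜ) hd (by rwa [bdry_compl])
      (by simp [hd, mem_cls, hdi]) (by simp [hd, mem_cls, hneg, hdi]) (by simp)
    rw [card_compl_zmod] at h3
    have := card_le_prime (insert 0 (cls X i))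
    have := card_le_card (subset_insert 0 (cls X i))
    have : #(insert 0 (cls X i)) ≤ 1 := by omega
    omega
  exact hjk ((key j hjo hj2 h1).symm.trans (key k hko hk2 h2))

include ha hX H in
/-- Four colour classes always give a coincidence. -/
theorem not_fourFree (hp3 : p ≠ 3) : False := by
  have h4 := cls_pos hX
  have hsum := sum_card_cls X (i := 0) (j := 1) (k := 2) (l := 3) (by decide) (by decide) (by decide)
    (by decide) (by decide) (by decide)
  have hp2 : p ≠ 2 := by have := h4 0; have := h4 1; have := h4 2; have := h4 3; omega
  obtain ⟨o, hodd⟩ := exists_odd_add (fun i => #(cls X i)) (by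
    rw [hsum]; exact hp.out.odd_of_ne_two hp2)
  rcases Nat.lt_or_ge (#(cls X o)) 2 with ho | ho
  · obtain ⟨u, hu⟩ := card_eq_one.1 (show #(cls X o) = 1 by have := h4 o; omega)
    have hcard : ∀ i, #(cls (fun x => X (u + x)) i) = #(cls X i) := by
      intro i
      rw [← card_shift u]
      congr 1
      ext x
      simp [mem_shift, mem_cls]
    refine not_small ha (X := fun x => X (u + x)) (o := o) ?_ ?_ ?_ ?_
    · intro i
      obtain ⟨x, hx⟩ := hX i
      exact ⟨x - u, by simpa using hx⟩
    · intro s t hst x x' y y' h1 h2 h3 h4 h5 h6 h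
      exact H s t hst _ _ _ _ h1 h2 h3 h4 h5 h6 (by linear_combination h)
    · intro i hi; rw [hcard, hcard]; exact hodd i hi
    · intro x
      rw [← mem_cls, hu, mem_singleton]
      simp
  · by_cases h : ∀ i, i ≠ o → #(cls X i) = 1
    · exact not_large_small ha hX H hp3 hodd h
    · push Not at h
      obtain ⟨i, hio, hi⟩ := h
      exact not_large_large ha hX H hodd ho hio (by have := h4 i; omega)

end

end FourColours

/-! ### A colour occurring once on a line -/

section Singles

variable {p : ℕ} [hp : Fact p.Prime]

/-- The nonzero residues form a single class under the multipliers `-(a i / a j)`. -/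
def Good (a : Fin 3 → ZMod p) : Prop :=
  ∀ S : Set (ZMod p), S.Nonempty → 0 ∉ S → (∀ i j, i ≠ j → ∀ x ∈ S, -(a i / a j) * x ∈ S) →
    ∀ x, x ≠ 0 → x ∈ S

/-- `T` colours the third entries of triples whose first two entries are coloured by `X`. -/
def Compat {κ : Type*} (a : Fin 3 → ZMod p) (s t : Fin 3) (X T : ZMod p → κ) : Prop :=
  ∀ x y, X x = X y ∨ T (a s * x + a t * y) = X x ∨ T (a s * x + a t * y) = X y

theorem natCast_ne_zero_of_lt {k : ℕ} (h0 : 0 < k) (hk : k < p) : (k : ZMod p) ≠ 0 := by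
  rw [Ne, ZMod.natCast_eq_zero_iff]
  exact fun h => absurd (Nat.le_of_dvd h0 h) (by omega)

variable {a : Fin 3 → ZMod p} {κ : Type*}

/-- Closure under ratios of a symmetric set. -/
theorem Good.mem_or_neg_mem (hg : Good a) {S : Set (ZMod p)} (hS : S.Nonempty) (h0 : 0 ∉ S)
    (h : ∀ i j, i ≠ j → ∀ x ∈ S, (a i / a j) * x ∈ S ∨ -((a i / a j) * x) ∈ S) {x : ZMod p}
    (hx : x ≠ 0) : x ∈ S ∨ -x ∈ S := by
  refine hg {x | x ∈ S ∨ -x ∈ S} ?_ ?_ ?_ x hx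
  · obtain ⟨x, hx⟩ := hS; exact ⟨x, Or.inl hx⟩
  · simpa using h0
  · rintro i j hij x (hx | hx)
    · rcases h i j hij x hx with h | h
      · right; simpa [neg_mul] using h
      · left; simpa [neg_mul] using h
    · rcases h i j hij _ hx with h | h
      · left; simpa [neg_mul] using h
      · right; simpa [neg_mul] using h

/-- Pairing with `0` shows that `T z` equals both `X ((a s)⁻¹ * z)` and `X ((a t)⁻¹ * z)` unless `T
z = X 0`. So the two dilates of a colour class differ in at most one point, and having equal size
they coincide. -/
theorem ratio_invariant (ha : ∀ s, a s ≠ 0) {X : ZMod p → κ} {c₁ c₂ : κ}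
    (h12 : c₁ ≠ c₂) (hX : ∀ x, x ≠ 0 → X x = c₁ ∨ X x = c₂) (hX0 : ∀ x, x ≠ 0 → X x ≠ X 0)
    {s t : Fin 3} {T : ZMod p → κ} (hT : Compat a s t X T)
    (hq : ∀ v v', T v = X 0 → T v' = X 0 → v = v') {x : ZMod p} (hx : x ≠ 0) :
    X (a s / a t * x) = X x := by
  classical
  have key : ∀ z, z ≠ 0 → T z ≠ X 0 → X ((a s)⁻¹ * z) = X ((a t)⁻¹ * z) := by
    intro z hz hTz
    have e1 := hT ((a s)⁻¹ * z) 0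
    have e2 := hT 0 ((a t)⁻¹ * z)
    rw [mul_zero, add_zero, mul_inv_cancel_left₀ (ha s)] at e1
    rw [mul_zero, zero_add, mul_inv_cancel_left₀ (ha t)] at e2
    have e3 := hX0 ((a s)⁻¹ * z) (by simp [ha, hz])
    have e4 := hX0 ((a t)⁻¹ * z) (by simp [ha, hz])
    have e5 : T z = X ((a s)⁻¹ * z) := by tauto
    have e6 : T z = X ((a t)⁻¹ * z) := by tauto
    rw [← e5, e6]
  set S : Finset (ZMod p) := {x | x ≠ 0 ∧ X x = c₁} with hS
  have hcard : #(dil (a s) S) = #(dil (a t) S) := by rw [card_dil (ha s), card_dil (ha t)]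
  have hmem : ∀ r z, z ∈ dil (a r) S ↔ z ≠ 0 ∧ X ((a r)⁻¹ * z) = c₁ := by
    intro r z
    rw [mem_dil (ha r), hS, mem_filter]
    simp [ha]
  have heq : dil (a s) S = dil (a t) S := by
    by_contra hne
    obtain ⟨z, hz, hz'⟩ := not_subset.1 fun h => hne (eq_of_subset_of_card_le h hcard.ge)
    obtain ⟨w, hw, hw'⟩ := not_subset.1 fun h => hne (eq_of_subset_of_card_le h hcard.le).symm
    rw [hmem] at hz hz' hw hw'
    have e1 : T z = X 0 := by
      by_contra h; exact hz' ⟨hz.1, (key z hz.1 h).symm.trans hz.2⟩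
    have e2 : T w = X 0 := by
      by_contra h; exact hw' ⟨hw.1, (key w hw.1 h).trans hw.2⟩
    rw [hq z w e1 e2] at hz
    exact hw' hz
  have h1 : a s * x ∈ dil (a s) S ↔ a s * x ∈ dil (a t) S := by rw [heq]
  have hsx : a s * x ≠ 0 := mul_ne_zero (ha s) hx
  rw [hmem, hmem, inv_mul_cancel_left₀ (ha s), show (a t)⁻¹ * (a s * x) = a s / a t * x by ring] at h1
  simp only [hsx, ne_eq, not_false_iff, true_and] at h1
  have h2 := hX x hx
  have h3 := hX (a s / a t * x) (by simp [ha, hx])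
  rcases h2 with h2 | h2
  · rw [h2, h1.1 h2]
  · rcases h3 with h3 | h3
    · exact absurd ((h1.2 h3).symm.trans h2) h12
    · rw [h2, h3]

/-- A line with one point of a rare colour and two further colours is impossible. -/
theorem not_singles (ha : ∀ s, a s ≠ 0) (hg : Good a) (hp5 : 5 ≤ p) {X : ZMod p → κ} {c₁ c₂ : κ}
    (h12 : c₁ ≠ c₂) (hX : ∀ x, x ≠ 0 → X x = c₁ ∨ X x = c₂) (hX0 : ∀ x, x ≠ 0 → X x ≠ X 0)
    (h1 : ∃ x, x ≠ 0 ∧ X x = c₁) (h2 : ∃ x, x ≠ 0 ∧ X x = c₂)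
    (hT : ∀ s t, s ≠ t → ∃ T : ZMod p → κ, Compat a s t X T ∧
      (∀ v v', T v = X 0 → T v' = X 0 → v = v') ∧ ∃ v, T v ≠ c₁ ∧ T v ≠ c₂) : False := by
  have hinv : ∀ s t, s ≠ t → ∀ x, x ≠ 0 → X (a s / a t * x) = X x := by
    intro s t hst x hx
    obtain ⟨T, h3, h4, -⟩ := hT s t hst
    exact ratio_invariant ha h12 hX hX0 h3 h4 hx
  have hsym : ∀ c, (∃ x, x ≠ 0 ∧ X x = c) → ∀ x, x ≠ 0 → X x = c ∨ X (-x) = c := by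
    intro c hc x hx
    have := hg.mem_or_neg_mem (S := {x | x ≠ 0 ∧ X x = c}) hc (by simp) (by
      rintro i j hij x ⟨hx, hxc⟩
      left
      exact ⟨by simp [ha, hx], by rw [hinv i j hij x hx, hxc]⟩) hx
    exact this.imp (fun h => h.2) (fun h => h.2)
  -- By goodness each colour meets every pair `{x, -x}`; with two colours, `x` and `-x` are coloured
  -- differently.
  have hanti : ∀ x, x ≠ 0 → X (-x) ≠ X x := by
    intro x hx h
    have e1 := hsym c₁ h1 x hx
    have e2 := hsym c₂ h2 x hx
    rw [h, or_self] at e1 e2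
    exact h12 (e1.symm.trans e2)
  -- Goodness puts `2` or `-2` among the multipliers preserving `X`; the square is `4` in either
  -- case.
  have h4 : ∀ x, x ≠ 0 → X (4 * x) = X x := by
    have hK := hg.mem_or_neg_mem (x := ((2 : ℕ) : ZMod p)) (S := {k | k ≠ 0 ∧ ∀ x, x ≠ 0 → X (k * x) = X x}) ⟨1, by simp⟩
      (by simp) (by
        rintro i j hij k ⟨hk, hkX⟩
        left
        refine ⟨by simp [ha, hk], fun x hx => ?_⟩
        rw [mul_assoc, hinv i j hij _ (mul_ne_zero hk hx), hkX x hx])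
    intro x hx
    have h2 : ((2 : ℕ) : ZMod p) ≠ 0 := natCast_ne_zero_of_lt (by omega) (by omega)
    rcases hK h2 with h | h
    · have e1 := h.2 x hx
      have e2 := h.2 (((2 : ℕ) : ZMod p) * x) (mul_ne_zero h2 hx)
      rw [← e1, ← e2]; congr 1; push_cast; ring
    · have e1 := h.2 x hx
      have e2 := h.2 (-((2 : ℕ) : ZMod p) * x) (mul_ne_zero (neg_ne_zero.2 h2) hx)
      rw [← e1, ← e2]; congr 1; push_cast; ring
  obtain ⟨T, hc, -, v, hv1, hv2⟩ := hT 0 1 (by decide)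
  have hTv : ∀ x y, x ≠ 0 → y ≠ 0 → a 0 * x + a 1 * y = v → X x = X y := by
    intro x y hx hy hxy
    have := hc x y
    rw [hxy] at this
    rcases hX x hx with e1 | e1 <;> rcases hX y hy with e2 | e2 <;> rw [e1, e2] at this ⊢ <;> tauto
  have hv0 : v ≠ 0 := by
    rintro rfl
    have h1 : a 0 / a 1 * 1 ≠ 0 := by simp [ha]
    have := hTv 1 (-(a 0 / a 1 * 1)) one_ne_zero (neg_ne_zero.2 h1) (by field_simp [ha 1]; ring)
    rw [← hinv 0 1 (by decide) 1 one_ne_zero] at this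
    exact hanti _ h1 this.symm
  -- Since `T v` is neither `c₁` nor `c₂`, nonzero solutions of `a 0 * x + a 1 * y = v` are
  -- monochromatic. In the normalised variable, with the antisymmetry, this makes `g` alternate
  -- along `1, 2, 3, 4`, so `g 1 ≠ g 4`, against invariance under `4`.
  set g : ZMod p → κ := fun u => X ((a 0)⁻¹ * v * u) with hg
  have hstep : ∀ u, u ≠ 0 → u ≠ 1 → g (u - 1) ≠ g u := by
    intro u hu hu1
    have hu1' : 1 - u ≠ 0 := sub_ne_zero.2 hu1.symm
    have hz : (a 0)⁻¹ * v * (1 - u) ≠ 0 := by simp [ha, hv0, hu1']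
    have e1 := hTv ((a 0)⁻¹ * v * u) (a 0 / a 1 * ((a 0)⁻¹ * v * (1 - u))) (by simp [ha, hv0, hu])
      (by simp [ha, hv0, hu1']) (by field_simp [ha 0, ha 1]; ring)
    rw [hinv 0 1 (by decide) _ hz] at e1
    simp only [hg]
    rw [e1, show (a 0)⁻¹ * v * (u - 1) = -((a 0)⁻¹ * v * (1 - u)) by ring]
    exact hanti _ hz
  have hne : ∀ k : ℕ, 2 ≤ k → k < p → g ((k - 1 : ℕ) : ZMod p) ≠ g (k : ZMod p) := by
    intro k hk hkp
    have := hstep k (natCast_ne_zero_of_lt (by omega) hkp) (by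
      rw [← Nat.cast_one]; intro h; have := natCast_injOn_lt hkp (by omega) h; omega)
    rwa [Nat.cast_sub (by omega), Nat.cast_one]
  have gc : ∀ k : ℕ, 0 < k → k < p → g k = c₁ ∨ g k = c₂ := by
    intro k hk hkp
    exact hX _ (by simp only [ne_eq, mul_eq_zero, inv_eq_zero, ha, hv0, false_or];
                   exact natCast_ne_zero_of_lt hk hkp)
  have e1 := hne 2 (by omega) (by omega)
  have e2 := hne 3 (by omega) (by omega)
  have e3 := hne 4 (by omega) (by omega)
  have e4 : g ((4 : ℕ) : ZMod p) = g ((1 : ℕ) : ZMod p) := by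
    simp only [hg]
    rw [← h4 ((a 0)⁻¹ * v * ((1 : ℕ) : ZMod p)) (by simp [ha, hv0])]
    congr 1; push_cast; ring
  have g1 := gc 1 (by omega) (by omega)
  have g2 := gc 2 (by omega) (by omega)
  have g3 := gc 3 (by omega) (by omega)
  rw [e4] at e3
  simp only [Nat.reduceSub] at e1 e2 e3
  rcases g1 with g1 | g1 <;> rcases g2 with g2 | g2 <;> rcases g3 with g3 | g3 <;>
    rw [g1, g2] at e1 <;> rw [g2, g3] at e2 <;> rw [g3, g1] at e3 <;> tauto

end Singles

/-! ### Three-colourings of `ℤ/p`: transfer of boundaries between classes -/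

section ThreeColours

theorem fin3_univ : ∀ i j k : Fin 3, i ≠ j → i ≠ k → j ≠ k → univ = {i, j, k} := by decide

theorem fin3_third : ∀ s t : Fin 3, s ≠ t → ∃ u, s ≠ u ∧ t ≠ u := by decide

variable {p : ℕ} [hp : Fact p.Prime]

/-- A colouring with three colours and no rainbow solution, in any order of the coefficients. -/
def TriFree (a : Fin 3 → ZMod p) (b : ZMod p) (c : ZMod p → Fin 3) : Prop :=
  ∀ s t u, s ≠ t → s ≠ u → t ≠ u → ∀ x y z, a s * x + a t * y + a u * z = b →
    c x = c y ∨ c x = c z ∨ c y = c z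

variable {a : Fin 3 → ZMod p} {b : ZMod p} {c : ZMod p → Fin 3}

theorem card_core (A : Finset (ZMod p)) (τ : ZMod p) : #(A ∩ shift τ A) = #A - bdry A τ := by
  have := card_inter_shift A τ; omega

/-- A surjective three-colouring of the line with no rainbow solution. -/
structure TriColoring (a : Fin 3 → ZMod p) (b : ZMod p) (c : ZMod p → Fin 3) : Prop where
  ne : ∀ s, a s ≠ 0
  good : Good a
  surj : Function.Surjective c
  free : TriFree a b c

namespace TriColoring

variable (T : TriColoring a b c)

include T

theorem cls_ne {i j k : Fin 3} (hij : i ≠ j) (hik : i ≠ k)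
    (hjk : j ≠ k) {s t u : Fin 3} (hst : s ≠ t) (hsu : s ≠ u) (htu : t ≠ u) :
    ∀ x ∈ cls c i, ∀ y ∈ cls c j, ∀ z ∈ cls c k, a s * x + a t * y + a u * z ≠ b := by
  intro x hx y hy z hz h
  rw [mem_cls] at hx hy hz
  have := T.free s t u hst hsu htu x y z h
  rw [hx, hy, hz] at this
  tauto

/-- Moving `x` by `τ` is compensated by moving `y` by `-(a s / a t) * τ`. Thus shrinking class `i`
to its overlap with its translate permits enlarging class `j` by a translate, still without a
solution. -/
theorem core_ne {i j k : Fin 3} (hij : i ≠ j)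
    (hik : i ≠ k) (hjk : j ≠ k) {s t u : Fin 3} (hst : s ≠ t) (hsu : s ≠ u) (htu : t ≠ u)
    (τ : ZMod p) :
    ∀ z ∈ cls c k, ∀ x ∈ cls c i ∩ shift τ (cls c i),
      ∀ y ∈ cls c j ∪ shift (-(a s / a t * τ)) (cls c j), a u * z + a s * x + a t * y ≠ b := by
  intro z hz x hx y hy h
  rw [mem_inter, mem_shift] at hx
  rw [mem_union, mem_shift] at hy
  rcases hy with hy | hy
  · exact T.cls_ne hij hik hjk hst hsu htu x hx.1 y hy z hz (by linear_combination h)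
  · refine T.cls_ne hij hik hjk hst hsu htu _ hx.2 _ hy z hz ?_
    have : a t * (a s / a t * τ) = a s * τ := by field_simp [T.ne t]
    linear_combination h + this

theorem cls_nonempty (i : Fin 3) : (cls c i).Nonempty := by
  obtain ⟨x, hx⟩ := T.surj i; exact ⟨x, mem_cls.2 hx⟩

theorem cls_pos (i : Fin 3) : 0 < #(cls c i) := card_pos.2 (T.cls_nonempty i)

omit T in
theorem sum_cls {i j k : Fin 3} (hij : i ≠ j) (hik : i ≠ k) (hjk : j ≠ k) :
    #(cls c i) + #(cls c j) + #(cls c k) = p := by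
  have h2 : ∑ i, #(cls c i) = p := by
    have := Finset.card_eq_sum_card_fiberwise (s := (univ : Finset (ZMod p))) (t := univ) (f := c)
      (fun _ _ => by simp)
    rw [card_univ, ZMod.card] at this
    exact this.symm
  refine Eq.trans ?_ h2
  rw [fin3_univ i j k hij hik hjk, sum_insert (by simp [*]), sum_insert (by simp [*]),
    sum_singleton, add_assoc]

/-- Cauchy–Davenport for the three sets of `core_ne`: class `i` has lost its boundary, class `j` has
gained its own, and the sizes add up to at most `p + 1`. -/
theorem bdry_le_add_one {i j : Fin 3} (hij : i ≠ j) {s t : Fin 3} (hst : s ≠ t) {τ : ZMod p}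
    (h : bdry (cls c i) τ < #(cls c i)) :
    bdry (cls c j) (a s / a t * τ) ≤ bdry (cls c i) τ + 1 := by
  obtain ⟨k, hik, hjk⟩ := fin3_third i j hij
  obtain ⟨u, hsu, htu⟩ := fin3_third s t hst
  have h1 := card_trio_le' (T.ne u) (T.ne s) (T.ne t) (T.cls_nonempty k)
    (card_pos.1 (by rw [card_core]; omega)) ((T.cls_nonempty j).mono subset_union_left)
    (T.core_ne hij hik hjk hst hsu htu τ)
  rw [card_union_shift, bdry_neg, card_core] at h1
  have h2 := sum_cls (c := c) hij hik hjk
  omega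

/-- The loss of 1 in `bdry_le_add_one` is the extremal case, in which Vosper would make class `k` a
progression. -/
theorem bdry_le {i j k : Fin 3} (hij : i ≠ j) (hik : i ≠ k) (hjk : j ≠ k) {s t : Fin 3}
    (hst : s ≠ t) {τ : ZMod p} (h : bdry (cls c i) τ + 2 ≤ #(cls c i)) (hj : 2 ≤ #(cls c j))
    (hk : 2 ≤ #(cls c k)) (hkd : ∀ d, d ≠ 0 → 2 ≤ bdry (cls c k) d) :
    bdry (cls c j) (a s / a t * τ) ≤ bdry (cls c i) τ := by
  obtain ⟨u, hsu, htu⟩ := fin3_third s t hst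
  by_contra hlt
  have h2 := sum_cls (c := c) hij hik hjk
  have h3 := card_union_shift (cls c j) (-(a s / a t * τ))
  have h4 := card_core (cls c i) τ
  rw [bdry_neg] at h3
  obtain ⟨d, hd, h5⟩ := bdry_of_trio (T.ne u) (T.ne s) (T.ne t) hk
    (by omega) (by omega) (T.core_ne hij hik hjk hst hsu htu τ) (by omega)
  have := hkd d hd
  omega

/-- If every ratio is `± m` with `m ≤ 3`, the coefficients are not good. -/
theorem not_small_ratios (hp11 : 11 ≤ p) (h : ∀ s t, s ≠ t → ∃ m : ℕ, m ≤ 3 ∧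
    (a s / a t = m ∨ a s / a t = -m)) : False := by
  have h1 : ∀ s t, s ≠ t → a s / a t = 1 ∨ a s / a t = -1 := by
    intro s t hst
    obtain ⟨m, hm, hm'⟩ := h s t hst
    obtain ⟨l, hl, hl'⟩ := h t s hst.symm
    have e : (a s / a t) * (a t / a s) = 1 := by field_simp [T.ne s, T.ne t]
    -- A ratio times its inverse gives `± m * l = 1` with `m * l ≤ 9`; as `p ≥ 11` this forces `m =
    -- 1`, so all ratios are `± 1` and `{1, -1}` contradicts goodness.
    have key : ((m * l : ℕ) : ZMod p) = 1 ∨ ((m * l + 1 : ℕ) : ZMod p) = 0 := by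
      rcases hm' with h1 | h1 <;> rcases hl' with h2 | h2 <;> rw [h1, h2] at e
      · left; push_cast; linear_combination e
      · right; push_cast; linear_combination -e
      · right; push_cast; linear_combination -e
      · left; push_cast; linear_combination e
    have hml : m * l ≤ 9 := Nat.mul_le_mul hm hl
    rcases key with h1 | h1
    · rw [← Nat.cast_one] at h1
      have h2 := natCast_injOn_lt (by omega) (by omega) h1
      rw [Nat.eq_one_of_mul_eq_one_right h2] at hm'
      simpa using hm'
    · exact absurd h1 (natCast_ne_zero_of_lt (by omega) (by omega))
  have h2 := T.good.mem_or_neg_mem (S := {1}) (x := ((2 : ℕ) : ZMod p)) (by simp) (by simp) (by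
    rintro s t hst x rfl
    rcases h1 s t hst with h | h <;> simp [h]) (natCast_ne_zero_of_lt (by omega) (by omega))
  simp only [Set.mem_singleton_iff] at h2
  rcases h2 with h2 | h2
  · rw [← Nat.cast_one] at h2
    have := natCast_injOn_lt (by omega) (by omega) h2
    omega
  · have h3 : ((3 : ℕ) : ZMod p) = 0 := by push_cast at h2 ⊢; linear_combination -h2
    exact natCast_ne_zero_of_lt (by omega) (by omega) h3

/-- If all ratios satisfy `x ^ (2 * k) = 1`, then so do all nonzero residues. -/
theorem pow_eq_one {k : ℕ} (h : ∀ s t, s ≠ t → (a s / a t) ^ (2 * k) = 1) {x : ZMod p}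
    (hx : x ≠ 0) (hk : k ≠ 0) : x ^ (2 * k) = 1 := by
  have h2 := T.good.mem_or_neg_mem (S := {x | x ^ (2 * k) = 1}) (x := x) ⟨1, by simp⟩ (by simp [hk]) (by
    rintro s t hst x hx
    left
    simp only [Set.mem_ofPred_eq] at hx ⊢
    rw [mul_pow, hx, h s t hst, one_mul]) hx
  simpa [pow_mul] using h2

omit T in
theorem ratio_mul (ha : ∀ s, a s ≠ 0) {s t u : Fin 3} :
    a s / a t = a u / a t * (a s / a u) := by
  field_simp [ha u, ha t]

omit T in
/-- A set closed under products of two ratios is closed under ratios. -/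
theorem exists_ratio_mul (ha : ∀ s, a s ≠ 0) {s t : Fin 3} (hst : s ≠ t) :
    ∃ u, u ≠ t ∧ s ≠ u ∧ a s / a t = a u / a t * (a s / a u) := by
  obtain ⟨u, hsu, htu⟩ := fin3_third s t hst
  exact ⟨u, htu.symm, hsu, ratio_mul ha⟩

/-- A large class is not a progression. -/
theorem two_le_bdry (hp11 : 11 ≤ p) {j k : Fin 3} (hjk : j ≠ k) (hj : 3 ≤ #(cls c j))
    (hk : 4 ≤ #(cls c k)) (hk' : #(cls c k) + 4 ≤ p) : ∀ d, d ≠ 0 → 2 ≤ bdry (cls c k) d := by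
  intro d hd
  by_contra hlt
  -- Each ratio is a product of two. Going from class `k` to `j` and back loses at most 1 each time,
  -- so `(a s / a t) * d` has boundary at most 3 in a `d`-progression and is `± m * d` with `m ≤ 3`.
  refine T.not_small_ratios hp11 fun s t hst => ?_
  obtain ⟨u, hut, hsu, e⟩ := exists_ratio_mul T.ne hst
  have h1 := T.bdry_le_add_one hjk.symm hsu (τ := d) (by omega)
  have h2 := T.bdry_le_add_one hjk hut (τ := a s / a u * d) (by omega)
  rw [← mul_assoc, ← e] at h2
  obtain ⟨m, hm, h3⟩ := exists_small_multiple (k := 3) hd (by omega : bdry (cls c k) d ≤ 1)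
    (τ := a s / a t * d) (by omega) (by omega) (by omega)
  refine ⟨m, hm, h3.imp (fun h => mul_right_cancel₀ hd h) fun h => ?_⟩
  apply mul_right_cancel₀ hd
  rw [h]; ring

/-- A closed property of nonzero directions holds in every direction. -/
theorem forall_of_closed {P : ZMod p → Prop} (hneg : ∀ τ, P τ → P (-τ)) {τ₀ : ZMod p} (h0 : τ₀ ≠ 0)
    (hP : P τ₀) (h : ∀ τ, τ ≠ 0 → P τ → ∀ s t u, s ≠ u → u ≠ t → P (a u / a t * (a s / a u * τ)))
    {τ : ZMod p} (hτ : τ ≠ 0) : P τ := by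
  have h2 := T.good.mem_or_neg_mem (S := {x | x ≠ 0 ∧ P x}) (x := τ) ⟨τ₀, h0, hP⟩ (by simp) (by
    rintro s t hst x ⟨hx, hPx⟩
    left
    obtain ⟨u, hut, hsu, e⟩ := exists_ratio_mul T.ne hst
    refine ⟨by simp [T.ne, hx], ?_⟩
    rw [e, mul_assoc]
    exact h x hx hPx s t u hsu hut) hτ
  rcases h2 with h2 | h2
  · exact h2.2
  · simpa using hneg _ h2.2

/-- After moving the singleton to `0` this is `not_singles`, with `T` the same colouring read off at
the third entry. -/
theorem not_one {i : Fin 3} (hp5 : 5 ≤ p) (hi : #(cls c i) = 1) : False := by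
  obtain ⟨w, hw⟩ := card_eq_one.1 hi
  have hw' : ∀ x, c x = i ↔ x = w := fun x => by rw [← mem_cls, hw, mem_singleton]
  obtain ⟨j, k, hij, hik, hjk⟩ : ∃ j k : Fin 3, i ≠ j ∧ i ≠ k ∧ j ≠ k := by
    clear * -; revert i; decide
  have hcw : c w = i := (hw' w).2 rfl
  refine not_singles T.ne T.good hp5 (X := fun x => c (w + x)) hjk ?_ ?_ ?_ ?_ ?_
  · intro x hx
    have h1 : c (w + x) ≠ i := fun h => hx (by simpa using (hw' _).1 h)
    have h2 := mem_univ (c (w + x))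
    rw [fin3_univ i j k hij hik hjk] at h2
    simpa [h1] using h2
  · intro x hx h
    simp only [add_zero, hcw, hw', add_eq_left] at h
    exact hx h
  · obtain ⟨x, hx⟩ := T.surj j
    refine ⟨x - w, sub_ne_zero.2 fun h => ?_, by simpa using hx⟩
    rw [h, hcw] at hx; exact hij hx
  · obtain ⟨x, hx⟩ := T.surj k
    refine ⟨x - w, sub_ne_zero.2 fun h => ?_, by simpa using hx⟩
    rw [h, hcw] at hx; exact hik hx
  · intro s t hst
    obtain ⟨u, hsu, htu⟩ := fin3_third s t hst
    refine ⟨fun v => c ((b - (a s + a t) * w - v) / a u), ?_, ?_, ?_⟩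
    · intro x y
      have := T.free s t u hst hsu htu (w + x) (w + y) ((b - (a s + a t) * w - (a s * x + a t * y)) / a u)
        (by field_simp [T.ne u]; ring)
      tauto
    · intro v v' h1 h2
      simp only [add_zero, hcw, hw'] at h1 h2
      have hu := T.ne u
      rw [div_eq_iff hu] at h1 h2
      linear_combination h2 - h1
    · refine ⟨b - (a s + a t) * w - a u * w, ?_⟩
      dsimp only
      rw [show (b - (a s + a t) * w - (b - (a s + a t) * w - a u * w)) / a u = w by
        field_simp [T.ne u]; ring, hcw]
      exact ⟨hij, hik⟩

end TriColoring

end ThreeColours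

/-! ### Three-colourings with all classes of size at least three -/

section ThreeColours

variable {p : ℕ} [hp : Fact p.Prime]

theorem sum_bdry_le {A : Finset (ZMod p)} {k : ℕ} (h : ∀ τ, τ ≠ 0 → bdry A τ ≤ k) :
    #A * (p - #A) ≤ (p - 1) * k := by
  rw [← sum_bdry_ne_zero]
  refine (sum_le_card_nsmul _ _ k fun τ hτ => h τ (mem_erase.1 hτ).1).trans ?_
  rw [card_erase_of_mem (mem_univ _), card_univ, ZMod.card, smul_eq_mul]

theorem le_sum_bdry {A : Finset (ZMod p)} {k : ℕ} (h : ∀ τ, τ ≠ 0 → k ≤ bdry A τ) :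
    (p - 1) * k ≤ #A * (p - #A) := by
  rw [← sum_bdry_ne_zero]
  refine le_trans ?_ (card_nsmul_le_sum _ _ k fun τ hτ => h τ (mem_erase.1 hτ).1)
  rw [card_erase_of_mem (mem_univ _), card_univ, ZMod.card, smul_eq_mul]

/-- Three translates of a set with small overlaps. -/
theorem three_translates {B : Finset (ZMod p)} {n : ℕ} (hn : #B = n)
    (h : ∀ τ, τ ≠ 0 → n ≤ bdry B τ + 1) {x y z : ZMod p} (hxy : x ≠ y) (hxz : x ≠ z)
    (hyz : y ≠ z) : 3 * n ≤ #((shift x B ∪ shift y B) ∪ shift z B) + 3 ∧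
      (bdry B (x - y) = n → 3 * n ≤ #((shift x B ∪ shift y B) ∪ shift z B) + 2) := by
  have hint : ∀ x y, #(shift x B ∩ shift y B) + bdry B (x - y) = n := by
    intro x y
    rw [← hn, ← card_inter_shift B (x - y), ← card_shift y (B ∩ shift (x - y) B)]
    congr 2
    ext w
    simp only [mem_inter, mem_shift, show w - y - (x - y) = w - x by ring]
    exact and_comm
  have h1 := card_union_add_card_inter (shift x B) (shift y B)
  have h2 := card_union_add_card_inter (shift x B ∪ shift y B) (shift z B)
  have h3 : #((shift x B ∪ shift y B) ∩ shift z B) ≤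
      #(shift x B ∩ shift z B) + #(shift y B ∩ shift z B) := by
    rw [union_inter_distrib_right]; exact card_union_le _ _
  rw [card_shift, card_shift, hn] at h1
  rw [card_shift, hn] at h2
  have e1 := hint x y
  have e2 := hint x z
  have e3 := hint y z
  have f1 := h _ (sub_ne_zero.2 hxy)
  have f2 := h _ (sub_ne_zero.2 hxz)
  have f3 := h _ (sub_ne_zero.2 hyz)
  omega

/-- The boundary sums for class sizes `x, y, y` when the two larger classes have boundary `x` in
every direction. The only survivor, `4, 6, 6`, has total 16, which is not prime. -/
theorem eq_four_six {x y : ℕ} (h3 : 3 ≤ x) (h1 : x ≤ y)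
    (h : y * (x + y) = (x + 2 * y - 1) * x) (f : (x + 2 * y - 1) * (x - 1) ≤ x * (y + y)) :
    x = 4 ∧ y = 6 := by
  obtain ⟨e, rfl⟩ := Nat.exists_eq_add_of_le h1
  obtain ⟨x, rfl⟩ := Nat.exists_eq_add_of_le h3
  rw [show 3 + x + 2 * (3 + x + e) - 1 = 8 + 3 * x + 2 * e by omega] at h f
  rw [show 3 + x - 1 = 2 + x by omega] at f
  have he : e ≤ 2 := by
    by_contra hgt
    obtain ⟨g, rfl⟩ := Nat.exists_eq_add_of_le (show 3 ≤ e by omega)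
    nlinarith
  interval_cases e
  · nlinarith
  · have : x * x + 4 * x + 2 = 0 := by nlinarith
    omega
  · have h4 : x * x + 3 * x = 4 := by nlinarith
    have : x ≤ 1 := by by_contra h; nlinarith
    interval_cases x <;> omega

variable {a : Fin 3 → ZMod p} {b : ZMod p} {c : ZMod p → Fin 3}

namespace TriColoring

variable (T : TriColoring a b c)

include T

theorem card_add_le {i j k : Fin 3} (hij : i ≠ j) (hik : i ≠ k) (hjk : j ≠ k) {s t : Fin 3}
    (hst : s ≠ t) : #(dil (a s) (cls c i) + dil (a t) (cls c j)) ≤ #(cls c i) + #(cls c j) := by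
  obtain ⟨u, hsu, htu⟩ := fin3_third s t hst
  have h1 := card_trio_le (T.ne u) (T.cls_ne hij hik hjk hst hsu htu)
  have := sum_cls (c := c) hij hik hjk
  omega

omit T in
theorem translates_subset {α β : ZMod p} {A B : Finset (ZMod p)} {x y z : ZMod p} (hx : x ∈ A)
    (hy : y ∈ A) (hz : z ∈ A) :
    (shift (α * x) (dil β B) ∪ shift (α * y) (dil β B)) ∪ shift (α * z) (dil β B) ⊆
      dil α A + dil β B := by
  intro w hw
  simp only [mem_union, mem_shift] at hw
  rcases hw with (h | h) | h
  · exact mem_add.2 ⟨_, mul_mem_dil hx, _, h, by ring⟩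
  · exact mem_add.2 ⟨_, mul_mem_dil hy, _, h, by ring⟩
  · exact mem_add.2 ⟨_, mul_mem_dil hz, _, h, by ring⟩

/-- The smallest class is not a progression. -/
theorem not_progression_min {i j k : Fin 3} (hij : i ≠ j) (hik : i ≠ k) (hjk : j ≠ k)
    (hp11 : 11 ≤ p) (h3 : 3 ≤ #(cls c i)) (h1 : #(cls c i) ≤ #(cls c j))
    (h2 : #(cls c j) ≤ #(cls c k)) {d : ZMod p} (hd : d ≠ 0) (hid : bdry (cls c i) d ≤ 1) :
    False := by
  have hsum := sum_cls (c := c) hij hik hjk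
  rcases h3.eq_or_lt with h3 | h4
  -- Size 3 is too small for `two_le_bdry`. Class `k` is not a progression, though, so passing from
  -- `i` to `j` costs nothing and the round trip costs only 1.
  · have hk := T.two_le_bdry hp11 hjk (by omega) (by omega) (by omega)
    refine T.not_small_ratios hp11 fun s t hst => ?_
    obtain ⟨u, hut, hsu, e⟩ := exists_ratio_mul T.ne hst
    have e1 := T.bdry_le hij hik hjk hsu (τ := d) (by omega) (by omega) (by omega) hk
    have e2 := T.bdry_le_add_one hij.symm hut (τ := a s / a u * d) (by omega)
    rw [← mul_assoc, ← e] at e2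
    obtain ⟨m, hm, h3⟩ := exists_small_multiple (k := 2) hd hid
      (τ := a s / a t * d) (by omega) (by omega) (by omega)
    refine ⟨m, by omega, h3.imp (fun h => mul_right_cancel₀ hd h) fun h => ?_⟩
    apply mul_right_cancel₀ hd
    rw [h]; ring
  · have := T.two_le_bdry hp11 hij.symm (by omega) (by omega) (by omega) d hd
    omega

/-- No two large classes have a direction with two overlaps. -/
theorem bdry_add_one_ge {i j k : Fin 3} (hij : i ≠ j) (hik : i ≠ k) (hjk : j ≠ k)
    (hp11 : 11 ≤ p) (h3 : 3 ≤ #(cls c i)) (h1 : #(cls c i) ≤ #(cls c j))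
    (h2 : #(cls c j) ≤ #(cls c k)) (hi : ∀ d, d ≠ 0 → 2 ≤ bdry (cls c i) d) :
    ∀ τ, τ ≠ 0 → #(cls c j) ≤ bdry (cls c j) τ + 1 := by
  by_contra! hex
  have hsum := sum_cls (c := c) hij hik hjk
  -- take a direction of minimal boundary
  obtain ⟨τ₀, hτ₀, hmin⟩ := exists_min_image (univ.erase (0 : ZMod p)) (bdry (cls c j))
    ⟨1, by simp⟩
  simp only [mem_erase, mem_univ, and_true] at hτ₀ hmin
  set β := bdry (cls c j) τ₀ with hβ
  have hb2 : β + 2 ≤ #(cls c j) := by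
    obtain ⟨τ, hτ, h⟩ := hex
    have := hmin τ hτ
    omega
  have h01 : (0 : Fin 3) ≠ 1 := by decide
  -- As class `i` is not a progression, the round trip from `j` to `k` and back does not increase
  -- the boundary; goodness carries the minimum `β` to every direction.
  have hj : ∀ τ, τ ≠ 0 → bdry (cls c j) τ ≤ β := by
    intro τ hτ
    refine T.forall_of_closed (P := fun τ => bdry (cls c j) τ ≤ β)
      (fun τ h => by rwa [bdry_neg]) hτ₀ le_rfl ?_ hτ
    intro τ _ h s t u hsu hut
    have e1 := T.bdry_le hjk hij.symm hik.symm hsu (τ := τ) (by omega) (by omega) (by omega) hi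
    have e2 := T.bdry_le hjk.symm hik.symm hij.symm hut (τ := a s / a u * τ) (by omega) (by omega)
      (by omega) hi
    omega
  have hconv : ∀ τ, a 0 / a 1 * (a 1 / a 0 * τ) = τ := fun τ => by field_simp [T.ne 0, T.ne 1]
  have hrne : ∀ τ, τ ≠ 0 → a 1 / a 0 * τ ≠ 0 := fun τ hτ => by simp [T.ne, hτ]
  have hk : ∀ τ, τ ≠ 0 → bdry (cls c k) τ ≤ β := by
    intro τ hτ
    have e0 := hj _ (hrne τ hτ)
    have e1 := T.bdry_le hjk hij.symm hik.symm h01 (τ := a 1 / a 0 * τ) (by omega)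
      (by omega) (by omega) hi
    rw [hconv] at e1
    omega
  have hk' : ∀ τ, τ ≠ 0 → β ≤ bdry (cls c k) τ := by
    intro τ hτ
    have e0 := hk τ hτ
    have e1 := T.bdry_le hjk.symm hik.symm hij.symm h01 (τ := τ) (by omega)
      (by omega) (by omega) hi
    have := hmin (a 0 / a 1 * τ) (by simp [T.ne, hτ])
    omega
  have s1 := sum_bdry_le hj
  have s2 := le_sum_bdry hmin
  have s3 := sum_bdry_le hk
  have s4 := le_sum_bdry hk'
  -- Both classes have constant boundary `β`, so their boundary sums agree.
  have hjk' : #(cls c j) = #(cls c k) := by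
    obtain ⟨e, he⟩ := Nat.exists_eq_add_of_le h2
    have e1 : p - #(cls c j) = #(cls c i) + #(cls c k) := by omega
    have e2 : p - #(cls c k) = #(cls c i) + #(cls c j) := by omega
    have e3 : #(cls c j) * (p - #(cls c j)) = #(cls c k) * (p - #(cls c k)) := by omega
    rw [e1, e2, he] at e3
    have : e * #(cls c i) = 0 := by nlinarith
    rcases mul_eq_zero.1 this with h | h
    · omega
    · omega
  have hβ2 : 2 ≤ β := by
    by_contra hlt
    have : (p - 1) * β ≤ (p - 1) * 1 := Nat.mul_le_mul_left _ (by omega)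
    have e1 : p - #(cls c j) = #(cls c i) + #(cls c k) := by omega
    rw [e1] at s1
    have : 3 * (#(cls c i) + #(cls c k)) ≤ #(cls c j) * (#(cls c i) + #(cls c k)) :=
      Nat.mul_le_mul_right _ (by omega)
    omega
  have hkd : ∀ d, d ≠ 0 → 2 ≤ bdry (cls c k) d := fun d hd => hβ2.trans (hk' d hd)
  have hi' : ∀ τ, τ ≠ 0 → bdry (cls c i) τ ≤ β := by
    intro τ hτ
    have e0 := hj _ (hrne τ hτ)
    have e1 := T.bdry_le hij.symm hjk hik h01 (τ := a 1 / a 0 * τ) (by omega)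
      (by omega) (by omega) hkd
    rw [hconv] at e1
    omega
  have hi2 : ∀ τ, τ ≠ 0 → β ≤ bdry (cls c i) τ ∨ #(cls c i) ≤ bdry (cls c i) τ + 1 := by
    intro τ hτ
    by_contra! hc
    have e1 := T.bdry_le hij hik hjk h01 (τ := τ) (by omega) (by omega) (by omega) hkd
    have := hmin (a 0 / a 1 * τ) (by simp [T.ne, hτ])
    omega
  have hβle : β ≤ #(cls c i) := by
    obtain ⟨x, hx, y, hy, hxy⟩ := one_lt_card.1 (by omega : 1 < #(cls c i))
    have hlt : bdry (cls c i) (x - y) < #(cls c i) := by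
      have := card_inter_shift (cls c i) (x - y)
      have : 0 < #(cls c i ∩ shift (x - y) (cls c i)) :=
        card_pos.2 ⟨x, mem_inter.2 ⟨hx, by rw [mem_shift]; simpa using hy⟩⟩
      omega
    have e1 := T.bdry_le_add_one hij h01 hlt
    have := hmin (a 0 / a 1 * (x - y)) (by simp [T.ne, sub_ne_zero.2 hxy])
    omega
  have e1 : p - #(cls c j) = #(cls c i) + #(cls c k) := by omega
  have e2 : p - #(cls c i) = #(cls c j) + #(cls c k) := by omega
  have e3 : p - 1 = #(cls c i) + 2 * #(cls c j) - 1 := by omega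
  -- If `β = #(cls c i)`, the sizes are `4, 6, 6`. If `β` is smaller, class `i` also has constant
  -- boundary `β`, all classes have equal size and `3 ∣ p`.
  rcases hβle.eq_or_lt with hβi | hβi
  · have s5 := le_sum_bdry (A := cls c i) (k := #(cls c i) - 1) (fun τ hτ => by
      rcases hi2 τ hτ with h | h <;> omega)
    rw [e1, ← hjk', hβi, e3] at s1 s2
    rw [e2, ← hjk', e3] at s5
    obtain ⟨e4, e5⟩ := eq_four_six h3 h1 (le_antisymm s1 s2) s5
    have : p = 16 := by omega
    exact absurd (this ▸ hp.out) (by norm_num)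
  · have s5 := le_sum_bdry (A := cls c i) (k := β) (fun τ hτ => by
      rcases hi2 τ hτ with h | h <;> omega)
    have s6 := sum_bdry_le hi'
    have e7 : #(cls c i) * (p - #(cls c i)) = #(cls c j) * (p - #(cls c j)) := by omega
    rw [e1, e2, ← hjk'] at e7
    obtain ⟨e, he⟩ := Nat.exists_eq_add_of_le h1
    rw [he] at e7
    have : e * #(cls c j) = 0 := by rw [he]; nlinarith
    rcases mul_eq_zero.1 this with h | h
    · have h3p : p = 3 * #(cls c i) := by omega
      have := (Nat.prime_dvd_prime_iff_eq Nat.prime_three hp.out).1 ⟨_, h3p⟩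
      omega
    · omega

/-- Translates of class `j` overlap in at most one point, so three of them already give `3 * #(cls c
j) - 3` elements in a sumset of at most `#(cls c i) + #(cls c j)`. Hence `i` and `j` both have size
3. -/
theorem not_three_le {i j k : Fin 3} (hij : i ≠ j) (hik : i ≠ k) (hjk : j ≠ k)
    (hp11 : 11 ≤ p) (h3 : 3 ≤ #(cls c i)) (h1 : #(cls c i) ≤ #(cls c j))
    (h2 : #(cls c j) ≤ #(cls c k)) : False := by
  have hi : ∀ d, d ≠ 0 → 2 ≤ bdry (cls c i) d := fun d hd => by
    by_contra hlt
    exact T.not_progression_min hij hik hjk hp11 h3 h1 h2 hd (by omega)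
  have hj := T.bdry_add_one_ge hij hik hjk hp11 h3 h1 h2 hi
  have hsum := sum_cls (c := c) hij hik hjk
  have h01 : (0 : Fin 3) ≠ 1 := by decide
  have key : ∀ i j : Fin 3, i ≠ j → ∀ s t : Fin 3, s ≠ t →
      (∀ τ, τ ≠ 0 → #(cls c j) ≤ bdry (cls c j) τ + 1) → ∀ x ∈ cls c i, ∀ y ∈ cls c i,
      ∀ z ∈ cls c i, x ≠ y → x ≠ z → y ≠ z → 2 * #(cls c j) ≤ #(cls c i) + 3 ∧
        (bdry (cls c j) (a s / a t * (x - y)) = #(cls c j) → 2 * #(cls c j) ≤ #(cls c i) + 2) := by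
    intro i j hij s t hst hj x hx y hy z hz hxy hxz hyz
    obtain ⟨k, hik, hjk⟩ := fin3_third i j hij
    have e1 := T.card_add_le hij hik hjk hst
    have e2 := card_le_card (translates_subset (α := a s) (β := a t) (B := cls c j) hx hy hz)
    have e3 := three_translates (B := dil (a t) (cls c j)) (card_dil (T.ne t) _)
      (x := a s * x) (y := a s * y) (z := a s * z) (fun τ hτ => by
        rw [bdry_dil' (T.ne t)]; exact hj _ (by simp [T.ne, hτ]))
      (fun h => hxy (mul_left_cancel₀ (T.ne s) h)) (fun h => hxz (mul_left_cancel₀ (T.ne s) h))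
      (fun h => hyz (mul_left_cancel₀ (T.ne s) h))
    rw [bdry_dil' (T.ne t), show (a t)⁻¹ * (a s * x - a s * y) = a s / a t * (x - y) by ring] at e3
    refine ⟨by omega, fun h => ?_⟩
    have := e3.2 h
    omega
  obtain ⟨x, hx, y, hy, z, hz, hxy, hxz, hyz⟩ := two_lt_card.1 (by omega : 2 < #(cls c i))
  have hsize := (key i j hij 0 1 h01 hj x hx y hy z hz hxy hxz hyz).1
  have hi3 : #(cls c i) = 3 := by omega
  have hj3 : #(cls c j) = 3 := by omega
  -- With size 3 the count is tight: a direction with an overlap in one class must give an overlap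
  -- in the other. By goodness class `i` then overlaps itself in every direction, whence `3 * (p -
  -- 3) ≤ 2 * (p - 1)`.
  have key2 : ∀ i j : Fin 3, i ≠ j → #(cls c i) = 3 → #(cls c j) = 3 →
      (∀ τ, τ ≠ 0 → #(cls c j) ≤ bdry (cls c j) τ + 1) → ∀ s t : Fin 3, s ≠ t → ∀ τ, τ ≠ 0 →
      bdry (cls c i) τ ≤ 2 → bdry (cls c j) (a s / a t * τ) ≤ 2 := by
    intro i j hij hi3 hj3 hj s t hst τ hτ h
    obtain ⟨x, hx⟩ : (cls c i ∩ shift τ (cls c i)).Nonempty := card_pos.1 (by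
      rw [card_core]; omega)
    rw [mem_inter, mem_shift] at hx
    have hne : x ≠ x - τ := fun h => hτ (by linear_combination h)
    obtain ⟨z, hz, hz'⟩ := exists_mem_notMem_of_card_lt_card (s := {x, x - τ}) (t := cls c i) (by
      rw [card_pair hne]; omega)
    simp only [mem_insert, mem_singleton, not_or] at hz'
    have := (key i j hij s t hst hj x hx.1 (x - τ) hx.2 z hz hne (Ne.symm hz'.1) (Ne.symm hz'.2)).2
    rw [sub_sub_cancel] at this
    have h5 := bdry_le_card (cls c j) (a s / a t * τ)
    by_contra hc
    have := this (by omega)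
    omega
  have hi4 : ∀ τ, τ ≠ 0 → #(cls c i) ≤ bdry (cls c i) τ + 1 := fun τ hτ => by
    have := hi τ hτ; omega
  have hfin : ∀ τ, τ ≠ 0 → bdry (cls c i) τ ≤ 2 := by
    intro τ hτ
    refine T.forall_of_closed (P := fun τ => bdry (cls c i) τ ≤ 2)
      (fun τ h => by rwa [bdry_neg]) (τ₀ := x - y) (sub_ne_zero.2 hxy) ?_ ?_ hτ
    · have := card_inter_shift (cls c i) (x - y)
      have : 0 < #(cls c i ∩ shift (x - y) (cls c i)) :=
        card_pos.2 ⟨x, mem_inter.2 ⟨hx, by rw [mem_shift]; simpa using hy⟩⟩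
      omega
    · intro τ hτ h s t u hsu hut
      have e1 := key2 i j hij hi3 hj3 hj s u hsu τ hτ h
      exact key2 j i hij.symm hj3 hi3 hi4 u t hut _ (by simp [T.ne, hτ]) e1
  have := sum_bdry_le hfin
  rw [hi3] at this
  omega

end TriColoring

end ThreeColours

/-! ### Parallelograms, overlaps and small sets of directions -/

section ThreeColours

variable {p : ℕ} [hp : Fact p.Prime]

theorem not_dvd_pow_sub_one {k m : ℕ} (hm : 2 ^ k = m + 1) (hpm : ¬ p ∣ m) :
    (2 : ZMod p) ^ k ≠ 1 := by
  intro h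
  apply hpm
  rw [← ZMod.natCast_eq_zero_iff]
  have : ((2 ^ k : ℕ) : ZMod p) = (m : ZMod p) + 1 := by rw [hm]; push_cast; rfl
  push_cast at this
  linear_combination h - this

/-- Directions with two overlaps in a parallelogram. -/
theorem sq_eq_of_parallelogram {V : Finset (ZMod p)} {v X Y : ZMod p}
    (hV : V = {v, v + X, v + Y, v + X + Y}) (hc : #V = 4) (hp2 : p ≠ 2) {τ : ZMod p} (hτ : τ ≠ 0)
    (h : bdry V τ ≤ 2) : τ ^ 2 = X ^ 2 ∨ τ ^ 2 = Y ^ 2 := by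
  have hX : X ≠ 0 := by
    rintro rfl
    have : V ⊆ {v, v + Y} := by rw [hV]; intro x; simp
    have := (card_le_card this).trans card_le_two
    omega
  have hY : Y ≠ 0 := by
    rintro rfl
    have : V ⊆ {v, v + X} := by rw [hV]; intro x; simp
    have := (card_le_card this).trans card_le_two
    omega
  have hXY : X + Y ≠ 0 := by
    intro h0
    have : V ⊆ {v, v + X, v + Y} := by rw [hV, add_assoc v X Y, h0]; intro x; simp; tauto
    have := (card_le_card this).trans card_le_three
    omega
  have hXY' : X ≠ Y := by
    intro h0
    have : V ⊆ {v, v + X, v + X + X} := by rw [hV, ← h0]; intro x; simp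
    have := (card_le_card this).trans card_le_three
    omega
  have h2 : ∀ z : ZMod p, z + z = 0 → z = 0 := fun z hz =>
    (ZMod.add_self_eq_zero_iff_eq_zero (hp.out.odd_of_ne_two hp2)).1 hz
  by_contra! hne
  obtain ⟨h3, h4⟩ := hne
  have hX1 : τ ≠ X := by rintro rfl; exact h3 rfl
  have hX2 : τ ≠ -X := by rintro rfl; exact h3 (by ring)
  have hY1 : τ ≠ Y := by rintro rfl; exact h4 rfl
  have hY2 : τ ≠ -Y := by rintro rfl; exact h4 (by ring)
  -- Apart from `± X` and `± Y`, each difference joins a single pair of vertices; two overlaps would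
  -- make two of these diagonals coincide.
  have key : ∀ w ∈ V, w - τ ∈ V → (w = v ∧ τ = -(X + Y)) ∨ (w = v + X + Y ∧ τ = X + Y) ∨
      (w = v + X ∧ τ = X - Y) ∨ (w = v + Y ∧ τ = Y - X) := by
    intro w hw hw'
    rw [hV] at hw hw'
    simp only [mem_insert, mem_singleton] at hw hw'
    rcases hw with rfl | rfl | rfl | rfl <;> rcases hw' with e | e | e | e
    · exact absurd (by linear_combination -e) hτ
    · exact absurd (by linear_combination -e) hX2
    · exact absurd (by linear_combination -e) hY2
    · left; exact ⟨rfl, by linear_combination -e⟩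
    · exact absurd (by linear_combination -e) hX1
    · exact absurd (by linear_combination -e) hτ
    · right; right; left; exact ⟨rfl, by linear_combination -e⟩
    · exact absurd (by linear_combination -e) hY2
    · exact absurd (by linear_combination -e) hY1
    · right; right; right; exact ⟨rfl, by linear_combination -e⟩
    · exact absurd (by linear_combination -e) hτ
    · exact absurd (by linear_combination -e) hX2
    · right; left; exact ⟨rfl, by linear_combination -e⟩
    · exact absurd (by linear_combination -e) hY1
    · exact absurd (by linear_combination -e) hX1
    · exact absurd (by linear_combination -e) hτ
  have hcard : 1 < #(V ∩ shift τ V) := by rw [card_core]; omega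
  obtain ⟨w, hw, w', hw', hww⟩ := one_lt_card.1 hcard
  rw [mem_inter, mem_shift] at hw hw'
  rcases key w hw.1 hw.2 with ⟨e1, f1⟩ | ⟨e1, f1⟩ | ⟨e1, f1⟩ | ⟨e1, f1⟩ <;>
  rcases key w' hw'.1 hw'.2 with ⟨e2, f2⟩ | ⟨e2, f2⟩ | ⟨e2, f2⟩ | ⟨e2, f2⟩
  · exact hww (e1.trans e2.symm)
  · exact hXY (h2 _ (by linear_combination f1 - f2))
  · exact hX (h2 _ (by linear_combination f1 - f2))
  · exact hY (h2 _ (by linear_combination f1 - f2))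
  · exact hXY (h2 _ (by linear_combination f2 - f1))
  · exact hww (e1.trans e2.symm)
  · exact hY (h2 _ (by linear_combination f2 - f1))
  · exact hX (h2 _ (by linear_combination f2 - f1))
  · exact hX (h2 _ (by linear_combination f2 - f1))
  · exact hY (h2 _ (by linear_combination f1 - f2))
  · exact hww (e1.trans e2.symm)
  · exact hXY' (sub_eq_zero.1 (h2 _ (by linear_combination f2 - f1)))
  · exact hY (h2 _ (by linear_combination f2 - f1))
  · exact hX (h2 _ (by linear_combination f1 - f2))
  · exact hXY' (sub_eq_zero.1 (h2 _ (by linear_combination f1 - f2)))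
  · exact hww (e1.trans e2.symm)

theorem bdry_core_le (A : Finset (ZMod p)) (τ : ZMod p) :
    bdry (A ∩ shift τ A) τ ≤ bdry A τ := by
  apply card_le_card
  intro x
  simp only [mem_filter, mem_inter, mem_shift, add_sub_cancel_right]
  tauto

theorem bdry_union_le (A B : Finset (ZMod p)) (τ : ZMod p) :
    bdry (A ∪ B) τ ≤ bdry A τ + bdry B τ := by
  refine (card_le_card ?_).trans (card_union_le _ _)
  intro x
  simp only [mem_filter, mem_union]
  tauto

/-- If the overlap of `A` with its translate by `2δ` is a `δ`-progression, so is `A`. -/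
theorem bdry_le_one_of_core {A : Finset (ZMod p)} {δ : ZMod p} (hp5 : 5 ≤ p) (hδ : δ ≠ 0)
    (h1 : bdry (A ∩ shift (2 * δ) A) δ ≤ 1) (h2 : bdry A (2 * δ) ≤ 2)
    (h3 : bdry A (2 * δ) + 2 ≤ #A) (h4 : #A + 1 < p) : bdry A δ ≤ 1 := by
  set W := shift (-(2 * δ)) (A ∩ shift (2 * δ) A) with hW
  have hmem : ∀ x, x ∈ W ↔ x ∈ A ∧ x + 2 * δ ∈ A := by
    intro x
    rw [hW, mem_shift, mem_inter, mem_shift]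
    rw [sub_neg_eq_add, add_sub_cancel_right]
    exact and_comm
  have hWδ : bdry W δ ≤ 1 := by rw [hW, bdry_shift]; exact h1
  have hWc : #W = #A - bdry A (2 * δ) := by rw [hW, card_shift, card_core]
  clear_value W
  have hW2 : 2 ≤ bdry W (2 * δ) := by
    by_contra hlt
    obtain ⟨m, hm, h⟩ := exists_small_multiple (k := 1) hδ hWδ (τ := 2 * δ) (by omega) (by omega)
      (by omega)
    have h1 : ((1 : ℕ) : ZMod p) ≠ 0 := natCast_ne_zero_of_lt (by omega) (by omega)
    have h2 : ((2 : ℕ) : ZMod p) ≠ 0 := natCast_ne_zero_of_lt (by omega) (by omega)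
    have h3 : ((3 : ℕ) : ZMod p) ≠ 0 := natCast_ne_zero_of_lt (by omega) (by omega)
    push_cast at h1 h2 h3
    obtain rfl | rfl : m = 0 ∨ m = 1 := by omega
    · have : 2 * δ = 0 := by simpa using h
      exact mul_ne_zero h2 hδ this
    · rcases h with h | h
      · exact hδ (by push_cast at h; linear_combination h)
      · exact mul_ne_zero h3 hδ (by push_cast at h; linear_combination h)
  -- `W` is a `δ`-progression and `2 * δ` is none of `0, ± δ`, so its translate adds at least two
  -- points, which is all that `A` has beyond `W`.
  have hA : W ∪ shift (2 * δ) W = A := by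
    apply eq_of_subset_of_card_le
    · intro x hx
      rw [mem_union, mem_shift, hmem, hmem] at hx
      rcases hx with h | h
      · exact h.1
      · simpa using h.2
    · rw [card_union_shift]; omega
  rw [bdry_le_one_iff] at hWδ ⊢
  have hexit : ∀ x ∈ A, x + δ ∉ A → x - 2 * δ ∈ W ∧ x - 2 * δ + δ ∉ W := by
    intro x hx hxδ
    rw [← hA, mem_union, mem_shift] at hx hxδ
    rw [not_or] at hxδ
    rcases hx with hx | hx
    · exfalso
      have h5 : x - δ ∉ W := by
        have := hxδ.2; rwa [show x + δ - 2 * δ = x - δ by ring] at this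
      obtain ⟨y, hy, hyx⟩ := exists_mem_notMem_of_card_lt_card (s := {x}) (t := W) (by
        rw [card_singleton]; omega)
      rw [mem_singleton] at hyx
      have := eq_univ_of_add_mem (A := {y | y ∈ W ∧ y ≠ x}) hδ ?_ ⟨hy, hyx⟩ x
      · exact this.2 rfl
      · rintro z ⟨hz, hzx⟩
        refine ⟨?_, ?_⟩
        · by_contra hc; exact hzx (hWδ z hz x hx hc hxδ.1)
        · rintro rfl; exact h5 (by simpa using hz)
    · refine ⟨hx, ?_⟩
      have := hxδ.2; rwa [show x + δ - 2 * δ = x - 2 * δ + δ by ring] at this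
  intro x hx y hy hxδ hyδ
  obtain ⟨e1, e2⟩ := hexit x hx hxδ
  obtain ⟨e3, e4⟩ := hexit y hy hyδ
  exact sub_left_injective (hWδ _ e1 _ e3 e2 e4)

theorem bdry_pair_le {x y : ZMod p} {A : Finset (ZMod p)} (hA : A = {x, y}) :
    bdry A (y - x) ≤ 1 := by
  rw [bdry_le_one_iff, hA]
  have : ∀ z ∈ ({x, y} : Finset (ZMod p)), z + (y - x) ∉ ({x, y} : Finset (ZMod p)) → z = y := by
    intro z hz h
    simp only [mem_insert, mem_singleton] at hz h
    rcases hz with rfl | rfl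
    · simp at h
    · rfl
  intro z hz w hw h1 h2
  rw [this z hz h1, this w hw h2]

/-- The number of directions with small boundary in a set of three or four points. -/
theorem card_small_bdry_le {A : Finset (ZMod p)} (h3 : 3 ≤ #A) (h4 : #A ≤ 4) (hlt : #A ≤ p) :
    #{τ ∈ univ.erase (0 : ZMod p) | bdry A τ ≤ 2} ≤ 6 := by
  set W : Finset (ZMod p) := {τ ∈ univ.erase (0 : ZMod p) | bdry A τ ≤ 2} with hW
  have h1 := sum_bdry_ne_zero A
  rw [← sum_filter_add_sum_filter_not _ (fun τ => bdry A τ ≤ 2)] at h1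
  have h2 := card_filter_add_card_filter_not (s := univ.erase (0 : ZMod p)) (fun τ => bdry A τ ≤ 2)
  rw [card_erase_of_mem (mem_univ _), card_univ, ZMod.card] at h2
  have h5 := sum_le_card_nsmul W (fun τ => bdry A τ) 2 fun τ hτ => (mem_filter.1 hτ).2
  have h6 := sum_le_card_nsmul {τ ∈ univ.erase (0 : ZMod p) | ¬ bdry A τ ≤ 2}
    (fun τ => bdry A τ) #A
    fun τ _ => bdry_le_card A τ
  rw [smul_eq_mul] at h5 h6
  rw [← hW] at h1 h2
  -- Bounding the other boundaries by `#A` in the boundary sum gives `(#A - 2) * #W ≤ #A * (#A -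
  -- 1)`, so `#W ≤ 6` for both sizes.
  obtain h | h : #A = 3 ∨ #A = 4 := by omega
  · rw [h] at h1 h6; omega
  · rw [h] at h1 h6; omega

/-- The multiplicative bookkeeping for two pairs. -/
theorem field_two_pairs {F : Type*} [Field F] {q q' r r' D E E' : F} (hqq : q * q' = 1)
    (hq2 : q ^ 2 ≠ 1) (hprod : q * r * r' = 1) (hq : q = E ∨ q = E') (hq' : q' = E ∨ q' = E')
    (hr : r = E ∨ r = E') (hr' : r' = E ∨ r' = E') (hD : D * q = E ∨ D * q = E')
    (hD' : D * q' = E ∨ D * q' = E') (h1 : D = 1 → E = 1 ∨ E' = 1) : False := by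
  have hq0 : q ≠ 0 := by rintro rfl; simp at hqq
  have hq1 : q ≠ 1 := by rintro rfl; simp at hq2
  have hqne : q ≠ q' := by rintro rfl; exact hq2 (by rw [sq, hqq])
  have hq'1 : q' ≠ 1 := by rintro rfl; exact hq1 (by simpa using hqq)
  -- As `q ≠ q'`, the set `{E, E'}` is `{q, q'}`. The product relation then gives `q ^ 3 = 1`, and
  -- multiplication by `D` can only be trivial.
  have key : ∀ x, (x = E ∨ x = E') → x = q ∨ x = q' := by
    intro x hx
    rcases hq with h | h <;> rcases hq' with h' | h'
    · exact absurd (h.trans h'.symm) hqne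
    · rw [h, h']; exact hx
    · rw [h, h']; exact hx.symm
    · exact absurd (h.trans h'.symm) hqne
  have hq3 : q ^ 3 = 1 := by
    rcases key r hr with e | e <;> rcases key r' hr' with f | f <;> rw [e, f] at hprod
    · linear_combination hprod
    · exact absurd (by linear_combination hprod - q * hqq) hq1
    · exact absurd (by linear_combination hprod - q * hqq) hq1
    · exact absurd (by linear_combination hprod - q' * hqq) hq'1
  have hD1 : D = 1 := by
    have hq'0 : q' ≠ 0 := by rintro rfl; simp at hqq
    rcases key _ hD with h | h
    · exact mul_right_cancel₀ hq0 (by rw [h, one_mul])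
    · rcases key _ hD' with h' | h'
      · exfalso
        have e : q' ^ 2 = q ^ 2 := by linear_combination q * h' - q' * h
        exact hq1 (by linear_combination (-q ^ 2) * e + (q * q' + 1) * hqq - q * hq3)
      · exact mul_right_cancel₀ hq'0 (by rw [h', one_mul])
  have h5 : (1 : F) = E ∨ (1 : F) = E' := (h1 hD1).imp Eq.symm Eq.symm
  rcases key 1 h5 with h | h
  · exact hq1 h.symm
  · exact hq'1 h.symm

end ThreeColours

/-! ### Three-colourings with a class of size two -/

section ThreeColours

variable {p : ℕ} [hp : Fact p.Prime] {a : Fin 3 → ZMod p} {b : ZMod p} {c : ZMod p → Fin 3}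

namespace TriColoring

variable (T : TriColoring a b c)

include T

/-- Otherwise goodness gives `2 ^ 4 = 1`, so `p ∣ 15`. -/
theorem exists_fourth_pow_ne (hp7 : 7 ≤ p) : ∃ s t, s ≠ t ∧ (a s / a t) ^ 4 ≠ 1 := by
  by_contra! h
  have h2 : ((2 : ℕ) : ZMod p) ≠ 0 := natCast_ne_zero_of_lt (by omega) (by omega)
  have := T.pow_eq_one (k := 2) h h2 (by norm_num)
  push_cast at this
  refine not_dvd_pow_sub_one (p := p) (k := 4) (m := 15) (by norm_num) ?_ this
  intro hd
  have : p ≤ 15 := Nat.le_of_dvd (by norm_num) hd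
  have := hp.out
  interval_cases p <;> revert hd <;> revert this <;> norm_num

/-- The sums `a s * x + a t * y` over the two pairs are four distinct values. They fill the
complement of an affine image of class `k`, which has exactly four elements. -/
theorem parallelogram {i j k : Fin 3} (hij : i ≠ j) (hik : i ≠ k)
    (hjk : j ≠ k) {x d y e : ZMod p} (hi : cls c i = {x, x + d}) (hj : cls c j = {y, y + e})
    (hi2 : #(cls c i) = 2) (hj2 : #(cls c j) = 2) (hp2 : p ≠ 2)
    {s t u : Fin 3} (hst : s ≠ t) (hsu : s ≠ u) (htu : t ≠ u)
    (hne : (a s * d) ^ 2 ≠ (a t * e) ^ 2) {τ : ZMod p} (hτ : τ ≠ 0) (h : bdry (cls c k) τ ≤ 2) :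
    (a u * τ) ^ 2 = (a s * d) ^ 2 ∨ (a u * τ) ^ 2 = (a t * e) ^ 2 := by
  have hsum := sum_cls (c := c) hij hik hjk
  set v := a s * x + a t * y with hv
  set V : Finset (ZMod p) := {v, v + a s * d, v + a t * e, v + a s * d + a t * e} with hV
  have hd : d ≠ 0 := by
    rintro rfl; rw [hi, add_zero, pair_eq_singleton, card_singleton] at hi2; omega
  have he : e ≠ 0 := by
    rintro rfl; rw [hj, add_zero, pair_eq_singleton, card_singleton] at hj2; omega
  have hX : a s * d ≠ 0 := mul_ne_zero (T.ne s) hd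
  have hY : a t * e ≠ 0 := mul_ne_zero (T.ne t) he
  have h1 : a s * d + a t * e ≠ 0 := fun h => hne (by linear_combination (a s * d - a t * e) * h)
  have h2 : a s * d ≠ a t * e := fun h => hne (by rw [h])
  have hVc : #V = 4 := by
    rw [hV, card_insert_of_notMem, card_insert_of_notMem, card_pair]
    · intro h; exact hX (by linear_combination -h)
    · simp only [mem_insert, mem_singleton, not_or]
      exact ⟨fun h => h2 (by linear_combination h), fun h => hY (by linear_combination -h)⟩
    · simp only [mem_insert, mem_singleton, not_or]
      exact ⟨fun h => hX (by linear_combination -h), fun h => hY (by linear_combination -h),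
        fun h => h1 (by linear_combination -h)⟩
  have hu := neg_ne_zero.2 (T.ne u)
  have hsub : V ⊆ shift b (dil (-a u) (cls c k))ᶜ := by
    have key : ∀ x' ∈ cls c i, ∀ y' ∈ cls c j,
        a s * x' + a t * y' ∈ shift b (dil (-a u) (cls c k))ᶜ := by
      intro x' hx y' hy
      rw [mem_shift, mem_compl]
      intro hc
      obtain ⟨z, hz, h⟩ := mem_image.1 hc
      exact T.cls_ne hij hik hjk hst hsu htu x' hx y' hy z hz (by linear_combination -h)
    have m1 : x ∈ cls c i := by simp [hi]
    have m2 : x + d ∈ cls c i := by simp [hi]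
    have m3 : y ∈ cls c j := by simp [hj]
    have m4 : y + e ∈ cls c j := by simp [hj]
    intro w hw
    rw [hV] at hw
    simp only [mem_insert, mem_singleton] at hw
    rcases hw with rfl | rfl | rfl | rfl
    · exact key _ m1 _ m3
    · convert key _ m2 _ m3 using 1; rw [hv]; ring
    · convert key _ m1 _ m4 using 1; rw [hv]; ring
    · convert key _ m2 _ m4 using 1; rw [hv]; ring
  have hVeq := eq_of_subset_of_card_le hsub (by
    rw [card_shift, card_compl_zmod, card_dil hu]; omega)
  refine sq_eq_of_parallelogram hV hVc hp2 (mul_ne_zero (T.ne u) hτ) ?_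
  rw [hVeq, bdry_shift, bdry_compl, bdry_dil' hu, inv_neg, neg_mul, inv_mul_cancel_left₀ (T.ne u),
    bdry_neg]
  exact h

/-- Every ratio times `d` or `e` is a direction of boundary at most 2 in class `k`. The
parallelogram allows only two squares of such directions, which is too few for the squared ratios
(`field_two_pairs`). -/
theorem not_two_two {i j k : Fin 3} (hij : i ≠ j) (hik : i ≠ k) (hjk : j ≠ k) (hp7 : 7 ≤ p)
    (hi2 : #(cls c i) = 2) (hj2 : #(cls c j) = 2) : False := by
  obtain ⟨x, x', hxx, hi⟩ := card_eq_two.1 hi2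
  obtain ⟨y, y', hyy, hj⟩ := card_eq_two.1 hj2
  obtain ⟨d, rfl⟩ : ∃ d, x' = x + d := ⟨x' - x, by ring⟩
  obtain ⟨e, rfl⟩ : ∃ e, y' = y + e := ⟨y' - y, by ring⟩
  have hd : d ≠ 0 := by rintro rfl; simp at hxx
  have he : e ≠ 0 := by rintro rfl; simp at hyy
  have hbi := bdry_pair_le hi
  have hbj := bdry_pair_le hj
  rw [add_sub_cancel_left] at hbi hbj
  obtain ⟨s₀, t₀, hst₀, h4⟩ := T.exists_fourth_pow_ne hp7
  obtain ⟨s, t, hst, hne⟩ : ∃ s t, s ≠ t ∧ (a s * d) ^ 2 ≠ (a t * e) ^ 2 := by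
    by_contra! hall
    have e1 := hall s₀ t₀ hst₀
    have e2 := hall t₀ s₀ hst₀.symm
    apply h4
    have hs := T.ne s₀
    have ht := T.ne t₀
    rw [div_pow, div_eq_one_iff_eq (pow_ne_zero _ ht)]
    have : d ^ 2 * (a s₀ ^ 4 - a t₀ ^ 4) = 0 := by
      linear_combination a s₀ ^ 2 * e1 - a t₀ ^ 2 * e2
    have := (mul_eq_zero.1 this).resolve_left (pow_ne_zero _ hd)
    exact sub_eq_zero.1 this
  obtain ⟨u, hsu, htu⟩ := fin3_third s t hst
  have key : ∀ τ, τ ≠ 0 → bdry (cls c k) τ ≤ 2 →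
      τ ^ 2 / d ^ 2 = (a s * d) ^ 2 / (a u ^ 2 * d ^ 2) ∨
      τ ^ 2 / d ^ 2 = (a t * e) ^ 2 / (a u ^ 2 * d ^ 2) := by
    intro τ hτ h
    have hu := T.ne u
    refine (T.parallelogram hij hik hjk hi hj hi2 hj2 (by omega) hst hsu htu hne hτ h).imp ?_ ?_
    · intro h; rw [← h]; field_simp
    · intro h; rw [← h]; field_simp
  have kd : ∀ v w, v ≠ w → ((a v / a w) ^ 2 = (a s * d) ^ 2 / (a u ^ 2 * d ^ 2) ∨
      (a v / a w) ^ 2 = (a t * e) ^ 2 / (a u ^ 2 * d ^ 2)) := by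
    intro v w hvw
    have e1 := T.bdry_le_add_one hik hvw (τ := d) (by omega)
    have := key _ (by simp [T.ne, hd]) (e1.trans (by omega))
    rwa [mul_pow, mul_div_cancel_right₀ _ (pow_ne_zero 2 hd)] at this
  have ke : ∀ v w, v ≠ w → (e ^ 2 / d ^ 2 * (a v / a w) ^ 2 = (a s * d) ^ 2 / (a u ^ 2 * d ^ 2) ∨
      e ^ 2 / d ^ 2 * (a v / a w) ^ 2 = (a t * e) ^ 2 / (a u ^ 2 * d ^ 2)) := by
    intro v w hvw
    have e1 := T.bdry_le_add_one hjk hvw (τ := e) (by omega)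
    have := key _ (by simp [T.ne, he]) (e1.trans (by omega))
    rwa [mul_pow, mul_comm, mul_div_right_comm] at this
  obtain ⟨u₀, hsu₀, htu₀⟩ := fin3_third s₀ t₀ hst₀
  have hs₀ := T.ne s₀
  have ht₀ := T.ne t₀
  have hu₀ := T.ne u₀
  refine field_two_pairs (q := (a s₀ / a t₀) ^ 2) (q' := (a t₀ / a s₀) ^ 2)
    (r := (a t₀ / a u₀) ^ 2) (r' := (a u₀ / a s₀) ^ 2) (by field_simp) ?_ (by field_simp)
    (kd _ _ hst₀) (kd _ _ hst₀.symm) (kd _ _ htu₀) (kd _ _ hsu₀.symm) (ke _ _ hst₀)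
    (ke _ _ hst₀.symm) ?_
  · rwa [← pow_mul]
  · intro hD
    have hed : e ^ 2 = d ^ 2 := by rwa [div_eq_one_iff_eq (pow_ne_zero 2 hd)] at hD
    have hjd : bdry (cls c j) d ≤ 1 := by
      rcases sq_eq_sq_iff_eq_or_eq_neg.1 hed with h | h
      · rwa [← h]
      · rwa [h, bdry_neg] at hbj
    have hkd : bdry (cls c k) d ≤ 2 := by
      have hk : cls c k = (cls c i ∪ cls c j)ᶜ := by
        ext z
        have := mem_univ (c z)
        rw [fin3_univ i j k hij hik hjk] at this
        simp only [mem_insert, mem_singleton] at this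
        simp only [mem_compl, mem_union, mem_cls]
        constructor
        · rintro h (h' | h')
          · exact hik (h'.symm.trans h)
          · exact hjk (h'.symm.trans h)
        · tauto
      rw [hk, bdry_compl]
      have := bdry_union_le (cls c i) (cls c j) d
      omega
    have := key d hd hkd
    rw [div_self (pow_ne_zero 2 hd)] at this
    exact this.imp Eq.symm Eq.symm

/-- Transfer of small boundaries between the two larger classes. -/
theorem bdry_le_two_of_pair {i j k : Fin 3} (hij : i ≠ j) (hik : i ≠ k) (hjk : j ≠ k) (hp5 : 5 ≤ p)
    {x d : ZMod p} (hi : cls c i = {x, x + d}) (hi2 : #(cls c i) = 2) (hj : 3 ≤ #(cls c j))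
    (hk : 5 ≤ #(cls c k)) (hkd : ∀ δ, δ ≠ 0 → 2 ≤ bdry (cls c k) δ)
    {s t : Fin 3} (hst : s ≠ t) {τ : ZMod p} (hτ : τ ≠ 0)
    (h : bdry (cls c k) τ ≤ 2) : bdry (cls c j) (a s / a t * τ) ≤ 2 := by
  have hsum := sum_cls (c := c) hij hik hjk
  have hd : d ≠ 0 := by
    rintro rfl; rw [hi, add_zero, pair_eq_singleton, card_singleton] at hi2; omega
  have hbi := bdry_pair_le hi
  rw [add_sub_cancel_left] at hbi
  obtain ⟨u, hsu, htu⟩ := fin3_third s t hst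
  set Y := cls c k ∩ shift τ (cls c k) with hY
  have hYc : #Y = #(cls c k) - bdry (cls c k) τ := card_core _ _
  have h1 := card_trio_le (T.ne t) (T.core_ne hjk.symm hik.symm hij.symm hst hsu htu τ)
  rw [card_union_shift, bdry_neg, ← hY] at h1
  have hs := T.ne s
  have ht := T.ne t
  have hu := T.ne u
  have h2 : #Y + bdry Y (a u / a s * d) ≤ #(dil (a u) (cls c i) + dil (a s) Y) := by
    have e1 : bdry Y (a u / a s * d) = bdry (dil (a s) Y) (a u * d) := by
      rw [bdry_dil' hs]; congr 1; ring
    rw [e1, ← card_dil hs Y, ← card_union_shift, ← card_shift (a u * x)]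
    apply card_le_card
    intro w hw
    rw [mem_shift, mem_union, mem_shift] at hw
    rcases hw with hw | hw
    · exact mem_add.2 ⟨a u * x, mul_mem_dil (by simp [hi]), _, hw, by ring⟩
    · exact mem_add.2 ⟨a u * (x + d), mul_mem_dil (by simp [hi]), _, hw, by ring⟩
  -- If the pair `i` enlarges `Y` by at least two, one is gained over Cauchy–Davenport and the
  -- boundary does not grow. Otherwise `Y` is a `δ`-progression and `τ = ± m * δ` with `m ≤ 2`: for
  -- `m = 1` the bound comes from the pair itself, and for `m = 2` class `k` would be a progression.
  rcases Nat.lt_or_ge (bdry Y (a u / a s * d)) 2 with hlt | hge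
  swap
  · omega
  set δ := a u / a s * d with hδ
  have hδ0 : δ ≠ 0 := by simp [hδ, hs, hu, hd]
  have hYτ : bdry Y τ ≤ 2 := (bdry_core_le _ _).trans h
  obtain ⟨m, hm, hmτ⟩ := exists_small_multiple (k := 2) hδ0 (by omega : bdry Y δ ≤ 1) hYτ
    (by omega) (by omega)
  obtain rfl | rfl | rfl : m = 0 ∨ m = 1 ∨ m = 2 := by omega
  · exact absurd (by simpa using hmτ) hτ
  · have e1 := T.bdry_le_add_one hij htu.symm (τ := d) (by omega)
    have e2 : a s / a t * δ = a u / a t * d := by rw [hδ]; field_simp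
    rcases hmτ with h' | h'
    · rw [h', Nat.cast_one, one_mul, e2]; omega
    · rw [h', Nat.cast_one, one_mul, mul_neg, bdry_neg, e2]; omega
  · exfalso
    rcases hmτ with h' | h'
    · have := bdry_le_one_of_core (A := cls c k) hp5 hδ0 (by
        push_cast at h'; rw [← h', ← hY]; omega) (by push_cast at h'; rw [← h']; exact h)
        (by push_cast at h'; rw [← h']; omega) (by omega)
      have := hkd δ hδ0
      omega
    · have h'' : τ = 2 * -δ := by push_cast at h'; linear_combination h'
      have := bdry_le_one_of_core (A := cls c k) hp5 (neg_ne_zero.2 hδ0) (by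
        rw [← h'', ← hY, bdry_neg]; omega) (by rw [← h'']; exact h)
        (by rw [← h'']; omega) (by omega)
      have := hkd (-δ) (neg_ne_zero.2 hδ0)
      omega

/-- At most six directions, hence three squares, have boundary at most 2. They include `1`, `q`,
`q⁻¹` and `q ^ 2` for a squared ratio `q` with `q ^ 2 ≠ 1`, so `q ^ 3 = 1`. All ratios are then
sixth roots of unity, and goodness gives `p ∣ 63`. -/
theorem not_two_small {j : Fin 3} (hp11 : 11 ≤ p) {d : ZMod p} (hd : d ≠ 0)
    (hj3 : 3 ≤ #(cls c j)) (hj4 : #(cls c j) ≤ 4)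
    (h : ∀ s t s' t', s ≠ t → s' ≠ t' → bdry (cls c j) (a s / a t * (a s' / a t' * d)) ≤ 2) :
    False := by
  set W : Finset (ZMod p) := {τ ∈ univ.erase (0 : ZMod p) | bdry (cls c j) τ ≤ 2} with hW
  have hW6 : #W ≤ 6 := card_small_bdry_le hj3 hj4 (by omega)
  set V := W.image fun τ => (τ / d) ^ 2 with hV
  have hV3 : #V ≤ 3 := by
    have h2 : ∀ v ∈ V, 2 ≤ #{τ ∈ W | (τ / d) ^ 2 = v} := by
      intro v hv
      obtain ⟨τ, hτ, rfl⟩ := mem_image.1 hv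
      have hτ' := hτ
      rw [hW, mem_filter, mem_erase] at hτ
      have hne : τ ≠ -τ := by
        intro h
        exact hτ.1.1 ((ZMod.add_self_eq_zero_iff_eq_zero (hp.out.odd_of_ne_two (by omega))).1
          (by linear_combination h))
      refine (card_pair hne).ge.trans (card_le_card ?_)
      intro w hw
      simp only [mem_insert, mem_singleton] at hw
      rcases hw with rfl | rfl
      · exact mem_filter.2 ⟨hτ', rfl⟩
      · refine mem_filter.2 ⟨?_, by ring⟩
        rw [hW, mem_filter, mem_erase, bdry_neg]
        exact ⟨⟨neg_ne_zero.2 hτ.1.1, mem_univ _⟩, hτ.2⟩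
    have h3 := card_nsmul_le_sum V _ 2 h2
    rw [← card_eq_sum_card_image, smul_eq_mul] at h3
    omega
  have hmem : ∀ s t s' t', s ≠ t → s' ≠ t' → (a s / a t * (a s' / a t')) ^ 2 ∈ V := by
    intro s t s' t' hst hst'
    refine mem_image.2 ⟨a s / a t * (a s' / a t' * d), ?_, by field_simp⟩
    rw [hW, mem_filter, mem_erase]
    exact ⟨⟨by simp [T.ne, hd], mem_univ _⟩, h s t s' t' hst hst'⟩
  obtain ⟨s, t, hst, h4⟩ := T.exists_fourth_pow_ne (by omega)
  have hs := T.ne s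
  have ht := T.ne t
  set q := (a s / a t) ^ 2 with hq
  have hq0 : q ≠ 0 := by simp [hq, hs, ht]
  have hq2 : q ^ 2 ≠ 1 := by rwa [hq, ← pow_mul]
  have hq1 : q ≠ 1 := fun h => hq2 (by rw [h, one_pow])
  have hratio : ∀ s t, s ≠ t → (a s / a t) ^ 2 ∈ V := by
    intro s t hst
    obtain ⟨u, hut, hsu, e⟩ := exists_ratio_mul T.ne hst
    rw [e]
    exact hmem u t s u hut hsu
  have m1 : 1 ∈ V := by
    have := hmem s t t s hst hst.symm
    rwa [show a s / a t * (a t / a s) = 1 by field_simp, one_pow] at this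
  have m2 : q ∈ V := hratio s t hst
  have m3 : q⁻¹ ∈ V := by
    have := hratio t s hst.symm
    rwa [← inv_div, inv_pow] at this
  have m4 : q ^ 2 ∈ V := by
    have := hmem s t s t hst hst
    rwa [← sq, ← pow_mul, mul_comm, pow_mul] at this
  have hqi : q ≠ q⁻¹ := fun h => hq2 (by
    rw [sq]; nth_rw 2 [h]; exact mul_inv_cancel₀ hq0)
  have hVeq : ({1, q, q⁻¹} : Finset (ZMod p)) = V := by
    apply eq_of_subset_of_card_le
    · intro x hx
      simp only [mem_insert, mem_singleton] at hx
      rcases hx with rfl | rfl | rfl <;> assumption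
    · rw [card_insert_of_notMem, card_pair hqi]
      · exact hV3
      · simp only [mem_insert, mem_singleton, not_or]
        exact ⟨hq1.symm, fun h => hq1 (by rw [eq_comm, inv_eq_one] at h; exact h)⟩
  have hq3 : q ^ 3 = 1 := by
    rw [← hVeq] at m4
    simp only [mem_insert, mem_singleton] at m4
    rcases m4 with h | h | h
    · exact absurd h hq2
    · exact absurd (mul_left_cancel₀ hq0 (by linear_combination h)) hq1
    · rw [pow_succ, h]; exact inv_mul_cancel₀ hq0
  have hall : ∀ s t, s ≠ t → (a s / a t) ^ (2 * 3) = 1 := by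
    intro s t hst
    have := hratio s t hst
    rw [← hVeq] at this
    simp only [mem_insert, mem_singleton] at this
    rw [pow_mul]
    rcases this with h | h | h <;> rw [h]
    · simp
    · exact hq3
    · rw [inv_pow, hq3, inv_one]
  have h2 : ((2 : ℕ) : ZMod p) ≠ 0 := natCast_ne_zero_of_lt (by omega) (by omega)
  have := T.pow_eq_one (k := 3) hall h2 (by norm_num)
  push_cast at this
  refine not_dvd_pow_sub_one (p := p) (k := 6) (m := 63) (by norm_num) ?_ this
  intro hdvd
  have h63 : p ∣ 3 * (3 * 7) := hdvd
  rw [hp.out.dvd_mul, hp.out.dvd_mul] at h63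
  rcases h63 with h | h | h <;> have := Nat.le_of_dvd (by norm_num) h <;> omega

/-- Boundary at most 2 passes between the two larger classes without loss. If class `j` has at least
five elements, goodness gives it in all directions for class `k`, against the boundary sum; smaller
`j` is `not_two_small`. -/
theorem not_two {i j k : Fin 3} (hij : i ≠ j) (hik : i ≠ k) (hjk : j ≠ k) (hp11 : 11 ≤ p)
    (hi2 : #(cls c i) = 2) (hj : 3 ≤ #(cls c j)) (hjk' : #(cls c j) ≤ #(cls c k)) : False := by
  have hsum := sum_cls (c := c) hij hik hjk
  obtain ⟨x, x', hxx, hi⟩ := card_eq_two.1 hi2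
  obtain ⟨d, rfl⟩ : ∃ d, x' = x + d := ⟨x' - x, by ring⟩
  have hd : d ≠ 0 := by rintro rfl; simp at hxx
  have hbi := bdry_pair_le hi
  rw [add_sub_cancel_left] at hbi
  have hkd := T.two_le_bdry hp11 hjk hj (by omega) (by omega)
  have hk : ∀ s t, s ≠ t → bdry (cls c k) (a s / a t * d) ≤ 2 := fun s t hst =>
    (T.bdry_le_add_one hik hst (τ := d) (by omega)).trans (by omega)
  have hkj : ∀ s t, s ≠ t → ∀ τ, τ ≠ 0 → bdry (cls c k) τ ≤ 2 →
      bdry (cls c j) (a s / a t * τ) ≤ 2 := fun s t hst τ hτ h =>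
    T.bdry_le_two_of_pair hij hik hjk (by omega) hi hi2 hj (by omega) hkd hst hτ h
  rcases Nat.lt_or_ge (#(cls c j)) 5 with hj5 | hj5
  · exact T.not_two_small hp11 hd hj (by omega) fun s t s' t' hst hst' =>
      hkj s t hst _ (by simp [T.ne, hd]) (hk s' t' hst')
  · have hjd := T.two_le_bdry hp11 hjk.symm (by omega) (by omega) (by omega)
    have hfin : ∀ τ, τ ≠ 0 → bdry (cls c k) τ ≤ 2 := by
      intro τ hτ
      refine T.forall_of_closed (P := fun τ => bdry (cls c k) τ ≤ 2)
        (fun τ h => by rwa [bdry_neg]) (τ₀ := a 0 / a 1 * d) (by simp [T.ne, hd])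
        (hk 0 1 (by decide)) ?_ hτ
      intro τ hτ h s t u hsu hut
      exact T.bdry_le_two_of_pair hik hij hjk.symm (by omega) hi hi2 (by omega) hj5 hjd hut
        (by simp [T.ne, hτ]) (hkj s u hsu τ hτ h)
    have h1 := sum_bdry_le hfin
    rw [show p - #(cls c k) = 2 + #(cls c j) by omega, show p - 1 = 1 + #(cls c j) + #(cls c k) by
      omega] at h1
    nlinarith

/-- There is no rainbow-free surjective three-colouring of the line for good coefficients. -/
theorem elim (hp5 : 5 ≤ p) : False := by
  have hex : ∀ n : Fin 3 → ℕ, ∃ i j k : Fin 3, i ≠ j ∧ i ≠ k ∧ j ≠ k ∧ n i ≤ n j ∧ n j ≤ n k := by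
    intro n
    rcases le_total (n 0) (n 1) with h1 | h1 <;> rcases le_total (n 0) (n 2) with h2 | h2 <;>
      rcases le_total (n 1) (n 2) with h3 | h3
    · exact ⟨0, 1, 2, by decide, by decide, by decide, h1, h3⟩
    · exact ⟨0, 2, 1, by decide, by decide, by decide, h2, h3⟩
    · exact ⟨2, 0, 1, by decide, by decide, by decide, h2, h1⟩
    · exact ⟨2, 0, 1, by decide, by decide, by decide, h2, h1⟩
    · exact ⟨1, 0, 2, by decide, by decide, by decide, h1, h2⟩
    · exact ⟨1, 0, 2, by decide, by decide, by decide, h1, h2⟩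
    · exact ⟨1, 2, 0, by decide, by decide, by decide, h3, h2⟩
    · exact ⟨2, 1, 0, by decide, by decide, by decide, h3, h1⟩
  obtain ⟨i, j, k, hij, hik, hjk, h1, h2⟩ := hex fun i => #(cls c i)
  have hsum := sum_cls (c := c) hij hik hjk
  have hi := T.cls_pos i
  have hp' := hp.out
  have h11 : 8 ≤ p → 11 ≤ p := by
    intro h
    by_contra hlt
    have : p = 8 ∨ p = 9 ∨ p = 10 := by omega
    rcases this with h | h | h <;> exact absurd (h ▸ hp') (by norm_num)
  have h7 : 6 ≤ p → 7 ≤ p := by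
    intro h
    by_contra hlt
    have : p = 6 := by omega
    exact absurd (this ▸ hp') (by norm_num)
  rcases Nat.lt_or_ge (#(cls c i)) 3 with hi3 | hi3
  · obtain h | h : #(cls c i) = 1 ∨ #(cls c i) = 2 := by omega
    · exact T.not_one hp5 h
    · rcases Nat.lt_or_ge (#(cls c j)) 3 with hj3 | hj3
      · exact T.not_two_two hij hik hjk (h7 (by omega)) h (by omega)
      · exact T.not_two hij hik hjk (h11 (by omega)) h hj3 h2
  · exact T.not_three_le hij hik hjk (h11 (by omega)) hi3 h1 h2

end TriColoring

end ThreeColours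

/-! ### Colourings cut into lines: the bound `M + 2` -/

section Fibred

/-- Rainbow-free colourings of a group for the homogeneous equation, in any coefficient order. -/
def RainbowFree {G κ : Type*} [AddCommGroup G] (a : Fin 3 → ℤ) (c : G → κ) : Prop :=
  ∀ s t u, s ≠ t → s ≠ u → t ≠ u → ∀ x y z : G, a s • x + a t • y + a u • z = 0 →
    c x = c y ∨ c x = c z ∨ c y = c z

variable {p : ℕ} [hp : Fact p.Prime]

/-- A family of lines over `Q` with no rainbow solution. -/
def Fibred {Q κ : Type*} [AddCommGroup Q] (a : Fin 3 → ℤ) (X : Q → ZMod p → κ) : Prop :=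
  ∀ s t u, s ≠ t → s ≠ u → t ≠ u → ∀ j k l : Q, a s • j + a t • k + a u • l = 0 →
    ∃ b : ZMod p, ∀ x y z : ZMod p, a s * x + a t * y + a u * z = b →
      X j x = X k y ∨ X j x = X l z ∨ X k y = X l z

theorem eq_of_periodic {κ : Type*} {f : ZMod p → κ} {d : ZMod p} (hd : d ≠ 0)
    (h : ∀ x, f (x + d) = f x) (x y : ZMod p) : f x = f y :=
  eq_univ_of_add_mem (A := {z | f z = f y}) hd (fun z hz => (h z).trans hz) (x := y) rfl x

theorem exists_line_point {a : Fin 3 → ℤ} (ha : ∀ s, (a s : ZMod p) ≠ 0) (s t u : Fin 3)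
    (b x y : ZMod p) :
    (a s : ZMod p) * x + a t * y + a u * ((b - a s * x - a t * y) / a u) = b := by
  field_simp [ha u]
  ring

variable {Q κ : Type} [AddCommGroup Q] [Fintype Q] [DecidableEq κ]

/-- The colours of a line. -/
def pal (X : Q → ZMod p → κ) (j : Q) : Finset κ := univ.image (X j)

/-- All colours. -/
def allPal (X : Q → ZMod p → κ) : Finset κ := univ.image fun i : Q × ZMod p => X i.1 i.2

omit [AddCommGroup Q] [Fintype Q] in
theorem mem_pal {X : Q → ZMod p → κ} {j : Q} {q : κ} : q ∈ pal X j ↔ ∃ x, X j x = q := by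
  simp [pal]

omit [AddCommGroup Q] in
theorem mem_allPal {X : Q → ZMod p → κ} {q : κ} : q ∈ allPal X ↔ ∃ j, q ∈ pal X j := by
  simp [pal, allPal]

omit [AddCommGroup Q] [Fintype Q] in
theorem apply_mem_pal (X : Q → ZMod p → κ) (j : Q) (x : ZMod p) : X j x ∈ pal X j :=
  mem_pal.2 ⟨x, rfl⟩

omit [AddCommGroup Q] [Fintype Q] in
theorem pal_eq_of_mono {X : Q → ZMod p → κ} {j : Q} (h : #(pal X j) ≤ 1) (x y : ZMod p) :
    X j x = X j y :=
  card_le_one.1 h _ (apply_mem_pal X j x) _ (apply_mem_pal X j y)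

/-- The data of the reduction from `G` to `Q`. -/
structure FibredData (a : Fin 3 → ℤ) (X : Q → ZMod p → κ) (M : ℕ) : Prop where
  ne : ∀ s, (a s : ZMod p) ≠ 0
  surj : ∀ s, Function.Surjective fun x : Q => a s • x
  free : Fibred a X
  -- All colour types are needed: the bound is applied to recolourings with values in `Option κ` and
  -- `κ ⊕ Bool`.
  bound : ∀ (κ' : Type) [DecidableEq κ'] (c : Q → κ'), RainbowFree a c → #(univ.image c) ≤ M

variable {a : Fin 3 → ℤ} {X : Q → ZMod p → κ} {M : ℕ}

namespace FibredData

variable (D : FibredData a X M)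

include D

omit [DecidableEq κ] in
theorem exists_third (s t u : Fin 3) (j k : Q) : ∃ l, a s • j + a t • k + a u • l = 0 := by
  obtain ⟨l, hl⟩ := D.surj u (-(a s • j + a t • k))
  dsimp only at hl
  exact ⟨l, by rw [hl]; abel⟩

/-- A line with two colours missing from a nonconstant line does not exist. -/
theorem eq_of_notMem {j k : Q} (hj : 1 < #(pal X j)) {q q' : κ} (hq : q ∈ pal X k)
    (hq' : q' ∈ pal X k) (hqj : q ∉ pal X j) (hqj' : q' ∉ pal X j) : q = q' := by
  by_contra hne
  obtain ⟨y, rfl⟩ := mem_pal.1 hq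
  obtain ⟨y', rfl⟩ := mem_pal.1 hq'
  obtain ⟨l, hl⟩ := D.exists_third 0 1 2 j k
  obtain ⟨b, hb⟩ := D.free 0 1 2 (by decide) (by decide) (by decide) j k l hl
  have h0 := D.ne 0
  have h1 := D.ne 1
  have h2 := D.ne 2
  -- Replacing `y` by `y'` and `x` by `x + d` keeps the third point. Its colour lies in `{X j x, q}`
  -- and in `{X j (x + d), q'}`, so line `j` has period `d`.
  set d : ZMod p := a 1 * (y - y') / a 0 with hd
  have hd0 : d ≠ 0 := by
    simp only [hd, ne_eq, div_eq_zero_iff, mul_eq_zero, h0, h1, false_or, or_false, sub_eq_zero]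
    rintro rfl; exact hne rfl
  have hper : ∀ x, X j (x + d) = X j x := by
    intro x
    have e1 := hb x y ((b - a 0 * x - a 1 * y) / a 2) (exists_line_point D.ne 0 1 2 b x y)
    have e2 := hb (x + d) y' ((b - a 0 * x - a 1 * y) / a 2) (by
      have : (a 0 : ZMod p) * d = a 1 * (y - y') := by rw [hd]; field_simp
      linear_combination this + exists_line_point D.ne 0 1 2 b x y)
    have f1 : X j x ≠ X k y := fun h => hqj (h ▸ apply_mem_pal X j x)
    have f2 : X j (x + d) ≠ X k y' := fun h => hqj' (h ▸ apply_mem_pal X j (x + d))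
    have f3 : X j x ≠ X k y' := fun h => hqj' (h ▸ apply_mem_pal X j x)
    have f4 : X j (x + d) ≠ X k y := fun h => hqj (h ▸ apply_mem_pal X j (x + d))
    rcases e1 with e1 | e1 | e1
    · exact absurd e1 f1
    · rcases e2 with e2 | e2 | e2
      · exact absurd e2 f2
      · rw [e1, e2]
      · exact absurd (e1.trans e2.symm) f3
    · rcases e2 with e2 | e2 | e2
      · exact absurd e2 f2
      · exact absurd (e2.trans e1.symm) f4
      · exact absurd (e1.trans e2.symm) hne
  obtain ⟨c, hc, c', hc', hcc⟩ := one_lt_card.1 hj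
  obtain ⟨x, rfl⟩ := mem_pal.1 hc
  obtain ⟨x', rfl⟩ := mem_pal.1 hc'
  exact hcc (eq_of_periodic hd0 hper x x')

/-- Label each line by its unique colour missing from line `j`, or `none`. The labelling is
rainbow-free on `Q` and uses `none` as well as every colour outside `pal X j`. -/
theorem card_le_of_nonconstant {j : Q} (hj : 1 < #(pal X j)) :
    #(allPal X) + 1 ≤ #(pal X j) + M := by
  classical
  set c : Q → Option κ := fun k => if h : (pal X k \ pal X j).Nonempty then some h.choose else none
    with hc
  have hsome : ∀ k q, c k = some q ↔ q ∈ pal X k ∧ q ∉ pal X j := by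
    intro k q
    rw [hc]
    dsimp only
    split_ifs with h
    · have hch := mem_sdiff.1 h.choose_spec
      rw [Option.some_inj]
      constructor
      · rintro rfl; exact hch
      · rintro ⟨h1, h2⟩; exact D.eq_of_notMem hj hch.1 h1 hch.2 h2
    · simp only [false_iff]
      rintro ⟨h1, h2⟩
      exact h ⟨q, mem_sdiff.2 ⟨h1, h2⟩⟩
  have key : ∀ s t u, s ≠ t → s ≠ u → t ≠ u → ∀ x y z : Q, a s • x + a t • y + a u • z = 0 →
      ∀ q q', c x = some q → c y = some q' → q ≠ q' → c x = c z ∨ c y = c z := by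
    intro s t u hst hsu htu x y z hxyz q q' hx hy hqq
    obtain ⟨b, hb⟩ := D.free s t u hst hsu htu x y z hxyz
    have hx' := (hsome x q).1 hx
    have hy' := (hsome y q').1 hy
    obtain ⟨v, hv⟩ := mem_pal.1 hx'.1
    obtain ⟨w, hw⟩ := mem_pal.1 hy'.1
    have := hb v w _ (exists_line_point D.ne s t u b v w)
    rw [hv, hw] at this
    rcases this with h | h | h
    · exact absurd h hqq
    · left; rw [hx, eq_comm, hsome]; exact ⟨h ▸ apply_mem_pal X z _, hx'.2⟩
    · right; rw [hy, eq_comm, hsome]; exact ⟨h ▸ apply_mem_pal X z _, hy'.2⟩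
  have hfree : RainbowFree a c := by
    intro s t u hst hsu htu x y z hxyz
    rcases hx : c x with _ | q <;> rcases hy : c y with _ | q' <;> rcases hz : c z with _ | q''
    · simp
    · simp
    · simp
    · by_cases h : q' = q''
      · simp [h]
      · have := key t u s htu hst.symm hsu.symm y z x (by rw [← hxyz]; abel) q' q'' hy hz h
        rw [hx, hy, hz] at this; simp at this
    · simp
    · by_cases h : q = q''
      · simp [h]
      · have := key s u t hsu hst htu.symm x z y (by rw [← hxyz]; abel) q q'' hx hz h
        rw [hx, hy, hz] at this; simp at this
    · by_cases h : q = q'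
      · simp [h]
      · have := key s t u hst hsu htu x y z hxyz q q' hx hy h
        rw [hx, hy, hz] at this; simp at this
    · by_cases h : q = q'
      · simp [h]
      · have := key s t u hst hsu htu x y z hxyz q q' hx hy h
        rw [hx, hy, hz] at this; exact Or.inr this
  have hM := D.bound _ c hfree
  have hsub : insert none ((allPal X \ pal X j).image some) ⊆ univ.image c := by
    intro o ho
    rw [mem_insert, mem_image] at ho
    rcases ho with rfl | ⟨q, hq, rfl⟩
    · refine mem_image.2 ⟨j, mem_univ _, ?_⟩
      rw [Option.eq_none_iff_forall_ne_some]
      intro q h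
      have := (hsome j q).1 h
      exact this.2 this.1
    · rw [mem_sdiff, mem_allPal] at hq
      obtain ⟨⟨k, hk⟩, hqj⟩ := hq
      exact mem_image.2 ⟨k, mem_univ _, (hsome k q).2 ⟨hk, hqj⟩⟩
  have h1 := card_le_card hsub
  rw [card_insert_of_notMem (by simp), card_image_of_injective _ (Option.some_injective κ)] at h1
  have h2 := le_card_sdiff (pal X j) (allPal X)
  omega

theorem card_le_of_constant (h : ∀ j, #(pal X j) ≤ 1) : #(allPal X) ≤ M := by
  have hfree : RainbowFree a fun j => X j 0 := by
    intro s t u hst hsu htu x y z hxyz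
    obtain ⟨b, hb⟩ := D.free s t u hst hsu htu x y z hxyz
    have := hb 0 0 _ (exists_line_point D.ne s t u b 0 0)
    rwa [pal_eq_of_mono (h z) _ 0] at this
  refine le_trans (card_le_card ?_) (D.bound _ _ hfree)
  intro q hq
  obtain ⟨j, hj⟩ := mem_allPal.1 hq
  obtain ⟨x, rfl⟩ := mem_pal.1 hj
  exact mem_image.2 ⟨j, mem_univ _, pal_eq_of_mono (h j) _ _⟩

omit [DecidableEq κ] in
/-- The third line seen from a pair of points on two lines. -/
theorem exists_compat {s t u : Fin 3} (hst : s ≠ t) (hsu : s ≠ u) (htu : t ≠ u) (j : Q) :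
    ∃ l : Q, ∃ b : ZMod p, a s • j + a t • j + a u • l = 0 ∧
      Compat (fun s => (a s : ZMod p)) s t (X j) fun v => X l ((b - v) / a u) := by
  obtain ⟨l, hl⟩ := D.exists_third s t u j j
  obtain ⟨b, hb⟩ := D.free s t u hst hsu htu j j l hl
  refine ⟨l, b, hl, fun x y => ?_⟩
  have := hb x y _ (exists_line_point D.ne s t u b x y)
  rw [sub_sub] at this
  exact this.imp_right (Or.imp Eq.symm Eq.symm)

/-- For `a s * x + a t * y' = a s * x' + a t * y` the third point is the same, and its colour would
lie in two disjoint pairs. So four colours, the others being merged into one of them, satisfy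
`FourFree`. -/
theorem card_pal_le_three (j : Q) : #(pal X j) ≤ 3 := by
  by_contra! h4
  have hp3 : p ≠ 3 := by
    rintro rfl
    have : #(pal X j) ≤ #(univ : Finset (ZMod 3)) := card_image_le
    rw [card_univ, ZMod.card] at this
    omega
  obtain ⟨P, hP, hPc⟩ := exists_subset_card_eq (show 4 ≤ #(pal X j) by omega)
  let e := (Fintype.equivFinOfCardEq (α := P) (n := 4) (by simpa using hPc))
  classical
  set g : κ → Fin 4 := fun q => if h : q ∈ P then e ⟨q, h⟩ else 0 with hg
  refine not_fourFree (a := fun s => (a s : ZMod p)) D.ne (X := fun x => g (X j x)) ?_ ?_ hp3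
  · intro i
    obtain ⟨x, hx⟩ := mem_pal.1 (hP (e.symm i).2)
    refine ⟨x, ?_⟩
    simp only [hg, hx]
    rw [dif_pos (e.symm i).2]
    simp
  · intro s t hst x x' y y' h1 h2 h3 h4 h5 h6 heq
    dsimp only at h1 h2 h3 h4 h5 h6
    obtain ⟨u, hsu, htu⟩ := fin3_third s t hst
    obtain ⟨l, b, -, hC⟩ := D.exists_compat hst hsu htu j
    have e1 := hC x y'
    have e2 := hC x' y
    dsimp only at e1 e2 heq
    rw [show (a s : ZMod p) * x + a t * y' = a s * x' + a t * y by linear_combination heq] at e1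
    have g1 : X j x ≠ X j x' := fun h => h1 (by rw [h])
    have g2 : X j x ≠ X j y := fun h => h2 (by rw [h])
    have g3 : X j x ≠ X j y' := fun h => h3 (by rw [h])
    have g4 : X j x' ≠ X j y := fun h => h4 (by rw [h])
    have g5 : X j x' ≠ X j y' := fun h => h5 (by rw [h])
    have g6 : X j y ≠ X j y' := fun h => h6 (by rw [h])
    rcases e1 with e1 | e1 | e1
    · exact g3 e1
    · rw [e1] at e2
      tauto
    · rw [e1] at e2
      rcases e2 with e2 | e2 | e2
      · exact g4 e2
      · exact g5 e2.symm
      · exact g6 e2.symm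

theorem card_le_add_two : #(allPal X) ≤ M + 2 := by
  by_cases h : ∀ j, #(pal X j) ≤ 1
  · have := D.card_le_of_constant h; omega
  · push Not at h
    obtain ⟨j, hj⟩ := h
    have := D.card_le_of_nonconstant hj
    have := D.card_pal_le_three j
    omega

end FibredData

end Fibred

/-! ### Good coefficients: the bound `M + 1` -/

section FibredGood

theorem zmod3_neg : ∀ x y : ZMod 3, x ≠ 0 → y ≠ 0 → x ≠ y → y = -x := by decide

theorem zmod3_facts : (3 : ZMod 3) = 0 ∧ (1 : ZMod 3) ≠ 0 ∧ (2 : ZMod 3) ≠ 1 ∧ (0 : ZMod 3) ≠ 2 := by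
  decide

variable {p : ℕ} [hp : Fact p.Prime]

variable {Q κ : Type} [AddCommGroup Q] [Fintype Q] [DecidableEq κ]

variable {a : Fin 3 → ℤ} {X : Q → ZMod p → κ} {M : ℕ}

omit [AddCommGroup Q] [Fintype Q] in
/-- A point of a line avoiding two colours. -/
theorem exists_notMem_pair {j : Q} (hj : #(pal X j) = 3) (q q' : κ) :
    ∃ x, X j x ≠ q ∧ X j x ≠ q' := by
  obtain ⟨c, hc, hc'⟩ := exists_mem_notMem_of_card_lt_card (s := {q, q'}) (t := pal X j)
    (by have := card_le_two (a := q) (b := q'); omega)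
  obtain ⟨x, rfl⟩ := mem_pal.1 hc
  simp only [mem_insert, mem_singleton, not_or] at hc'
  exact ⟨x, hc'⟩

namespace FibredData

variable (D : FibredData a X M)

include D

/-- The third line of two nonconstant lines is nonconstant. -/
theorem third_nonconstant (h3 : ∀ j, 1 < #(pal X j) → #(pal X j) = 3) {s t u : Fin 3} (hst : s ≠ t)
    (hsu : s ≠ u) (htu : t ≠ u) {j k l : Q} (h : a s • j + a t • k + a u • l = 0)
    (hj : 1 < #(pal X j)) (hk : 1 < #(pal X k)) : 1 < #(pal X l) := by
  by_contra! hl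
  obtain ⟨b, hb⟩ := D.free s t u hst hsu htu j k l h
  obtain ⟨x, hx, -⟩ := exists_notMem_pair (h3 j hj) (X l 0) (X l 0)
  obtain ⟨y, hy, hy'⟩ := exists_notMem_pair (h3 k hk) (X l 0) (X j x)
  have := hb x y _ (exists_line_point D.ne s t u b x y)
  rw [pal_eq_of_mono hl _ 0] at this
  tauto

/-- The third line of a nonconstant and a constant line is constant, of the same colour. -/
theorem third_constant (h3 : ∀ j, 1 < #(pal X j) → #(pal X j) = 3) {s t u : Fin 3} (hst : s ≠ t)
    (hsu : s ≠ u) (htu : t ≠ u) {j k l : Q} (h : a s • j + a t • k + a u • l = 0)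
    (hj : 1 < #(pal X j)) (hk : #(pal X k) ≤ 1) : #(pal X l) ≤ 1 ∧ X k 0 = X l 0 := by
  have hl : #(pal X l) ≤ 1 := by
    by_contra! hl
    have := D.third_nonconstant h3 hsu hst htu.symm (j := j) (k := l) (l := k)
      (by rw [← h]; abel) hj hl
    omega
  refine ⟨hl, ?_⟩
  obtain ⟨b, hb⟩ := D.free s t u hst hsu htu j k l h
  obtain ⟨x, hx, hx'⟩ := exists_notMem_pair (h3 j hj) (X k 0) (X l 0)
  have := hb x 0 _ (exists_line_point D.ne s t u b x 0)
  rw [pal_eq_of_mono hl _ 0] at this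
  tauto

omit [AddCommGroup Q] [Fintype Q] D in
theorem sum_card_cls_pal (j : Q) {R : Finset κ} (hR : pal X j ⊆ R) :
    ∑ q ∈ R, #(cls (X j) q) = p := by
  have := Finset.card_eq_sum_card_fiberwise (s := (univ : Finset (ZMod p))) (t := R) (f := X j)
    (fun x _ => by simpa using hR (apply_mem_pal X j x))
  rw [card_univ, ZMod.card] at this
  exact this.symm

/-- Counting the occurrences of a colour missing from one of three lines. -/
theorem card_cls_rare (h3 : ∀ j, 1 < #(pal X j) → #(pal X j) = 3) {s t u : Fin 3} (hst : s ≠ t)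
    (hsu : s ≠ u) (htu : t ≠ u) {j k l : Q} (h : a s • j + a t • k + a u • l = 0)
    (hj : 1 < #(pal X j)) (hl : 1 < #(pal X l)) {r : κ} (hr : r ∉ pal X j)
    (hk : 1 ≤ #(cls (X k) r)) :
    (r ∉ pal X l → #(cls (X k) r) ≤ 1) ∧
      (r ∈ pal X l → 2 * #(cls (X k) r) ≤ #(cls (X l) r) + 1) := by
  obtain ⟨b, hb⟩ := D.free s t u hst hsu htu j k l h
  -- A point of colour `r` on line `k` and one of colour `q` on line `l` force colour `q` on line
  -- `j`, where `r` is absent. Cauchy–Davenport bounds the size, and summing over `q` gives both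
  -- claims.
  have key : ∀ q ∈ (pal X l).erase r,
      #(cls (X l) q) + (#(cls (X k) r) - 1) ≤ #(cls (X j) q) := by
    intro q hq
    rw [mem_erase] at hq
    obtain ⟨hqr, hq⟩ := hq
    obtain ⟨z, hz⟩ := mem_pal.1 hq
    have hsub : shift b (dil (-(a t : ZMod p)) (cls (X k) r) + dil (-(a u : ZMod p)) (cls (X l) q)) ⊆
        dil (a s) (cls (X j) q) := by
      intro w hw
      rw [mem_shift] at hw
      obtain ⟨_, hy, _, hz, hyz⟩ := mem_add.1 hw
      obtain ⟨y, hyr, rfl⟩ := mem_image.1 hy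
      obtain ⟨z, hzq, rfl⟩ := mem_image.1 hz
      rw [mem_cls] at hyr hzq
      rw [mem_dil (D.ne s), mem_cls]
      have := hb ((a s : ZMod p)⁻¹ * w) y z (by
        rw [mul_inv_cancel_left₀ (D.ne s)]; linear_combination -hyz)
      rw [hyr, hzq] at this
      rcases this with h | h | h
      · exact absurd (h ▸ apply_mem_pal X j _) hr
      · exact h
      · exact absurd h.symm hqr
    have h1 := card_le_card hsub
    rw [card_shift, card_dil (D.ne s)] at h1
    have hlt : #(cls (X j) q) < p := by
      by_contra hge
      have hun : cls (X j) q = univ := by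
        rw [← card_eq_iff_eq_univ, ZMod.card]
        exact le_antisymm (card_le_prime _) (by omega)
      obtain ⟨x, hx, -⟩ := exists_notMem_pair (h3 j hj) q q
      exact hx (mem_cls.1 (hun ▸ mem_univ x))
    have h2 := card_add_ge (A := dil (-(a t : ZMod p)) (cls (X k) r)) (B := dil (-(a u : ZMod p)) (cls (X l) q))
      ((card_pos.1 hk).image _) (⟨_, mul_mem_dil (mem_cls.2 hz)⟩) (by omega)
    rw [card_dil (neg_ne_zero.2 (D.ne t)), card_dil (neg_ne_zero.2 (D.ne u))] at h2
    omega
  have hsum := sum_le_sum key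
  rw [sum_add_distrib, sum_const, smul_eq_mul] at hsum
  have hW := sum_card_cls_pal (X := X) l (subset_refl _)
  have hXle : ∑ q ∈ (pal X l).erase r, #(cls (X j) q) + #(pal X j \ (pal X l).erase r) ≤ p := by
    refine le_trans ?_
      (sum_card_cls_pal (X := X) j (R := (pal X l).erase r ∪ pal X j) subset_union_right).le
    rw [← union_sdiff_self_eq_union, sum_union disjoint_sdiff, card_eq_sum_ones]
    gcongr with q hq
    obtain ⟨x, hx⟩ := mem_pal.1 (mem_sdiff.1 hq).1
    exact card_pos.2 ⟨x, mem_cls.2 hx⟩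
  have hj3 := h3 j hj
  have hl3 := h3 l hl
  constructor
  · intro hrl
    rw [erase_eq_of_notMem hrl] at hsum hXle
    rw [hl3, hW] at hsum
    omega
  · intro hrl
    rw [card_erase_of_mem hrl, hl3] at hsum
    rw [← add_sum_erase _ _ hrl] at hW
    have h4 := le_card_sdiff ((pal X l).erase r) (pal X j)
    rw [card_erase_of_mem hrl, hl3, hj3] at h4
    omega

/-- If `r` occurs on the third line, `card_cls_rare` applies with `k` and `l` interchanged as well;
the inequalities `2u ≤ v + 1` and `2v ≤ u + 1` give `u ≤ 1`. -/
theorem card_cls_le_one (h3 : ∀ j, 1 < #(pal X j) → #(pal X j) = 3) {j k : Q}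
    (hj : 1 < #(pal X j)) (hk : 1 < #(pal X k)) {r : κ} (hr : r ∉ pal X j) :
    #(cls (X k) r) ≤ 1 := by
  by_contra! hgt
  obtain ⟨l, hl⟩ := D.exists_third 0 1 2 j k
  have hl1 := D.third_nonconstant h3 (by decide) (by decide) (by decide) hl hj hk
  obtain ⟨e1, e2⟩ := D.card_cls_rare h3 (by decide) (by decide) (by decide) hl hj hl1 hr
    (by omega)
  by_cases hrl : r ∈ pal X l
  · obtain ⟨z, hz⟩ := mem_pal.1 hrl
    have hz1 : 1 ≤ #(cls (X l) r) := card_pos.2 ⟨z, mem_cls.2 hz⟩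
    have hl' : a 0 • j + a 2 • l + a 1 • k = 0 := by rw [← hl]; abel
    obtain ⟨f1, f2⟩ := D.card_cls_rare h3 (by decide) (by decide) (by decide) hl' hj hk hr hz1
    obtain ⟨y, hy⟩ := card_pos.1 (by omega : 0 < #(cls (X k) r))
    have := e2 hrl
    have := f2 (mem_pal.2 ⟨y, mem_cls.1 hy⟩)
    omega
  · have := e1 hrl; omega

/-- All nonconstant lines have the same colours. -/
theorem pal_subset (hp5 : 5 ≤ p) (hg : Good fun s => (a s : ZMod p))
    (h3 : ∀ j, 1 < #(pal X j) → #(pal X j) = 3) {j k : Q}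
    (hj : 1 < #(pal X j)) (hk : 1 < #(pal X k)) : pal X j ⊆ pal X k := by
  intro r hr
  by_contra hrk
  obtain ⟨x₀, hx₀⟩ := mem_pal.1 hr
  have hone := D.card_cls_le_one h3 hk hj hrk
  have hj3 := h3 j hj
  obtain ⟨c₁, c₂, h12, hpair⟩ := card_eq_two.1 (show #((pal X j).erase r) = 2 by
    rw [card_erase_of_mem hr, hj3])
  have hc1 : c₁ ∈ (pal X j).erase r := by simp [hpair]
  have hc2 : c₂ ∈ (pal X j).erase r := by simp [hpair]
  rw [mem_erase] at hc1 hc2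
  have hX0 : ∀ x, x ≠ 0 → X j (x₀ + x) ≠ r := by
    intro x hx h
    have := card_le_one.1 hone (x₀ + x) (mem_cls.2 h) x₀ (mem_cls.2 hx₀)
    exact hx (by simpa using this)
  -- The colour `r` occurs once on line `j` and at most once on each third line of `j` with itself,
  -- which has three colours and so a point avoiding `c₁` and `c₂`.
  refine not_singles (a := fun s => (a s : ZMod p)) D.ne hg hp5 (X := fun x => X j (x₀ + x)) h12
    ?_ ?_ ?_ ?_ ?_
  · intro x hx
    have : X j (x₀ + x) ∈ (pal X j).erase r := mem_erase.2 ⟨hX0 x hx, apply_mem_pal X j _⟩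
    rw [hpair] at this
    simpa using this
  · intro x hx
    simpa [hx₀] using hX0 x hx
  · obtain ⟨x, hx⟩ := mem_pal.1 hc1.2
    refine ⟨x - x₀, fun h => hc1.1 ?_, by simpa using hx⟩
    rw [← hx, sub_eq_zero.1 h, hx₀]
  · obtain ⟨x, hx⟩ := mem_pal.1 hc2.2
    refine ⟨x - x₀, fun h => hc2.1 ?_, by simpa using hx⟩
    rw [← hx, sub_eq_zero.1 h, hx₀]
  · intro s t hst
    obtain ⟨u, hsu, htu⟩ := fin3_third s t hst
    obtain ⟨l, b, hl, hC⟩ := D.exists_compat hst hsu htu j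
    have hl1 := D.third_nonconstant h3 hst hsu htu hl hj hj
    have hlone := D.card_cls_le_one h3 hk hl1 hrk
    have hu := D.ne u
    refine ⟨fun v => X l ((b - (v + (a s + a t) * x₀)) / a u), ?_, ?_, ?_⟩
    · intro x y
      have := hC (x₀ + x) (x₀ + y)
      dsimp only at this ⊢
      rwa [show (a s : ZMod p) * (x₀ + x) + a t * (x₀ + y) =
        a s * x + a t * y + (a s + a t) * x₀ by ring] at this
    · intro v v' h1 h2
      simp only [add_zero, hx₀] at h1 h2
      have := card_le_one.1 hlone _ (mem_cls.2 h1) _ (mem_cls.2 h2)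
      rw [div_left_inj' hu] at this
      linear_combination -this
    · obtain ⟨z, hz⟩ := exists_notMem_pair (h3 l hl1) c₁ c₂
      refine ⟨b - a u * z - (a s + a t) * x₀, ?_⟩
      dsimp only
      rwa [show (b - (b - a u * z - (a s + a t) * x₀ + (a s + a t) * x₀)) / (a u : ZMod p) = z by
        field_simp; ring]

theorem card_pal_ne_three_of_self (hp5 : 5 ≤ p) (hg : Good fun s => (a s : ZMod p)) {j : Q}
    (h : a 0 • j + a 1 • j + a 2 • j = 0) : #(pal X j) ≠ 3 := by
  intro h3
  classical
  obtain ⟨b, hb⟩ := D.free 0 1 2 (by decide) (by decide) (by decide) j j j h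
  let e := (Fintype.equivFinOfCardEq (α := pal X j) (n := 3) (by simpa using h3))
  let c : ZMod p → Fin 3 := fun x => e ⟨X j x, apply_mem_pal X j x⟩
  have hc : ∀ x y, c x = c y ↔ X j x = X j y := fun x y => by simp [c]
  refine TriColoring.elim (a := fun s => (a s : ZMod p)) (b := b) (c := c) ⟨D.ne, hg, ?_, ?_⟩ hp5
  · intro i
    obtain ⟨x, hx⟩ := mem_pal.1 (e.symm i).2
    refine ⟨x, ?_⟩
    simp only [c, hx]
    simp
  · have hperm : ∀ s t u : Fin 3, s ≠ t → s ≠ u → t ≠ u → (s = 0 ∧ t = 1 ∧ u = 2) ∨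
        (s = 0 ∧ t = 2 ∧ u = 1) ∨ (s = 1 ∧ t = 0 ∧ u = 2) ∨ (s = 1 ∧ t = 2 ∧ u = 0) ∨
        (s = 2 ∧ t = 0 ∧ u = 1) ∨ (s = 2 ∧ t = 1 ∧ u = 0) := by decide
    intro s t u hst hsu htu x y z hxyz
    simp only [hc]
    dsimp only at hxyz
    rcases hperm s t u hst hsu htu with ⟨rfl, rfl, rfl⟩ | ⟨rfl, rfl, rfl⟩ | ⟨rfl, rfl, rfl⟩ |
      ⟨rfl, rfl, rfl⟩ | ⟨rfl, rfl, rfl⟩ | ⟨rfl, rfl, rfl⟩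
    · exact hb x y z (by linear_combination hxyz)
    · have := hb x z y (by linear_combination hxyz); tauto
    · have := hb y x z (by linear_combination hxyz); tauto
    · have := hb z x y (by linear_combination hxyz); tauto
    · have := hb y z x (by linear_combination hxyz); tauto
    · have := hb z y x (by linear_combination hxyz); tauto

/-- The third line of two nonconstant lines is nonconstant, and that of a nonconstant and a constant
line is constant of the same colour. So nonconstant lines may be labelled arbitrarily by two new
colours; this costs one colour, as they share a palette of three. -/
theorem card_le_of_good (hp5 : 5 ≤ p) (hg : Good fun s => (a s : ZMod p))
    (h3 : ∀ j, 1 < #(pal X j) → #(pal X j) = 3) {j : Q} (hj : 1 < #(pal X j)) :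
    #(allPal X) ≤ M + 1 := by
  classical
  have hone : ∃ k, k ≠ j ∧ 1 < #(pal X k) := by
    by_contra! hc
    obtain ⟨l, hl⟩ := D.exists_third 0 1 2 j j
    have hl1 := D.third_nonconstant h3 (by decide) (by decide) (by decide) hl hj hj
    have hlj : l = j := by
      by_contra h
      have := hc l h
      omega
    rw [hlj] at hl
    exact D.card_pal_ne_three_of_self hp5 hg hl (h3 j hj)
  obtain ⟨k, hkj, hk⟩ := hone
  set c : Q → κ ⊕ Bool := fun i => if 1 < #(pal X i) then
    (if i = j then Sum.inr true else Sum.inr false) else Sum.inl (X i 0) with hc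
  have hc1 : ∀ i, ¬ 1 < #(pal X i) → c i = Sum.inl (X i 0) := fun i hi => by simp [hc, hi]
  have hc2 : ∀ i, 1 < #(pal X i) → c i = Sum.inr true ∨ c i = Sum.inr false := fun i hi => by
    simp only [hc, hi, if_true]
    split_ifs <;> simp
  have hfree : RainbowFree a c := by
    intro s t u hst hsu htu x y z hxyz
    by_cases hx : 1 < #(pal X x) <;> by_cases hy : 1 < #(pal X y)
    · have hz := D.third_nonconstant h3 hst hsu htu hxyz hx hy
      rcases hc2 x hx with e1 | e1 <;> rcases hc2 y hy with e2 | e2 <;>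
        rcases hc2 z hz with e3 | e3 <;> simp [e1, e2, e3]
    · have := D.third_constant h3 hst hsu htu hxyz hx (by omega)
      right; right
      rw [hc1 y hy, hc1 z (by omega), this.2]
    · have := D.third_constant h3 hst.symm htu hsu (j := y) (k := x) (l := z)
        (by rw [← hxyz]; abel) hy (by omega)
      right; left
      rw [hc1 x hx, hc1 z (by omega), this.2]
    · by_cases hz : 1 < #(pal X z)
      · have := D.third_constant h3 hsu.symm htu.symm hst (j := z) (k := x) (l := y)
          (by rw [← hxyz]; abel) hz (by omega)
        left
        rw [hc1 x hx, hc1 y hy, this.2]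
      · obtain ⟨b, hb⟩ := D.free s t u hst hsu htu x y z hxyz
        have := hb 0 0 _ (exists_line_point D.ne s t u b 0 0)
        rw [pal_eq_of_mono (by omega : #(pal X z) ≤ 1) _ 0] at this
        rw [hc1 x hx, hc1 y hy, hc1 z hz]
        simpa using this
  have hM := D.bound _ c hfree
  have hsub : insert (Sum.inr true) (insert (Sum.inr false)
      ((allPal X \ pal X j).image Sum.inl)) ⊆ univ.image c := by
    intro o ho
    rw [mem_insert, mem_insert, mem_image] at ho
    rcases ho with rfl | rfl | ⟨q, hq, rfl⟩
    · exact mem_image.2 ⟨j, mem_univ _, by simp [hc, hj]⟩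
    · exact mem_image.2 ⟨k, mem_univ _, by simp [hc, hk, hkj]⟩
    · rw [mem_sdiff, mem_allPal] at hq
      obtain ⟨⟨i, hi⟩, hqj⟩ := hq
      have hi1 : ¬ 1 < #(pal X i) := fun h => hqj (D.pal_subset hp5 hg h3 h hj hi)
      obtain ⟨x, rfl⟩ := mem_pal.1 hi
      exact mem_image.2 ⟨i, mem_univ _, by rw [hc1 i hi1, pal_eq_of_mono (X := X) (by omega) 0 x]⟩
  have h1 := card_le_card hsub
  rw [card_insert_of_notMem (by simp), card_insert_of_notMem (by simp),
    card_image_of_injective _ Sum.inl_injective] at h1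
  have h2 := le_card_sdiff (pal X j) (allPal X)
  have := h3 j hj
  omega

theorem card_le_add_one (hg : Good fun s => (a s : ZMod p))
    (h3 : p = 3 → ∃ s t, (a s : ZMod p) ≠ a t) : #(allPal X) ≤ M + 1 := by
  by_cases h : ∀ j, #(pal X j) ≤ 1
  · have := D.card_le_of_constant h; omega
  push Not at h
  obtain ⟨j, hj⟩ := h
  have hle := D.card_le_of_nonconstant hj
  by_cases h2 : ∃ j, 1 < #(pal X j) ∧ #(pal X j) ≤ 2
  · obtain ⟨j, hj, hj2⟩ := h2
    have := D.card_le_of_nonconstant hj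
    omega
  push Not at h2
  have h3' : ∀ j, 1 < #(pal X j) → #(pal X j) = 3 := fun j hj => by
    have := h2 j hj
    have := D.card_pal_le_three j
    omega
  have hp3 : p ≠ 3 := by
    intro hp3
    obtain ⟨s, t, hst⟩ := h3 hp3
    clear hg h3
    subst hp3
    have hinj : Set.InjOn (X j) (univ : Finset (ZMod 3)) := by
      apply injOn_of_card_image_eq
      have : #(univ.image (X j)) = 3 := h3' j hj
      rw [this, card_univ, ZMod.card]
    have hne : ∀ x y, x ≠ y → X j x ≠ X j y := fun x y hxy h =>
      hxy (hinj (mem_coe.2 (mem_univ x)) (mem_coe.2 (mem_univ y)) h)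
    have hst' : s ≠ t := fun h => hst (by rw [h])
    obtain ⟨u, hsu, htu⟩ := fin3_third s t hst'
    obtain ⟨l, b, -, hC⟩ := D.exists_compat hst' hsu htu j
    have hat := zmod3_neg _ _ (D.ne s) (D.ne t) hst
    obtain ⟨h30, m1, m2, m3⟩ := zmod3_facts
    -- Modulo 3, unequal nonzero coefficients are opposite, so the pairs `(1, 0)`, `(2, 1)`, `(0,
    -- 2)` share a third point. No colour lies in all three pairs of colours.
    have e1 := hC 1 0
    have e2 := hC 2 1
    have e3 := hC 0 2
    dsimp only at e1 e2 e3
    rw [hat] at e1 e2 e3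
    rw [show (a s : ZMod 3) * 1 + -a s * 0 = a s by ring] at e1
    rw [show (a s : ZMod 3) * 2 + -a s * 1 = a s by ring] at e2
    rw [show (a s : ZMod 3) * 0 + -a s * 2 = a s by linear_combination (-(a s : ZMod 3)) * h30] at e3
    have n1 := hne 1 0 m1
    have n2 := hne 2 1 m2
    have n3 := hne 0 2 m3
    rcases e1 with e1 | e1 | e1
    · exact n1 e1
    · rw [e1] at e3
      rcases e3 with e3 | e3 | e3
      · exact n3 e3
      · exact n1 e3
      · exact n2 e3.symm
    · rw [e1] at e2
      rcases e2 with e2 | e2 | e2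
      · exact n2 e2
      · exact n3 e2
      · exact n1 e2.symm
  have hp5 : 5 ≤ p := by
    have h4 : #(pal X j) ≤ #(univ : Finset (ZMod p)) := card_image_le
    rw [card_univ, ZMod.card, h3' j hj] at h4
    by_contra hlt
    have : p = 4 := by omega
    exact absurd (this ▸ hp.out) (by norm_num)
  exact D.card_le_of_good hp5 hg h3' hj

end FibredData

end FibredGood

/-! ### Passing between `ℤ/m` and `ℤ/pm` -/

section Steps

variable {p m : ℕ}

/-- The embedding of `ℤ/p` as the multiples of `m` in `ℤ/pm`. -/
def incl (p m : ℕ) : ZMod p →+ ZMod (p * m) :=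
  ZMod.lift p ⟨(AddMonoidHom.mulRight (m : ZMod (p * m))).comp (Int.castAddHom _), by
    simp [← Nat.cast_mul]⟩

theorem incl_natCast (k : ℕ) : incl p m (k : ZMod p) = (k * m : ℕ) := by
  have : incl p m ((k : ℤ) : ZMod p) = ((k : ℤ) : ZMod (p * m)) * m := by
    rw [incl, ZMod.lift_coe]; rfl
  push_cast at this ⊢
  exact this

/-- The projection of `ℤ/pm` to `ℤ/m`. -/
def proj (p m : ℕ) : ZMod (p * m) →+* ZMod m := ZMod.castHom (Dvd.intro_left p rfl) (ZMod m)

/-- The projection of `ℤ/pm` to `ℤ/p`. -/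
def projP (p m : ℕ) : ZMod (p * m) →+* ZMod p := ZMod.castHom (Dvd.intro m rfl) (ZMod p)

variable [hp : Fact p.Prime] [NeZero m]

theorem exists_incl {g : ZMod (p * m)} (h : proj p m g = 0) : ∃ e, incl p m e = g := by
  have : NeZero (p * m) := ⟨mul_ne_zero hp.out.ne_zero (NeZero.ne m)⟩
  have h1 : ((g.val : ℕ) : ZMod m) = 0 := by
    rw [← h, ← map_natCast (proj p m), ZMod.natCast_zmod_val]
  rw [ZMod.natCast_eq_zero_iff] at h1
  obtain ⟨e, he⟩ := h1
  refine ⟨e, ?_⟩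
  rw [incl_natCast, show e * m = g.val by rw [he, mul_comm], ZMod.natCast_zmod_val]

omit hp in
theorem proj_section (j : ZMod m) : proj p m ((j.val : ℕ) : ZMod (p * m)) = j := by
  rw [map_natCast, ZMod.natCast_zmod_val]

/-- The lines of a colouring of `ℤ/pm`. -/
def lines {κ : Type} (c : ZMod (p * m) → κ) (j : ZMod m) (x : ZMod p) : κ :=
  c ((j.val : ℕ) + incl p m x)

/-- The representatives of a solution in `ℤ/m` sum to zero only up to a multiple of `m` in `ℤ/pm`.
This carry is the constant `b` in `Fibred`. -/
theorem fibred_lines {κ : Type} {a : Fin 3 → ℤ} {c : ZMod (p * m) → κ} (hc : RainbowFree a c) :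
    Fibred a (lines c) := by
  intro s t u hst hsu htu j k l h
  obtain ⟨e, he⟩ := exists_incl (p := p) (m := m)
    (g := a s • ((j.val : ℕ) : ZMod (p * m)) + a t • ((k.val : ℕ) : ZMod (p * m)) +
      a u • ((l.val : ℕ) : ZMod (p * m))) (by
    rw [map_add, map_add, map_zsmul, map_zsmul, map_zsmul, proj_section, proj_section,
      proj_section, h])
  refine ⟨-e, fun x y z hxyz => hc s t u hst hsu htu _ _ _ ?_⟩
  have h1 : a s • incl p m x + a t • incl p m y + a u • incl p m z = -incl p m e := by
    rw [← map_zsmul, ← map_zsmul, ← map_zsmul, ← map_add, ← map_add, ← map_neg, ← hxyz]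
    simp only [zsmul_eq_mul]
  rw [smul_add, smul_add, smul_add, ← neg_add_cancel (incl p m e), ← h1, he]
  abel

theorem fibredData_lines {κ : Type} {a : Fin 3 → ℤ} {c : ZMod (p * m) → κ} (hc : RainbowFree a c)
    (ha : ∀ s, IsUnit (a s : ZMod (p * m))) {M : ℕ}
    (hM : ∀ (κ' : Type) [DecidableEq κ'] (c : ZMod m → κ'), RainbowFree a c → #(univ.image c) ≤ M) :
    FibredData a (lines c) M where
  ne s := by
    have := (ha s).map (projP p m)
    rw [map_intCast] at this
    exact this.ne_zero
  surj s y := by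
    have := (ha s).map (proj p m)
    rw [map_intCast] at this
    obtain ⟨v, hv⟩ := this.exists_right_inv
    refine ⟨v * y, ?_⟩
    dsimp only
    rw [zsmul_eq_mul, ← mul_assoc, hv, one_mul]
  free := fibred_lines hc
  bound := hM

theorem image_subset_allPal {κ : Type} [DecidableEq κ] [NeZero (p * m)] (c : ZMod (p * m) → κ) :
    univ.image c ⊆ allPal (lines c) := by
  intro q hq
  obtain ⟨g, -, rfl⟩ := mem_image.1 hq
  obtain ⟨e, he⟩ := exists_incl (p := p) (m := m)
    (g := g - (((proj p m g).val : ℕ) : ZMod (p * m))) (by rw [map_sub, proj_section, sub_self])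
  refine mem_allPal.2 ⟨proj p m g, mem_pal.2 ⟨e, ?_⟩⟩
  rw [lines, he]; congr 1; ring

/-- Extension of a colouring from the multiples of `p`. -/
noncomputable def extend {κ : Type} (S : Set (ZMod p)) [DecidablePred (· ∈ S)] (c : ZMod m → κ)
    (g : ZMod (p * m)) : κ ⊕ Bool :=
  if projP p m g = 0 then Sum.inl (c ((g.val / p : ℕ) : ZMod m)) else
    Sum.inr (decide (projP p m g ∈ S))

theorem exists_mul_of_projP {g : ZMod (p * m)} (h : projP p m g = 0) : ∃ k, g.val = p * k := by
  have : NeZero (p * m) := ⟨mul_ne_zero hp.out.ne_zero (NeZero.ne m)⟩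
  have h1 : ((g.val : ℕ) : ZMod p) = 0 := by
    rw [← h, ← map_natCast (projP p m), ZMod.natCast_zmod_val]
  rwa [ZMod.natCast_eq_zero_iff] at h1

/-- A solution has all, one or none of its entries divisible by `p`. If all, divide by `p`; if one,
the other two are related by a multiplier and agree on `S`; if none, only two colours are available.
-/
theorem rainbowFree_extend {κ : Type} {a : Fin 3 → ℤ} {S : Set (ZMod p)} [DecidablePred (· ∈ S)]
    (ha : ∀ s, (a s : ZMod p) ≠ 0)
    (hS : ∀ i j, i ≠ j → ∀ x ∈ S, -((a i : ZMod p) / a j) * x ∈ S) {c : ZMod m → κ}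
    (hc : RainbowFree a c) : RainbowFree a (extend S c) := by
  have : NeZero (p * m) := ⟨mul_ne_zero hp.out.ne_zero (NeZero.ne m)⟩
  intro s t u hst hsu htu x y z h
  have hP : (a s : ZMod p) * projP p m x + a t * projP p m y + a u * projP p m z = 0 := by
    have := congrArg (projP p m) h
    simpa only [map_add, map_mul, map_intCast, map_zero, zsmul_eq_mul] using this
  have hpair : ∀ i j, i ≠ j → ∀ v w : ZMod p, (a i : ZMod p) * v + a j * w = 0 →
      (v ∈ S ↔ w ∈ S) := by
    intro i j hij v w hvw
    have e1 : w = -((a i : ZMod p) / a j) * v := by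
      field_simp [ha j]; linear_combination hvw
    have e2 : v = -((a j : ZMod p) / a i) * w := by
      field_simp [ha i]; linear_combination hvw
    exact ⟨fun h => e1 ▸ hS i j hij v h, fun h => e2 ▸ hS j i hij.symm w h⟩
  by_cases hx : projP p m x = 0 <;> by_cases hy : projP p m y = 0 <;>
    by_cases hz : projP p m z = 0
  · obtain ⟨k₁, e₁⟩ := exists_mul_of_projP hx
    obtain ⟨k₂, e₂⟩ := exists_mul_of_projP hy
    obtain ⟨k₃, e₃⟩ := exists_mul_of_projP hz
    have hp0 := hp.out.pos
    simp only [extend, hx, hy, hz, if_true, e₁, e₂, e₃, Nat.mul_div_cancel_left _ hp0,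
      Sum.inl.injEq]
    apply hc s t u hst hsu htu
    have h1 : (((a s * (p * k₁) + a t * (p * k₂) + a u * (p * k₃) : ℤ)) : ZMod (p * m)) = 0 := by
      rw [← h, zsmul_eq_mul, zsmul_eq_mul, zsmul_eq_mul]
      rw [← ZMod.natCast_zmod_val x, ← ZMod.natCast_zmod_val y, ← ZMod.natCast_zmod_val z, e₁, e₂, e₃]
      push_cast
      ring
    rw [ZMod.intCast_zmod_eq_zero_iff_dvd] at h1
    rw [show a s * (p * k₁) + a t * (p * k₂) + a u * (p * k₃) =
      (p : ℤ) * (a s * k₁ + a t * k₂ + a u * k₃) by ring, Nat.cast_mul] at h1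
    have h2 := Int.dvd_of_mul_dvd_mul_left (by exact_mod_cast hp0.ne') h1
    rw [← ZMod.intCast_zmod_eq_zero_iff_dvd] at h2
    simp only [zsmul_eq_mul]
    push_cast at h2
    exact h2
  · rw [hx, hy, mul_zero, mul_zero, zero_add, zero_add] at hP
    exact absurd hP (mul_ne_zero (ha u) hz)
  · rw [hx, hz, mul_zero, mul_zero, zero_add, add_zero] at hP
    exact absurd hP (mul_ne_zero (ha t) hy)
  · right; right
    have := hpair t u htu (projP p m y) (projP p m z) (by rw [← hP, hx]; ring)
    simp [extend, hy, hz, this]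
  · rw [hy, hz, mul_zero, mul_zero, add_zero, add_zero] at hP
    exact absurd hP (mul_ne_zero (ha s) hx)
  · right; left
    have := hpair s u hsu (projP p m x) (projP p m z) (by rw [← hP, hy]; ring)
    simp [extend, hx, hz, this]
  · left
    have := hpair s t hst (projP p m x) (projP p m y) (by rw [← hP, hz]; ring)
    simp [extend, hx, hy, this]
  · by_cases h1 : projP p m x ∈ S <;> by_cases h2 : projP p m y ∈ S <;>
      by_cases h3 : projP p m z ∈ S <;> simp [extend, hx, hy, hz, h1, h2, h3]

theorem inl_mem_extend {κ : Type} [DecidableEq κ] [NeZero (p * m)] (S : Set (ZMod p))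
    [DecidablePred (· ∈ S)] (c : ZMod m → κ) :
    (univ.image c).image Sum.inl ⊆ univ.image (extend S c) := by
  intro o ho
  obtain ⟨q, hq, rfl⟩ := mem_image.1 ho
  obtain ⟨j, -, rfl⟩ := mem_image.1 hq
  refine mem_image.2 ⟨((p * j.val : ℕ) : ZMod (p * m)), mem_univ _, ?_⟩
  have h1 : projP p m ((p * j.val : ℕ) : ZMod (p * m)) = 0 := by
    rw [map_natCast]; simp
  have h2 : ((p * j.val : ℕ) : ZMod (p * m)).val = p * j.val :=
    ZMod.val_cast_of_lt (Nat.mul_lt_mul_of_pos_left (ZMod.val_lt j) hp.out.pos)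
  simp only [extend, h1, if_true, h2, Nat.mul_div_cancel_left _ hp.out.pos, ZMod.natCast_zmod_val]

omit [NeZero m] in
theorem inr_mem_extend {κ : Type} [DecidableEq κ] [NeZero (p * m)] {S : Set (ZMod p)}
    [DecidablePred (· ∈ S)] (c : ZMod m → κ) {x : ZMod p} (hx : x ≠ 0) :
    Sum.inr (decide (x ∈ S)) ∈ univ.image (extend S c) := by
  refine mem_image.2 ⟨((x.val : ℕ) : ZMod (p * m)), mem_univ _, ?_⟩
  simp [extend, hx]

end Steps

/-! ### The maximal number of colours -/

section Maximum

/-- `K` is the maximal number of colours of a rainbow-free colouring of `ℤ/n`. -/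
structure MaxColours (n : ℕ) [NeZero n] (a : Fin 3 → ℤ) (K : ℕ) : Prop where
  upper : ∀ (κ : Type) [DecidableEq κ] (c : ZMod n → κ), RainbowFree a c → #(univ.image c) ≤ K
  attained : ∃ (κ : Type) (_ : DecidableEq κ) (c : ZMod n → κ), RainbowFree a c ∧
    K ≤ #(univ.image c)

open Classical in
/-- The contribution of a prime: `1` for good coefficients, `2` otherwise. -/
noncomputable def contribution (a : Fin 3 → ℤ) (p : ℕ) : ℕ :=
  if ∃ _ : Fact p.Prime, Good fun s => (a s : ZMod p) then 1 else 2

theorem MaxColours.one {a : Fin 3 → ℤ} : MaxColours 1 a 1 where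
  upper κ _ c _ := card_image_le.trans (by simp)
  attained := ⟨Unit, inferInstance, fun _ => (), fun _ _ _ _ _ _ _ _ _ _ => by simp, by simp⟩

/-- For good coefficients the extension uses all nonzero residues as `S`. Otherwise the failure of
goodness is itself a closed set separating two nonzero residues, which yields a second new colour.
-/
theorem MaxColours.mul {a : Fin 3 → ℤ} {p m K : ℕ} [hp : Fact p.Prime] [NeZero m]
    [NeZero (p * m)] (h : MaxColours m a K) (ha : ∀ s, IsUnit (a s : ZMod (p * m)))
    (h3 : p = 3 → ∃ s t, (a s : ZMod p) ≠ a t) : MaxColours (p * m) a (K + contribution a p) where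
  upper κ _ c hc := by
    have D := fibredData_lines hc ha h.upper
    refine (card_le_card (image_subset_allPal c)).trans ?_
    unfold contribution
    split_ifs with hg
    · obtain ⟨_, hg⟩ := hg
      exact D.card_le_add_one hg h3
    · exact D.card_le_add_two
  attained := by
    classical
    obtain ⟨κ, _, c, hc, hK⟩ := h.attained
    have hne : ∀ s, (a s : ZMod p) ≠ 0 := fun s => by
      have := (ha s).map (projP p m)
      rw [map_intCast] at this
      exact this.ne_zero
    have hinl : #((univ.image c).image (Sum.inl : κ → κ ⊕ Bool)) = #(univ.image c) :=
      card_image_of_injective _ Sum.inl_injective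
    unfold contribution
    split_ifs with hg
    · refine ⟨κ ⊕ Bool, inferInstance, extend (p := p) (m := m) {x | x ≠ 0} c,
        rainbowFree_extend hne (fun i j _ x hx => by simpa [hne] using hx) hc, ?_⟩
      have hsub : insert (Sum.inr (decide ((1 : ZMod p) ∈ {x : ZMod p | x ≠ 0})))
          ((univ.image c).image (Sum.inl : κ → κ ⊕ Bool)) ⊆
          univ.image (extend (p := p) (m := m) {x | x ≠ 0} c) :=
        insert_subset (inr_mem_extend c one_ne_zero) (inl_mem_extend _ c)
      have := card_le_card hsub
      rw [card_insert_of_notMem (by simp)] at this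
      omega
    · have hg' : ¬ Good fun s => (a s : ZMod p) := fun h => hg ⟨hp, h⟩
      unfold Good at hg'
      push Not at hg'
      obtain ⟨S, ⟨y, hy⟩, h0, hS, x, hx0, hx⟩ := hg'
      refine ⟨κ ⊕ Bool, inferInstance, extend (p := p) (m := m) S c,
        rainbowFree_extend hne hS hc, ?_⟩
      have hy0 : y ≠ 0 := by rintro rfl; exact h0 hy
      have hsub : insert (Sum.inr (decide (x ∈ S))) (insert (Sum.inr (decide (y ∈ S)))
          ((univ.image c).image (Sum.inl : κ → κ ⊕ Bool))) ⊆
          univ.image (extend (p := p) (m := m) S c) :=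
        insert_subset (inr_mem_extend c hx0)
          (insert_subset (inr_mem_extend c hy0) (inl_mem_extend _ c))
      have := card_le_card hsub
      rw [card_insert_of_notMem (by simp [hx, hy]), card_insert_of_notMem (by simp)] at this
      omega

/-- The total contribution of the prime factors of `n`. -/
noncomputable def totalContribution (a : Fin 3 → ℤ) (n : ℕ) : ℕ :=
  (n.primeFactorsList.map (contribution a)).sum

theorem totalContribution_one (a : Fin 3 → ℤ) : totalContribution a 1 = 0 := by
  simp [totalContribution]

theorem totalContribution_mul (a : Fin 3 → ℤ) {m n : ℕ} (hm : m ≠ 0) (hn : n ≠ 0) :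
    totalContribution a (m * n) = totalContribution a m + totalContribution a n := by
  unfold totalContribution
  rw [((Nat.perm_primeFactorsList_mul hm hn).map _).sum_eq, List.map_append, List.sum_append]

theorem totalContribution_prime (a : Fin 3 → ℤ) {p : ℕ} (hp : p.Prime) :
    totalContribution a p = contribution a p := by
  simp [totalContribution, Nat.primeFactorsList_prime hp]

theorem totalContribution_pow (a : Fin 3 → ℤ) {p : ℕ} (hp : p.Prime) (k : ℕ) :
    totalContribution a (p ^ k) = k * contribution a p := by
  induction k with
  | zero => simp [totalContribution_one]
  | succ k ih =>
    rw [pow_succ, totalContribution_mul a (pow_ne_zero _ hp.ne_zero) hp.ne_zero, ih,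
      totalContribution_prime a hp]
    ring

theorem totalContribution_prod (a : Fin 3 → ℤ) {ι : Type*} (S : Finset ι) (p α : ι → ℕ)
    (hp : ∀ k, (p k).Prime) :
    totalContribution a (∏ k ∈ S, p k ^ α k) = ∑ k ∈ S, α k * contribution a (p k) := by
  classical
  induction S using Finset.induction_on with
  | empty => simp [totalContribution_one]
  | insert k S hk ih =>
    rw [prod_insert hk, sum_insert hk, totalContribution_mul a (pow_ne_zero _ (hp k).ne_zero)
      (prod_ne_zero_iff.2 fun k _ => pow_ne_zero _ (hp k).ne_zero), ih,
      totalContribution_pow a (hp k)]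

theorem maxColours (a : Fin 3 → ℤ) (n : ℕ) [NeZero n] (ha : ∀ s, IsUnit (a s : ZMod n))
    (h3 : 3 ∣ n → ∃ s t, (a s : ZMod 3) ≠ a t) : MaxColours n a (1 + totalContribution a n) := by
  have hn := NeZero.ne n
  have key : ∀ n : ℕ, ∀ hn : n ≠ 0, (∀ s, IsUnit (a s : ZMod n)) →
      (3 ∣ n → ∃ s t, (a s : ZMod 3) ≠ a t) →
      haveI : NeZero n := ⟨hn⟩
      MaxColours n a (1 + totalContribution a n) := by
    intro n
    induction n using induction_on_primes with
    | zero => intro h; exact absurd rfl h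
    | one => intro _ _ _; rw [totalContribution_one]; exact MaxColours.one
    | prime_mul p m hp ih =>
      intro hn ha h3
      have hm : m ≠ 0 := (mul_ne_zero_iff.1 hn).2
      have : Fact p.Prime := ⟨hp⟩
      have : NeZero m := ⟨hm⟩
      have : NeZero (p * m) := ⟨hn⟩
      have h1 := ih hm (fun s => by
        have := (ha s).map (proj p m)
        rwa [map_intCast] at this) (fun h => h3 (h.mul_left p))
      have h2 := h1.mul (p := p) ha (by
        rintro rfl; exact h3 (dvd_mul_right 3 m))
      rw [totalContribution_mul a hp.ne_zero hm, totalContribution_prime a hp,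
        add_comm (contribution a p), ← add_assoc]
      exact h2
  exact key n hn ha h3

end Maximum

/-! ### From maximal colourings to the rainbow number -/

section RainbowNumber

theorem rainbowFree_of_not {n : ℕ} {a₁ a₂ a₃ : ℤ} {r : ℕ} {c : ZMod n → Fin r} :
    ¬ HasRainbowSolution n a₁ a₂ a₃ 0 c ↔ RainbowFree ![a₁, a₂, a₃] c := by
  have hperm : ∀ s t u : Fin 3, s ≠ t → s ≠ u → t ≠ u → (s = 0 ∧ t = 1 ∧ u = 2) ∨
      (s = 0 ∧ t = 2 ∧ u = 1) ∨ (s = 1 ∧ t = 0 ∧ u = 2) ∨ (s = 1 ∧ t = 2 ∧ u = 0) ∨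
      (s = 2 ∧ t = 0 ∧ u = 1) ∨ (s = 2 ∧ t = 1 ∧ u = 0) := by decide
  constructor
  · intro h
    have hb : ∀ x y z : ZMod n, (a₁ : ZMod n) * x + a₂ * y + a₃ * z = 0 →
        c x = c y ∨ c x = c z ∨ c y = c z := by
      intro x y z hxyz
      by_contra! hc
      exact h ⟨x, y, z, by simpa [IsSolution] using hxyz, hc.1, hc.2.1, hc.2.2⟩
    intro s t u hst hsu htu x y z hxyz
    rcases hperm s t u hst hsu htu with ⟨rfl, rfl, rfl⟩ | ⟨rfl, rfl, rfl⟩ | ⟨rfl, rfl, rfl⟩ |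
      ⟨rfl, rfl, rfl⟩ | ⟨rfl, rfl, rfl⟩ | ⟨rfl, rfl, rfl⟩ <;>
      simp [zsmul_eq_mul] at hxyz
    · exact hb x y z (by linear_combination hxyz)
    · have := hb x z y (by linear_combination hxyz); tauto
    · have := hb y x z (by linear_combination hxyz); tauto
    · have := hb z x y (by linear_combination hxyz); tauto
    · have := hb y z x (by linear_combination hxyz); tauto
    · have := hb z y x (by linear_combination hxyz); tauto
  · rintro h ⟨x, y, z, hs, h1, h2, h3⟩
    have := h 0 1 2 (by decide) (by decide) (by decide) x y z (by
      simpa [IsSolution, zsmul_eq_mul] using hs)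
    tauto

/-- For `r ≤ K`, keeping `r` colours of an optimal colouring and merging the rest into one of them
gives an exact rainbow-free `r`-colouring. -/
theorem rainbowNumber_eq_of_maxColours {n : ℕ} [NeZero n] {a₁ a₂ a₃ : ℤ} {K : ℕ}
    (h : MaxColours n ![a₁, a₂, a₃] K) : rainbowNumber n a₁ a₂ a₃ 0 = K + 1 := by
  apply le_antisymm
  · apply Nat.sInf_le
    refine ⟨Nat.succ_pos K, fun c hc => ?_⟩
    by_contra hno
    have := h.upper _ c (rainbowFree_of_not.1 hno)
    rw [image_univ_of_surjective hc, card_univ, Fintype.card_fin] at this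
    omega
  · apply le_csInf ⟨_, rainbowNumber_set_nonempty n (NeZero.pos n) a₁ a₂ a₃ 0⟩
    rintro r ⟨hr, hall⟩
    by_contra! hlt
    obtain ⟨κ, _, c, hc, hK⟩ := h.attained
    obtain ⟨P, hP, hPc⟩ := exists_subset_card_eq (show r ≤ #(univ.image c) by omega)
    let e := Fintype.equivFinOfCardEq (α := P) (n := r) (by simpa using hPc)
    set g : κ → Fin r := fun q => if h : q ∈ P then e ⟨q, h⟩ else ⟨0, hr⟩ with hg
    have hsurj : Function.Surjective fun x => g (c x) := by
      intro i
      obtain ⟨x, -, hx⟩ := mem_image.1 (hP (e.symm i).2)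
      refine ⟨x, ?_⟩
      simp only [hg, hx]
      rw [dif_pos (e.symm i).2]
      simp
    refine rainbowFree_of_not.2 ?_ (hall _ hsurj)
    intro s t u hst hsu htu x y z hxyz
    exact (hc s t u hst hsu htu x y z hxyz).imp (congrArg g) (Or.imp (congrArg g) (congrArg g))

theorem hasRainbowSolution_shift {n : ℕ} {a₁ a₂ a₃ b : ℤ} {t : ZMod n}
    (ht : ((a₁ + a₂ + a₃ : ℤ) : ZMod n) * t = b) {r : ℕ} {c : ZMod n → Fin r} :
    HasRainbowSolution n a₁ a₂ a₃ b c ↔ HasRainbowSolution n a₁ a₂ a₃ 0 fun x => c (x + t) := by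
  push_cast at ht
  constructor
  · rintro ⟨x, y, z, hs, h⟩
    refine ⟨x - t, y - t, z - t, ?_, by simpa using h⟩
    simp only [IsSolution] at hs ⊢
    push_cast
    linear_combination hs - ht
  · rintro ⟨x, y, z, hs, h⟩
    refine ⟨x + t, y + t, z + t, ?_, h⟩
    simp only [IsSolution] at hs ⊢
    push_cast at hs
    linear_combination hs + ht

theorem rainbowNumber_shift {n : ℕ} {a₁ a₂ a₃ b : ℤ} {t : ZMod n}
    (ht : ((a₁ + a₂ + a₃ : ℤ) : ZMod n) * t = b) :
    rainbowNumber n a₁ a₂ a₃ b = rainbowNumber n a₁ a₂ a₃ 0 := by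
  unfold rainbowNumber
  congr 1
  ext r
  refine and_congr_right fun _ => ?_
  constructor
  · intro h c hc
    have := h (fun x => c (x - t)) (hc.comp (Equiv.subRight t).surjective)
    rw [hasRainbowSolution_shift ht] at this
    simpa using this
  · intro h c hc
    rw [hasRainbowSolution_shift ht]
    exact h _ (hc.comp (Equiv.addRight t).surjective)

theorem isUnit_of_dvd {m n : ℕ} (h : m ∣ n) {z : ℤ} (hz : IsUnit (z : ZMod n)) :
    IsUnit (z : ZMod m) := by
  have := hz.map (ZMod.castHom h (ZMod m))
  rwa [map_intCast] at this

theorem rainbowNumber_eq {n : ℕ} [NeZero n] {a₁ a₂ a₃ b : ℤ}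
    (ha : IsUnit ((a₁ * a₂ * a₃ : ℤ) : ZMod n))
    (hb : ∃ t, ((a₁ + a₂ + a₃ : ℤ) : ZMod n) * t = b)
    (h3 : 3 ∣ n → IsUnit ((a₁ + a₂ + a₃ : ℤ) : ZMod 3)) :
    rainbowNumber n a₁ a₂ a₃ b = 2 + totalContribution ![a₁, a₂, a₃] n := by
  obtain ⟨t, ht⟩ := hb
  rw [rainbowNumber_shift ht, rainbowNumber_eq_of_maxColours (maxColours ![a₁, a₂, a₃] n ?_ ?_)]
  · ring
  · push_cast at ha
    rw [IsUnit.mul_iff, IsUnit.mul_iff] at ha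
    intro s
    fin_cases s
    · exact ha.1.1
    · exact ha.1.2
    · exact ha.2
  · intro hd
    -- Were the three coefficients equal modulo 3, their sum would vanish there.
    by_contra! hall
    have e1 := hall 0 1
    have e2 := hall 0 2
    simp only [Matrix.cons_val_zero, Matrix.cons_val_one, Matrix.cons_val] at e1 e2
    have := h3 hd
    push_cast at this
    rw [← e1, ← e2] at this
    have h30 : (a₁ : ZMod 3) + a₁ + a₁ = 0 := by
      generalize (a₁ : ZMod 3) = x
      revert x; decide
    rw [h30] at this
    exact not_isUnit_zero this

end RainbowNumber

end RainbowZMod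

theorem mainTheorem1 (l : ℕ) (p α : Fin l → ℕ) (hp : ∀ k, (p k).Prime) (n : ℕ)
    (hn : n = ∏ k, p k ^ α k) (a₁ a₂ a₃ b : ℤ) (ha : IsUnit ((a₁ * a₂ * a₃ : ℤ) : ZMod n))
    (h : ((b : ZMod n) ≠ 0 ∧ IsUnit ((a₁ + a₂ + a₃ : ℤ) : ZMod n)) ∨
      ((b : ZMod n) = 0 ∧ ¬ 3 ∣ n) ∨
      ((b : ZMod n) = 0 ∧ 3 ∣ n ∧ IsUnit ((a₁ + a₂ + a₃ : ℤ) : ZMod 3))) :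
    (rainbowNumber n a₁ a₂ a₃ b : ℤ) =
      2 + ∑ k, (α k : ℤ) * ((rainbowNumber (p k) a₁ a₂ a₃ b : ℤ) - 2) := by
  have hn0 : n ≠ 0 := by
    rw [hn]; exact Finset.prod_ne_zero_iff.2 fun k _ => pow_ne_zero _ (hp k).ne_zero
  have hb : ∀ m, m ∣ n → ∃ t, ((a₁ + a₂ + a₃ : ℤ) : ZMod m) * t = b := by
    intro m hm
    have hzero : (b : ZMod n) = 0 → ∃ t, ((a₁ + a₂ + a₃ : ℤ) : ZMod m) * t = b := by
      intro h0
      refine ⟨0, ?_⟩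
      rw [mul_zero, eq_comm, ← map_intCast (ZMod.castHom hm (ZMod m)), h0, map_zero]
    rcases h with h | h | h
    · obtain ⟨v, hv⟩ := (RainbowZMod.isUnit_of_dvd hm h.2).exists_right_inv
      exact ⟨v * b, by rw [← mul_assoc, hv, one_mul]⟩
    · exact hzero h.1
    · exact hzero h.1
  have h3 : 3 ∣ n → IsUnit ((a₁ + a₂ + a₃ : ℤ) : ZMod 3) := by
    intro hd
    rcases h with h | h | h
    · exact RainbowZMod.isUnit_of_dvd hd h.2
    · exact absurd hd h.2
    · exact h.2.2
  -- The same formula serves `n` and each prime divisor, where it reads `contribution = rb - 2`.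
  -- Additivity over products needs no distinctness of the `p k`.
  have key : ∀ m, m ∣ n → rainbowNumber m a₁ a₂ a₃ b =
      2 + RainbowZMod.totalContribution ![a₁, a₂, a₃] m := by
    intro m hm
    have : NeZero m := ⟨fun h => hn0 (by rw [h] at hm; exact zero_dvd_iff.1 hm)⟩
    exact RainbowZMod.rainbowNumber_eq (RainbowZMod.isUnit_of_dvd hm ha) (hb m hm)
      fun h => h3 (h.trans hm)
  rw [key n dvd_rfl, hn, RainbowZMod.totalContribution_prod _ _ p α hp]
  push_cast
  congr 1
  refine Finset.sum_congr rfl fun k _ => ?_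
  -- A prime with exponent zero need not divide `n`, so nothing is known of its rainbow number; its
  -- term vanishes.
  rcases Nat.eq_zero_or_pos (α k) with h0 | h0
  · simp [h0]
  · have hd : p k ∣ n := by
      rw [hn]
      exact (dvd_pow_self _ h0.ne').trans (Finset.dvd_prod_of_mem _ (Finset.mem_univ k))
    rw [key _ hd, RainbowZMod.totalContribution_prime _ (hp k)]
    push_cast
    ring
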